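/- Let $k\ge 1$ and, for $\mathcal V=(\mu,\Sigma,\nu)\in\Theta:=\mathbb R^k\times S_k\times(0,\infty)$ with $S_k$ the set of symmetric positive definite $k\times k$ matrices, let $$f_{\mathcal V}(x)=\frac{\Gamma(\frac{\nu+k}{2})}{(\pi\nu)^{k/2}\,\Gamma(\frac{\nu}{2})}\,|\Sigma|^{-1/2}\Bigl(1+\tfrac1\nu\,(x-\mu)'\Sigma^{-1}(x-\mu)\Bigr)^{-\frac{\nu+k}{2}},\qquad x\in\mathbb R^k,$$ be the $k$-variate Student $t$ density, and let $\mathrm P^{(n)}_{\mathcal V}$ be the joint law of $n$ i.i.d. observations $X_1,\dots,X_n$ with density $f_{\mathcal V}$. Let $\mathcal L^{(2)}_{\mathcal V}=D_{\mathrm{vech}\,\Sigma}\log f_{\mathcal V}$ (gradient with respect to the entries of the symmetric matrix $\Sigma$ on and above the diagonal) and $\mathcal L^{(3)}_{\mathcal V}=D_\nu\log f_{\mathcal V}$ be the scores for scatter and tail weight. Let $\Gamma_{22}(\mathcal V)$, $\Gamma_{23}(\mathcal V)$, $\Gamma_{33}(\mathcal V)$ be, respectively, the covariance matrix of $\mathcal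 L^{(2)}_{\mathcal V}(X)$, the covariance of $\mathcal L^{(2)}_{\mathcal V}(X)$ with $\mathcal L^{(3)}_{\mathcal V}(X)$, and the variance of $\mathcal L^{(3)}_{\mathcal V}(X)$, for $X$ with density $f_{\mathcal V}$. Put $\Delta^{(n)}_i(\mathcal V)=n^{-1/2}\sum_{j=1}^n\mathcal L^{(i)}_{\mathcal V}(X_j)$ for $i=2,3$ and $$\Delta_3^{(n)*}(\mathcal V)=\Delta_3^{(n)}(\mathcal V)-\Gamma_{23}(\mathcal V)'\,\Gamma_{22}(\mathcal V)^{-1}\Delta_2^{(n)}(\mathcal V),\qquad \Gamma_{33}^*(\mathcal V)=\Gamma_{33}(\mathcal V)-\Gamma_{23}(\mathcal V)'\,\Gamma_{22}(\mathcal V)^{-1}\Gamma_{23}(\mathcal V).$$ Let $\hat\mu^{(n)}$, $\hat\Sigma^{(n)}$ (symmetric) and $\hat\nu^{(n)}$ be measurable functions of $X_1,\dots,X_n$ with values in $\mathbb R^k$, the $k\times k$ matrices and $\mathbb R$. Suppose that, for $\lambda$ each of the parameters $\mu,\Sigma,\nu$ and $\hat\lambda^{(n)}$ its estimator, (i) (root-$n$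 consistency) $n^{1/2}(\hat\lambda^{(n)}-\lambda)=O_{\mathrm P}(1)$ under $\mathrm P^{(n)}_{\mathcal V}$, for every $\mathcal V\in\Theta$; (ii) (local asymptotic discreteness) for every value of $\lambda$ in its parameter space and every $c>0$, the number of possible values of $\hat\lambda^{(n)}$ in the ball of radius $c\,n^{-1/2}$ centred at $\lambda$ is bounded as $n\to\infty$. Write $\hat{\mathcal V}^{(n)}=(\hat\mu^{(n)},\hat\Sigma^{(n)},\hat\nu^{(n)})$ and define the one-step estimator by $$\hat\nu^{(n)}_{Cam}=\hat\nu^{(n)}+n^{-1/2}\bigl(\Gamma^*_{33}(\hat{\mathcal V}^{(n)})\bigr)^{-1}\Delta_3^{(n)*}(\hat{\mathcal V}^{(n)})$$ when $\hat{\mathcal V}^{(n)}\in\Theta$, and $\hat\nu^{(n)}_{Cam}=\hat\nu^{(n)}$ otherwise. Then, for every $\mathcal V\in\Theta$, $\Gamma_{22}(\mathcal V)$ is positive definite, $\Gamma^*_{33}(\mathcal V)>0$ and, under $\mathrm P^{(n)}_{\mathcal V}$, $$n^{1/2}\bigl(\hat\nu^{(n)}_{Cam}-\nu\bigr)\xrightarrow{\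 \mathcal L\ }\mathcal N\bigl(0,\,1/\Gamma^*_{33}(\mathcal V)\bigr)\qquad(n\to\infty).$$ Moreover $\hat\nu^{(n)}_{Cam}$ is asymptotically efficient for $\nu$ (best regular) at every $\mathcal V\in\Theta$. Here a sequence of measurable real-valued statistics $T_n$ is called regular at $\mathcal V$ with limit law $L$ if, for every $h=(h_1,h_2,h_3)\in\mathbb R^k\times M_k\times\mathbb R$ with $h_2$ symmetric ($M_k$ being the $k\times k$ matrices), $n^{1/2}\bigl(T_n-(\nu+n^{-1/2}h_3)\bigr)\to L$ in distribution under $\mathrm P^{(n)}_{\mathcal V+n^{-1/2}h}$, with the same $L$ for all $h$. Asymptotic efficiency means that $\hat\nu^{(n)}_{Cam}$ is regular at every $\mathcal V\in\Theta$ with some limit law $L_{\mathcal V}$, and that the limit law of any sequence of estimators which is regular at $\mathcal V$ is a convolution $L_{\mathcal V}*M$ for some probability measure $M$ on $\mathbb R$. -/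

import Mathlib

open MeasureTheory ProbabilityTheory Filter Topology
open scoped Matrix BoundedContinuousFunction

noncomputable section

namespace StudentT

/-- Ambient space of the parameters `V = (μ, Σ, ν)`: location, scatter matrix, tail weight.
It is also the space of local perturbations of such parameters. -/
abbrev Param (k : ℕ) : Type := (Fin k → ℝ) × Matrix (Fin k) (Fin k) ℝ × ℝ

/-- The parameter space `ℝ^k × S_k × (0, ∞)`, with `S_k` the symmetric positive definite
matrices. -/
def paramSpace (k : ℕ) : Set (Param k) := {V | V.2.1.PosDef ∧ 0 < V.2.2}

/-- Samples of `n` observations in `ℝ^k`. -/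
abbrev Sample (k n : ℕ) : Type := Fin n → Fin k → ℝ

/-- The normalizing constant `c_{ν,k} = Γ((ν+k)/2) / ((πν)^{k/2} Γ(ν/2))`. -/
def normConst (k : ℕ) (ν : ℝ) : ℝ :=
  Real.Gamma ((ν + k) / 2) / ((Real.pi * ν) ^ ((k : ℝ) / 2) * Real.Gamma (ν / 2))

/-- The squared Mahalanobis distance `‖Σ^{-1/2}(x - μ)‖² = (x - μ)' Σ⁻¹ (x - μ)`. -/
def sqMahalanobis {k : ℕ} (m : Fin k → ℝ) (S : Matrix (Fin k) (Fin k) ℝ) (x : Fin k → ℝ) : ℝ :=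
  (x - m) ⬝ᵥ (S⁻¹ *ᵥ (x - m))

/-- The density of the `k`-variate Student `t` distribution. -/
def density {k : ℕ} (V : Param k) (x : Fin k → ℝ) : ℝ :=
  normConst k V.2.2 * V.2.1.det ^ (-(1 / 2) : ℝ) *
    (1 + sqMahalanobis V.1 V.2.1 x / V.2.2) ^ (-((V.2.2 + k) / 2))

/-- The `k`-variate Student `t` distribution. -/
def law {k : ℕ} (V : Param k) : Measure (Fin k → ℝ) :=
  volume.withDensity fun x => ENNReal.ofReal (density V x)

/-- The joint distribution of `n` independent observations from `law V`. -/
def sampleLaw {k : ℕ} (n : ℕ) (V : Param k) : Measure (Sample k n) :=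
  Measure.pi fun _ => law V

/-- Index set of `vech`: the positions on and above the diagonal. -/
abbrev VechIdx (k : ℕ) : Type := {p : Fin k × Fin k // p.1 ≤ p.2}

/-- The symmetric matrix `A` with `vech A` the `p`-th unit vector. -/
def symUnit {k : ℕ} (p : VechIdx k) : Matrix (Fin k) (Fin k) ℝ :=
  Matrix.of fun i j => if (min i j, max i j) = p.1 then 1 else 0

/-- The scatter part of the score: the gradient of the log-density in `vech Σ`. -/
def scoreScatter {k : ℕ} (V : Param k) (x : Fin k → ℝ) : VechIdx k → ℝ :=
  fun p => deriv (fun t : ℝ => Real.log (density (V.1, V.2.1 + t • symUnit p, V.2.2) x)) 0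

/-- The tail part of the score: the derivative of the log-density in `ν`. -/
def scoreTail {k : ℕ} (V : Param k) (x : Fin k → ℝ) : ℝ :=
  deriv (fun ν : ℝ => Real.log (density (V.1, V.2.1, ν) x)) V.2.2

/-- The scatter block of the Fisher information. -/
def infoSS {k : ℕ} (V : Param k) : Matrix (VechIdx k) (VechIdx k) ℝ :=
  Matrix.of fun p q => cov[fun x => scoreScatter V x p, fun x => scoreScatter V x q; law V]

/-- The scatter-tail block of the Fisher information. -/
def infoST {k : ℕ} (V : Param k) : VechIdx k → ℝ :=
  fun p => cov[fun x => scoreScatter V x p, scoreTail V; law V]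

/-- The tail entry of the Fisher information. -/
def infoTT {k : ℕ} (V : Param k) : ℝ := cov[scoreTail V, scoreTail V; law V]

/-- The scatter part of the central sequence. -/
def centralScatter {k n : ℕ} (V : Param k) (x : Sample k n) : VechIdx k → ℝ :=
  (√(n : ℝ))⁻¹ • ∑ i, scoreScatter V (x i)

/-- The tail part of the central sequence. -/
def centralTail {k n : ℕ} (V : Param k) (x : Sample k n) : ℝ :=
  (√(n : ℝ))⁻¹ * ∑ i, scoreTail V (x i)

/-- The efficient central sequence for tail weight. -/
def effCentral {k n : ℕ} (V : Param k) (x : Sample k n) : ℝ :=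
  centralTail V x - infoST V ⬝ᵥ ((infoSS V)⁻¹ *ᵥ centralScatter V x)

/-- The efficient Fisher information for tail weight. -/
def effInfo {k : ℕ} (V : Param k) : ℝ :=
  infoTT V - infoST V ⬝ᵥ ((infoSS V)⁻¹ *ᵥ infoST V)

/-- `est` is root-`n` consistent for `g V`: `√n (est - g V) = O_P(1)` under `V`, for every `V`. -/
def RootNConsistent {k : ℕ} {F : Type*} [PseudoMetricSpace F]
    (est : ∀ n, Sample k n → F) (g : Param k → F) : Prop :=
  ∀ V ∈ paramSpace k, ∀ ε : ℝ, 0 < ε → ∃ C : ℝ, ∀ᶠ n : ℕ in atTop,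
    sampleLaw n V {x | C < √(n : ℝ) * dist (est n x) (g V)} ≤ ENNReal.ofReal ε

/-- `est` is locally asymptotically discrete: the number of its possible values in a ball of
radius `c n^{-1/2}` about a possible value `g V` of the parameter stays bounded as `n → ∞`. -/
def LocallyDiscrete {k : ℕ} {F : Type*} [PseudoMetricSpace F]
    (est : ∀ n, Sample k n → F) (g : Param k → F) : Prop :=
  ∀ V ∈ paramSpace k, ∀ c : ℝ, 0 < c → ∃ N : ℕ, ∀ᶠ n : ℕ in atTop,
    (Set.range (est n) ∩ Metric.closedBall (g V) (c / √(n : ℝ))).encard ≤ N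

open Classical in
/-- The one-step estimator of `ν` built on preliminary estimators of `μ`, `Σ`, `ν`. The efficient
central sequence and information only make sense on the parameter space; where the preliminary
estimate falls outside it, the preliminary estimate of `ν` is kept. -/
def oneStep {k : ℕ} (locEst : ∀ n, Sample k n → Fin k → ℝ)
    (scatEst : ∀ n, Sample k n → Matrix (Fin k) (Fin k) ℝ) (tailEst : ∀ n, Sample k n → ℝ)
    (n : ℕ) (x : Sample k n) : ℝ :=
  let V : Param k := (locEst n x, scatEst n x, tailEst n x)
  if V ∈ paramSpace k then tailEst n x + (√(n : ℝ))⁻¹ * ((effInfo V)⁻¹ * effCentral V x)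
  else tailEst n x

/-- Weak convergence to `L` of the distribution of `Y n` under `P n`. -/
def TendstoLaw {Ω : ℕ → Type*} [∀ n, MeasurableSpace (Ω n)] (P : ∀ n, Measure (Ω n))
    (Y : ∀ n, Ω n → ℝ) (L : Measure ℝ) : Prop :=
  ∀ f : ℝ →ᵇ ℝ, Tendsto (fun n => ∫ ω, f (Y n ω) ∂P n) atTop (𝓝 (∫ y, f y ∂L))

/-- The local perturbation `V + n^{-1/2} h` of the parameter `V`. -/
def localParam {k : ℕ} (V h : Param k) (n : ℕ) : Param k := V + (√(n : ℝ))⁻¹ • h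

/-- `T` is a regular sequence of estimators of `ν` at `V` with limit distribution `L`: under every
local perturbation `V + n^{-1/2} h` of all the parameters, the centred and scaled estimator
converges in distribution to the same `L`. -/
def IsRegularAt {k : ℕ} (T : ∀ n, Sample k n → ℝ) (V : Param k) (L : Measure ℝ) : Prop :=
  (∀ n, Measurable (T n)) ∧
    ∀ h : Param k, h.2.1.IsSymm →
      TendstoLaw (fun n => sampleLaw n (localParam V h n))
        (fun n x => √(n : ℝ) * (T n x - (localParam V h n).2.2)) L

/-- `T` is asymptotically efficient for `ν` (best regular): at every parameter value it is
regular, and the limit distribution of any regular sequence of estimators of `ν` is the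
convolution of the limit distribution of `T` with some probability measure. -/
def IsAsymptoticallyEfficient {k : ℕ} (T : ∀ n, Sample k n → ℝ) : Prop :=
  ∀ V ∈ paramSpace k, ∃ L : Measure ℝ, IsProbabilityMeasure L ∧ IsRegularAt T V L ∧
    ∀ (T' : ∀ n, Sample k n → ℝ) (L' : Measure ℝ), IsProbabilityMeasure L' →
      IsRegularAt T' V L' →
        ∃ M : Measure ℝ, IsProbabilityMeasure M ∧ L' = Measure.conv L M

end StudentT

end

/-! Up to a term free of the parameter and the term -(ν/2) log(1 + |x|²), linear in ν, the Student
log-density is a smooth function of the parameter and of the direction of (1, x), which stays in a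
compact sphere. Hence the second order expansion of the log-likelihood ratio r and the first order
expansion of the score s hold uniformly in x, with a bounded Hessian. `LocalModel` isolates this
situation, and the general asymptotic theory is developed from it.

Since likelihood ratios integrate to one, the uniform expansion gives the score small exponential
moments and, for complex α and β, E exp(τ α s(a) + β r(τ h)) = 1 + τ² (α² I(a,a)/2 + α β I(a,h) +
(β² - β) I(h,h)/2) + o(τ²), with I the Fisher information (`tendsto_integral_cexp`). The n-th power
at τ = n^(-1/2) gives the Gaussian limits for samples (`tendsto_integral_cexp_sample`). Suitable
exponents then yield contiguity (`whp_localLaw_le`), the limit of the central sequence under local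
alternatives (`tendsto_charFun_localLaw`) and the mean square approximation of likelihood ratios
(`tendsto_integral_sq_ratio_sub`).

The central sequence may be evaluated at a random root-n consistent parameter, at the cost of an
information term (`tendsto_centralSeq_sub`). The efficient direction v satisfies I(v, h) = Γ₃₃* h₃
for all h: location is orthogonal to the rest by reflection about μ, and scatter is projected out
(`info_effDir`). So in the one-step estimator the information term cancels the preliminary error,
and n^(1/2) times the error of the estimator is the central sequence in direction v divided by Γ₃₃*,
up to o_P(1). Contiguity turns this into regularity with limit N(0, 1/Γ₃₃*).

For the convolution theorem (`exists_eq_conv`), take a limit point π of the joint law of a regular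
statistic and the central sequence in direction v. Regularity along t v determines E exp(iuY + tΔ)
under π for real t; both sides are entire in t, and t = -iu/Γ₃₃* shows that the limit law has the
characteristic function of N(0, 1/Γ₃₃*) times that of Y - Δ/Γ₃₃*.

Positivity of Γ₂₂ and Γ₃₃* holds because no nonzero combination of scatter and tail scores vanishes
identically (`eq_zero_of_score_eq_zero`): along rays it would make log(1 + τ) proportional to τ/(1 +
τ). -/

open MeasureTheory ProbabilityTheory Filter Topology
open scoped Matrix BoundedContinuousFunction

noncomputable section

namespace StudentT

section

/-! ### Convergence and boundedness in probability. -/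

section InProbability

variable {Ω : ℕ → Type*} [∀ n, MeasurableSpace (Ω n)] {P : ∀ n, Measure (Ω n)}

/-- The filter of sequences of events whose probability tends to one. Convergence in probability
is convergence along this filter. -/
def whp (P : ∀ n, Measure (Ω n)) : Filter (Σ n, Ω n) where
  sets := {A | Tendsto (fun n => P n {ω | ⟨n, ω⟩ ∉ A}) atTop (𝓝 0)}
  univ_sets := by simp
  sets_of_superset {A B} hA hAB := by
    refine tendsto_of_tendsto_of_tendsto_of_le_of_le tendsto_const_nhds hA (fun _ => zero_le)
      fun n => measure_mono fun ω hω h => hω (hAB h)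
  inter_sets {A B} hA hB := by
    have h : Tendsto (fun n => P n {ω | ⟨n, ω⟩ ∉ A} + P n {ω | ⟨n, ω⟩ ∉ B}) atTop (𝓝 0) := by
      simpa using hA.add hB
    refine tendsto_of_tendsto_of_tendsto_of_le_of_le tendsto_const_nhds h (fun _ => zero_le)
      fun n => (measure_mono fun ω hω => ?_).trans (measure_union_le _ _)
    by_contra hc
    simp only [Set.mem_union, Set.mem_ofPred_eq, not_or, not_not] at hc
    exact hω hc

lemma eventually_whp {p : (Σ n, Ω n) → Prop} :
    (∀ᶠ z in whp P, p z) ↔ Tendsto (fun n => P n {ω | ¬ p ⟨n, ω⟩}) atTop (𝓝 0) := Iff.rfl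

lemma tendsto_fst_whp : Tendsto Sigma.fst (whp P) atTop := by
  refine tendsto_atTop.2 fun N => eventually_whp.2 (tendsto_const_nhds.congr' ?_)
  filter_upwards [eventually_ge_atTop N] with n hn
  simp [hn]

/-- Boundedness in probability. -/
def BoundedInProb (P : ∀ n, Measure (Ω n)) (Z : (Σ n, Ω n) → ℝ) : Prop :=
  ∀ ε : ℝ, 0 < ε → ∃ C : ℝ, ∀ᶠ n in atTop, P n {ω | C < |Z ⟨n, ω⟩|} ≤ ENNReal.ofReal ε

lemma BoundedInProb.mono {Z W : (Σ n, Ω n) → ℝ} (hZ : BoundedInProb P Z)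
    (h : ∀ z, |W z| ≤ |Z z|) : BoundedInProb P W := fun ε hε => by
  obtain ⟨C, hC⟩ := hZ ε hε
  exact ⟨C, hC.mono fun n hn => (measure_mono fun ω hω => lt_of_lt_of_le hω (h _)).trans hn⟩

lemma BoundedInProb.const_mul {Z : (Σ n, Ω n) → ℝ} (hZ : BoundedInProb P Z) (c : ℝ) :
    BoundedInProb P fun z => c * Z z := fun ε hε => by
  obtain ⟨C, hC⟩ := hZ ε hε
  refine ⟨|c| * C, hC.mono fun n hn => (measure_mono fun ω hω => ?_).trans hn⟩
  simp only [Set.mem_ofPred_eq, abs_mul] at hω ⊢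
  exact lt_of_mul_lt_mul_left hω (abs_nonneg c)

lemma BoundedInProb.add {Z W : (Σ n, Ω n) → ℝ} (hZ : BoundedInProb P Z)
    (hW : BoundedInProb P W) : BoundedInProb P fun z => Z z + W z := fun ε hε => by
  obtain ⟨C, hC⟩ := hZ (ε / 2) (half_pos hε)
  obtain ⟨D, hD⟩ := hW (ε / 2) (half_pos hε)
  refine ⟨C + D, ?_⟩
  filter_upwards [hC, hD] with n h1 h2
  calc P n {ω | C + D < |Z ⟨n, ω⟩ + W ⟨n, ω⟩|}
      ≤ P n ({ω | C < |Z ⟨n, ω⟩|} ∪ {ω | D < |W ⟨n, ω⟩|}) := by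
        refine measure_mono fun ω hω => ?_
        by_contra hc
        simp only [Set.mem_union, Set.mem_ofPred_eq, not_or, not_lt] at hc hω
        linarith [abs_add_le (Z ⟨n, ω⟩) (W ⟨n, ω⟩), hc.1, hc.2]
    _ ≤ ENNReal.ofReal (ε / 2) + ENNReal.ofReal (ε / 2) :=
        (measure_union_le _ _).trans (add_le_add h1 h2)
    _ = ENNReal.ofReal ε := by
        rw [← ENNReal.ofReal_add (half_pos hε).le (half_pos hε).le, add_halves]

/-- The rule O_P(1) o_P(1) = o_P(1): outside an event of probability at most e the first factor is
below C, and the second is eventually below δ / (|C| + 1) except on another such event. -/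
lemma BoundedInProb.mul_tendsto_zero {Z W : (Σ n, Ω n) → ℝ} (hZ : BoundedInProb P Z)
    (hW : Tendsto W (whp P) (𝓝 0)) : Tendsto (fun z => Z z * W z) (whp P) (𝓝 0) := by
  rw [Metric.tendsto_nhds]
  intro δ hδ
  rw [eventually_whp, ENNReal.tendsto_nhds_zero]
  intro ε hε
  obtain ⟨e, he0, hee⟩ : ∃ e : ℝ, 0 < e ∧ ENNReal.ofReal e + ENNReal.ofReal e ≤ ε := by
    obtain ⟨e, he0, hee⟩ := ENNReal.lt_iff_exists_nnreal_btwn.1 hε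
    refine ⟨e / 2, half_pos (by exact_mod_cast he0), ?_⟩
    rw [← ENNReal.ofReal_add (by positivity) (by positivity), add_halves]
    simpa using hee.le
  obtain ⟨C, hC⟩ := hZ e he0
  have hW' := (Metric.tendsto_nhds.1 hW) (δ / (|C| + 1)) (by positivity)
  rw [eventually_whp, ENNReal.tendsto_nhds_zero] at hW'
  filter_upwards [hC, hW' (ENNReal.ofReal e) (by simpa using he0)] with n h1 h2
  refine le_trans (le_trans (measure_mono fun ω hω => ?_) (measure_union_le
    {ω | C < |Z ⟨n, ω⟩|} {ω | ¬ dist (W ⟨n, ω⟩) 0 < δ / (|C| + 1)})) ((add_le_add h1 h2).trans hee)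
  by_contra hc
  simp only [Set.mem_union, Set.mem_ofPred_eq, not_or, not_lt, not_le, dist_zero_right,
    Real.norm_eq_abs, abs_mul] at hc hω
  have h3 := hc.2
  rw [lt_div_iff₀ (by positivity)] at h3
  nlinarith [hc.1, le_abs_self C, abs_nonneg (W ⟨n, ω⟩), abs_nonneg (Z ⟨n, ω⟩)]

/-- A variable that is, for every `ε`, at most `ε` times a variable bounded in probability with
probability tending to one, tends to zero in probability. -/
lemma BoundedInProb.tendsto_zero_of_le {Z W : (Σ n, Ω n) → ℝ} (hW : BoundedInProb P W)
    (h : ∀ ε : ℝ, 0 < ε → ∀ᶠ z in whp P, |Z z| ≤ ε * |W z|) : Tendsto Z (whp P) (𝓝 0) := by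
  -- Where `W` vanishes the quotient is 0 by convention, and the hypothesis with ε = 1 makes `Z`
  -- vanish there too, so that `Z = W * (Z / W)` with probability tending to one.
  have h0 : Tendsto (fun z => Z z / W z) (whp P) (𝓝 0) := by
    rw [Metric.tendsto_nhds]
    intro ε hε
    filter_upwards [h (ε / 2) (half_pos hε)] with z hz
    rw [dist_zero_right, Real.norm_eq_abs, abs_div]
    rcases eq_or_ne (W z) 0 with hw | hw
    · simp [hw, hε]
    · rw [div_lt_iff₀ (abs_pos.2 hw)]
      nlinarith [abs_pos.2 hw]
  refine (hW.mul_tendsto_zero h0).congr' ?_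
  filter_upwards [h 1 one_pos] with z hz
  rcases eq_or_ne (W z) 0 with hw | hw
  · rw [hw, abs_zero, mul_zero] at hz
    rw [hw, zero_mul, abs_eq_zero.1 (le_antisymm hz (abs_nonneg _))]
  · field_simp

/-- This is how root-n consistency yields consistency. -/
lemma BoundedInProb.tendsto_div_sqrt {Z : (Σ n, Ω n) → ℝ}
    (hZ : BoundedInProb P fun z => √(z.1 : ℝ) * Z z) : Tendsto Z (whp P) (𝓝 0) := by
  have h : Tendsto (fun z : Σ n, Ω n => (√(z.1 : ℝ))⁻¹) (whp P) (𝓝 0) :=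
    (tendsto_inv_atTop_zero.comp (Real.tendsto_sqrt_atTop.comp
      tendsto_natCast_atTop_atTop)).comp tendsto_fst_whp
  refine (hZ.mul_tendsto_zero h).congr' ?_
  filter_upwards [tendsto_fst_whp.eventually (eventually_gt_atTop 0)] with z hz
  have : 0 < √(z.1 : ℝ) := Real.sqrt_pos.2 (by exact_mod_cast hz)
  field_simp

/-- Chebyshev's inequality: bounded second moments give boundedness in probability. -/
lemma boundedInProb_of_sq {Z : (Σ n, Ω n) → ℝ} {B : ℝ}
    (hInt : ∀ n, Integrable (fun ω => Z ⟨n, ω⟩ ^ 2) (P n))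
    (hB : ∀ n, ∫ ω, Z ⟨n, ω⟩ ^ 2 ∂P n ≤ B) : BoundedInProb P Z := fun ε hε => by
  -- Chebyshev gives probability at most B / C² beyond C; replacing B by |B| + 1 keeps the threshold
  -- positive.
  refine ⟨√((|B| + 1) / ε), Eventually.of_forall fun n => ?_⟩
  have hc : 0 < (|B| + 1) / ε := by positivity
  have h1 := mul_meas_ge_le_integral_of_nonneg
    (Eventually.of_forall fun ω => sq_nonneg (Z ⟨n, ω⟩)) (hInt n) ((|B| + 1) / ε)
  have hfin : P n {ω | (|B| + 1) / ε ≤ Z ⟨n, ω⟩ ^ 2} ≠ ⊤ :=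
    ((hInt n).measure_ge_lt_top hc).ne
  calc P n {ω | √((|B| + 1) / ε) < |Z ⟨n, ω⟩|}
      ≤ P n {ω | (|B| + 1) / ε ≤ Z ⟨n, ω⟩ ^ 2} := by
        refine measure_mono fun ω hω => ?_
        simp only [Set.mem_ofPred_eq] at hω ⊢
        rw [Real.sqrt_lt' (lt_of_le_of_lt (Real.sqrt_nonneg _) hω), sq_abs] at hω
        exact hω.le
    _ = ENNReal.ofReal ((P n).real {ω | (|B| + 1) / ε ≤ Z ⟨n, ω⟩ ^ 2}) :=
        (ENNReal.ofReal_toReal hfin).symm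
    _ ≤ ENNReal.ofReal ε := by
        refine ENNReal.ofReal_le_ofReal ?_
        have h2 : (|B| + 1) / ε * (P n).real {ω | (|B| + 1) / ε ≤ Z ⟨n, ω⟩ ^ 2} ≤ |B| + 1 :=
          h1.trans ((hB n).trans ((le_abs_self B).trans (by linarith)))
        rw [div_mul_eq_mul_div, div_le_iff₀ hε] at h2
        exact le_of_mul_le_mul_left h2 (by positivity)

/-- Vanishing second moments give convergence to zero in probability. -/
lemma tendsto_whp_zero_of_sq {Z : (Σ n, Ω n) → ℝ} {b : ℕ → ℝ}
    (hInt : ∀ᶠ n in atTop, Integrable (fun ω => Z ⟨n, ω⟩ ^ 2) (P n))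
    (hB : ∀ᶠ n in atTop, ∫ ω, Z ⟨n, ω⟩ ^ 2 ∂P n ≤ b n) (hb : Tendsto b atTop (𝓝 0)) :
    Tendsto Z (whp P) (𝓝 0) := by
  rw [Metric.tendsto_nhds]
  intro δ hδ
  rw [eventually_whp]
  have h0 : Tendsto (fun n => ENNReal.ofReal (b n / δ ^ 2)) atTop (𝓝 0) := by
    simpa using ENNReal.tendsto_ofReal (hb.div_const (δ ^ 2))
  refine tendsto_of_tendsto_of_tendsto_of_le_of_le' tendsto_const_nhds h0
    (Eventually.of_forall fun _ => zero_le) ?_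
  filter_upwards [hInt, hB] with n h1 h2
  have h3 := mul_meas_ge_le_integral_of_nonneg
    (Eventually.of_forall fun ω => sq_nonneg (Z ⟨n, ω⟩)) h1 (δ ^ 2)
  have hfin : P n {ω | δ ^ 2 ≤ Z ⟨n, ω⟩ ^ 2} ≠ ⊤ := (h1.measure_ge_lt_top (by positivity)).ne
  calc P n {ω | ¬ dist (Z ⟨n, ω⟩) 0 < δ}
      ≤ P n {ω | δ ^ 2 ≤ Z ⟨n, ω⟩ ^ 2} := by
        refine measure_mono fun ω hω => ?_
        simp only [Set.mem_ofPred_eq, dist_zero_right, Real.norm_eq_abs, not_lt] at hω ⊢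
        rw [← sq_abs (Z ⟨n, ω⟩)]
        gcongr
    _ = ENNReal.ofReal ((P n).real {ω | δ ^ 2 ≤ Z ⟨n, ω⟩ ^ 2}) :=
        (ENNReal.ofReal_toReal hfin).symm
    _ ≤ ENNReal.ofReal (b n / δ ^ 2) := by
        refine ENNReal.ofReal_le_ofReal ?_
        rw [le_div_iff₀ (by positivity), mul_comm]
        exact h3.trans h2

end InProbability

/-! ### Weak convergence through characteristic functions. -/

section WeakConvergence

variable {Ω : ℕ → Type*} [∀ n, MeasurableSpace (Ω n)] {P : ∀ n, Measure (Ω n)}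
  {Y : ∀ n, Ω n → ℝ} {L : Measure ℝ}

/-- Weak convergence of distributions is pointwise convergence of characteristic functions. -/
lemma tendstoLaw_iff_charFun [IsProbabilityMeasure L]
    (hP : ∀ᶠ n in atTop, IsProbabilityMeasure (P n)) (hY : ∀ n, Measurable (Y n)) :
    TendstoLaw P Y L ↔ ∀ u : ℝ,
      Tendsto (fun n => ∫ ω, Complex.exp (u * Y n ω * Complex.I) ∂P n) atTop
        (𝓝 (charFun L u)) := by
  classical
  let L₀ : ProbabilityMeasure ℝ := ⟨L, inferInstance⟩
  -- The finitely many n for which `P n` may fail to be a probability measure receive the dummy law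
  -- `L₀`.
  let μ : ℕ → ProbabilityMeasure ℝ := fun n =>
    if h : IsProbabilityMeasure (P n) then
      ⟨(P n).map (Y n), Measure.isProbabilityMeasure_map (hY n).aemeasurable⟩
    else L₀
  have hμ : ∀ᶠ n in atTop, (μ n : Measure ℝ) = (P n).map (Y n) := by
    filter_upwards [hP] with n hn
    simp [μ, hn]
  have h1 : TendstoLaw P Y L ↔ Tendsto μ atTop (𝓝 L₀) := by
    rw [ProbabilityMeasure.tendsto_iff_forall_integral_tendsto]
    refine forall_congr' fun f => tendsto_congr' ?_
    filter_upwards [hμ] with n hn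
    rw [hn, integral_map (hY n).aemeasurable f.continuous.aestronglyMeasurable]
  rw [h1, ProbabilityMeasure.tendsto_iff_tendsto_charFun]
  refine forall_congr' fun u => tendsto_congr' ?_
  filter_upwards [hμ] with n hn
  rw [hn, charFun_apply_real, integral_map (hY n).aemeasurable (by fun_prop)]

lemma norm_cexp_sub_cexp_le (u a b : ℝ) :
    ‖Complex.exp (u * a * Complex.I) - Complex.exp (u * b * Complex.I)‖ ≤ |u| * |a - b| := by
  have h : Complex.exp (u * a * Complex.I) - Complex.exp (u * b * Complex.I) =
      Complex.exp ((u * b : ℝ) * Complex.I) *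
        (Complex.exp (Complex.I * ((u * (a - b) : ℝ) : ℂ)) - 1) := by
    rw [mul_sub, ← Complex.exp_add, mul_one]
    push_cast
    ring_nf
  rw [h, norm_mul, Complex.norm_exp_ofReal_mul_I, one_mul, ← abs_mul]
  exact Real.norm_exp_I_mul_ofReal_sub_one_le

/-- Variables whose difference tends to zero in probability have asymptotically the same
characteristic function. -/
lemma tendsto_charFun_of_sub {Z W : ∀ n, Ω n → ℝ}
    (hP : ∀ᶠ n in atTop, IsProbabilityMeasure (P n))
    (hZ : ∀ n, Measurable (Z n)) (hW : ∀ n, Measurable (W n))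
    (h : Tendsto (fun z : Σ n, Ω n => Z z.1 z.2 - W z.1 z.2) (whp P) (𝓝 0)) (u : ℝ) {c : ℂ}
    (hc : Tendsto (fun n => ∫ ω, Complex.exp (u * W n ω * Complex.I) ∂P n) atTop (𝓝 c)) :
    Tendsto (fun n => ∫ ω, Complex.exp (u * Z n ω * Complex.I) ∂P n) atTop (𝓝 c) := by
  suffices hs : Tendsto (fun n => ∫ ω, Complex.exp (u * Z n ω * Complex.I) ∂P n -
      ∫ ω, Complex.exp (u * W n ω * Complex.I) ∂P n) atTop (𝓝 0) by
    simpa using hs.add hc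
  rw [Metric.tendsto_nhds]
  intro ε hε
  -- With this radius the Lipschitz bound |u| |a - b| stays below ε / 4 off the bad event; on it the
  -- integrand is at most 2, which costs 2 * (ε / 8).
  have hδ : 0 < ε / (4 * (|u| + 1)) := by positivity
  have h1 := (Metric.tendsto_nhds.1 h) _ hδ
  rw [eventually_whp, ENNReal.tendsto_nhds_zero] at h1
  filter_upwards [hP, h1 (ENNReal.ofReal (ε / 8)) (by simpa using hε)] with n hn h2
  set δ := ε / (4 * (|u| + 1)) with hδdef
  set A : Set (Ω n) := {ω | ¬ dist (Z n ω - W n ω) 0 < δ} with hA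
  have hAm : MeasurableSet A := by
    have : Measurable fun ω => dist (Z n ω - W n ω) 0 := by
      have := hZ n; have := hW n; fun_prop
    exact (measurableSet_lt this measurable_const).compl
  have hi : ∀ V : Ω n → ℝ, Measurable V →
      Integrable (fun ω => Complex.exp (u * V ω * Complex.I)) (P n) := fun V hV => by
    refine Integrable.of_bound (by fun_prop) 1 (Eventually.of_forall fun ω => ?_)
    have := Complex.norm_exp_ofReal_mul_I (u * V ω)
    push_cast at this
    exact this.le
  rw [dist_zero_right, ← integral_sub (hi _ (hZ n)) (hi _ (hW n))]
  have hb : ∀ ω, ‖Complex.exp (u * Z n ω * Complex.I) - Complex.exp (u * W n ω * Complex.I)‖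
      ≤ ε / 4 + A.indicator (fun _ => (2 : ℝ)) ω := fun ω => by
    by_cases hω : ω ∈ A
    · rw [Set.indicator_of_mem hω]
      refine (norm_sub_le _ _).trans ?_
      have h3 := Complex.norm_exp_ofReal_mul_I (u * Z n ω)
      have h4 := Complex.norm_exp_ofReal_mul_I (u * W n ω)
      push_cast at h3 h4
      rw [h3, h4]
      linarith
    · rw [Set.indicator_of_notMem hω, add_zero]
      refine (norm_cexp_sub_cexp_le _ _ _).trans ?_
      simp only [hA, Set.mem_ofPred_eq, not_not, dist_zero_right, Real.norm_eq_abs] at hω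
      rw [hδdef, lt_div_iff₀ (by positivity)] at hω
      nlinarith [abs_nonneg u, abs_nonneg (Z n ω - W n ω)]
  have h5 : ∫ ω, (ε / 4 + A.indicator (fun _ => (2 : ℝ)) ω) ∂P n = ε / 4 + 2 * (P n).real A := by
    rw [integral_add (integrable_const _) ((integrable_const _).indicator hAm),
      integral_indicator hAm]
    simp [mul_comm]
  have h6 : (P n).real A ≤ ε / 8 := by
    refine ENNReal.toReal_le_of_le_ofReal (by positivity) h2
  calc _ ≤ ∫ ω, (ε / 4 + A.indicator (fun _ => (2 : ℝ)) ω) ∂P n := by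
        refine norm_integral_le_of_norm_le ?_ (Eventually.of_forall hb)
        exact (integrable_const _).add ((integrable_const _).indicator hAm)
    _ < ε := by rw [h5]; linarith

end WeakConvergence

end

end StudentT

/-! ### Product densities, local models and the moments of the score. -/

namespace StudentT

section

section Product

variable {X : Type*} [MeasurableSpace X]

/-- The product of identical measures with a density has the product density. -/
lemma pi_withDensity {ι : Type*} [Fintype ι] (μ : Measure X) [IsProbabilityMeasure μ]
    {g : X → ENNReal} (hg : Measurable g) [SigmaFinite (μ.withDensity g)] :
    Measure.pi (fun _ : ι => μ.withDensity g) =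
      (Measure.pi fun _ : ι => μ).withDensity fun x => ∏ i, g (x i) := by
  refine Measure.pi_eq fun A hA => ?_
  rw [withDensity_apply _ (MeasurableSet.univ_pi hA),
    ← lintegral_indicator (MeasurableSet.univ_pi hA)]
  -- On a box the restricted density is a product of functions of single coordinates, which are
  -- independent under the product of the `μ`.
  have h1 : (Set.univ.pi A).indicator (fun x : ι → X => ∏ i, g (x i)) =
      fun x => ∏ i, (A i).indicator g (x i) := by
    ext x
    by_cases hx : x ∈ Set.univ.pi A
    · rw [Set.indicator_of_mem hx]
      exact Finset.prod_congr rfl fun i _ => (Set.indicator_of_mem (hx i (Set.mem_univ i)) _).symm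
    · rw [Set.indicator_of_notMem hx]
      simp only [Set.mem_pi, Set.mem_univ, true_imp_iff, not_forall] at hx
      obtain ⟨i, hi⟩ := hx
      exact (Finset.prod_eq_zero (Finset.mem_univ i) (Set.indicator_of_notMem hi _)).symm
  rw [h1, lintegral_prod_eq_prod_lintegral_of_indepFun Finset.univ
    (fun i (x : ι → X) => (A i).indicator g (x i))
    (iIndepFun_pi fun i => (hg.indicator (hA i)).aemeasurable)
    (fun i => (hg.indicator (hA i)).comp (measurable_pi_apply i))]
  refine Finset.prod_congr rfl fun i _ => ?_
  rw [withDensity_apply _ (hA i), ← lintegral_indicator (hA i)]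
  exact (measurePreserving_eval (fun _ : ι => μ) i).lintegral_comp (hg.indicator (hA i))

end Product

variable {X : Type*} [MeasurableSpace X] {E : Type*} [NormedAddCommGroup E] [NormedSpace ℝ E]

/-- A statistical model near a parameter with law `P`: `r h` is the log-likelihood ratio of the
parameter at distance `h`, with an expansion of second order that is uniform in the observation,
`s` is the score and `H` the Hessian of the log-likelihood. -/
structure LocalModel (P : Measure X) (r : E → X → ℝ) (s : X → E →L[ℝ] ℝ)
    (H : X → E →L[ℝ] E →L[ℝ] ℝ) : Prop where
  measurable_score : ∀ v, Measurable fun x => s x v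
  measurable_hess : ∀ v w, Measurable fun x => H x v w
  hess_symm : ∀ x v w, H x v w = H x w v
  hess_bdd : ∃ C, ∀ x, ‖H x‖ ≤ C
  measurable_ratio : ∀ᶠ h in 𝓝 (0 : E), Measurable (r h)
  expansion : ∀ ε : ℝ, 0 < ε → ∀ᶠ h in 𝓝 (0 : E), ∀ x, |r h x - s x h - H x h h / 2| ≤ ε * ‖h‖ ^ 2
  integral_exp : ∀ᶠ h in 𝓝 (0 : E), ∫ x, Real.exp (r h x) ∂P = 1

/-- The Fisher information as a bilinear form. -/
def info (P : Measure X) (s : X → E →L[ℝ] ℝ) (v w : E) : ℝ := ∫ x, s x v * s x w ∂P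

lemma info_comm (P : Measure X) (s : X → E →L[ℝ] ℝ) (v w : E) : info P s v w = info P s w v := by
  simp only [info, mul_comm]

namespace LocalModel

variable {P : Measure X} [IsProbabilityMeasure P] {r : E → X → ℝ} {s : X → E →L[ℝ] ℝ}
  {H : X → E →L[ℝ] E →L[ℝ] ℝ}

-- A bounded Hessian is absorbed in the remainder. The uniformity in x is what allows scores and
-- log-likelihood ratios to be exchanged inside exponentials.
omit [IsProbabilityMeasure P] in
lemma exists_remainder_bound (M : LocalModel P r s H) :
    ∃ C : ℝ, 0 ≤ C ∧ ∀ᶠ h in 𝓝 (0 : E), ∀ x, |r h x - s x h| ≤ C * ‖h‖ ^ 2 := by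
  obtain ⟨C, hC⟩ := M.hess_bdd
  refine ⟨|C| + 1, by positivity, ?_⟩
  filter_upwards [M.expansion 1 one_pos] with h hh x
  have h1 : |H x h h| ≤ |C| * ‖h‖ ^ 2 := by
    have := ((H x h).le_opNorm h).trans
      (mul_le_mul_of_nonneg_right ((H x).le_opNorm h) (norm_nonneg h))
    rw [Real.norm_eq_abs] at this
    refine this.trans ?_
    rw [mul_assoc, ← sq]
    exact mul_le_mul_of_nonneg_right ((hC x).trans (le_abs_self C)) (sq_nonneg _)
  have h2 := hh x
  have h3 : r h x - s x h = (r h x - s x h - H x h h / 2) + H x h h / 2 := by ring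
  rw [h3]
  refine (abs_add_le _ _).trans ?_
  rw [abs_div, abs_two]
  nlinarith [sq_nonneg ‖h‖, abs_nonneg C]

-- A function that is not integrable has Bochner integral 0, so the value 1 forces integrability.
omit [IsProbabilityMeasure P] in
lemma integrable_exp (M : LocalModel P r s H) :
    ∀ᶠ h in 𝓝 (0 : E), Integrable (fun x => Real.exp (r h x)) P := by
  filter_upwards [M.integral_exp] with h hh
  by_contra hc
  rw [integral_undef hc] at hh
  exact zero_ne_one hh

omit [IsProbabilityMeasure P] in
/-- Small exponential moments of the score. -/
lemma exists_integral_exp_score_le (M : LocalModel P r s H) :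
    ∃ C : ℝ, 0 ≤ C ∧ ∀ᶠ h in 𝓝 (0 : E), Integrable (fun x => Real.exp (s x h)) P ∧
      ∫ x, Real.exp (s x h) ∂P ≤ Real.exp (C * ‖h‖ ^ 2) := by
  obtain ⟨C, hC0, hC⟩ := M.exists_remainder_bound
  refine ⟨C, hC0, ?_⟩
  filter_upwards [hC, M.integrable_exp, M.integral_exp] with h h1 h2 h3
  -- The score is within C ‖h‖² of the log-likelihood ratio, whose exponential has integral one.
  have hle : ∀ x, Real.exp (s x h) ≤ Real.exp (C * ‖h‖ ^ 2) * Real.exp (r h x) := fun x => by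
    rw [← Real.exp_add, Real.exp_le_exp]
    linarith [(abs_le.1 (h1 x)).1]
  have hInt : Integrable (fun x => Real.exp (s x h)) P := by
    refine (h2.const_mul (Real.exp (C * ‖h‖ ^ 2))).mono'
      (Real.measurable_exp.comp (M.measurable_score h)).aestronglyMeasurable
      (Eventually.of_forall fun x => ?_)
    rw [Real.norm_eq_abs, abs_of_pos (Real.exp_pos _)]
    exact hle x
  refine ⟨hInt, (integral_mono hInt (h2.const_mul _) hle).trans ?_⟩
  rw [integral_const_mul, h3, mul_one]

-- For small t > 0 both t v and -t v are admissible directions, and exp |y| ≤ exp y + exp (-y).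
omit [IsProbabilityMeasure P] in
lemma exists_integrable_exp_abs (M : LocalModel P r s H) (v : E) :
    ∃ ρ : ℝ, 0 < ρ ∧ Integrable (fun x => Real.exp (ρ * |s x v|)) P := by
  obtain ⟨C, -, hC⟩ := M.exists_integral_exp_score_le
  have h1 : Tendsto (fun t : ℝ => t • v) (𝓝[>] 0) (𝓝 0) := by
    have : Tendsto (fun t : ℝ => t • v) (𝓝 0) (𝓝 ((0 : ℝ) • v)) :=
      (continuous_id.smul continuous_const).tendsto 0
    rw [zero_smul] at this
    exact this.mono_left nhdsWithin_le_nhds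
  have h2 : Tendsto (fun t : ℝ => -(t • v)) (𝓝[>] 0) (𝓝 0) := by simpa using h1.neg
  obtain ⟨ρ, h3, h4, h5⟩ := ((h1.eventually hC).and ((h2.eventually hC).and
    self_mem_nhdsWithin)).exists
  refine ⟨ρ, h5, (h3.1.add h4.1).mono' ?_ (Eventually.of_forall fun x => ?_)⟩
  · exact (Real.measurable_exp.comp
      ((M.measurable_score v).abs.const_mul ρ)).aestronglyMeasurable
  · simp only [Real.norm_eq_abs, Real.abs_exp, map_neg, map_smul, smul_eq_mul, Pi.add_apply]
    rcases abs_cases (s x v) with h | h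
    · rw [h.1]
      linarith [Real.exp_pos (-(ρ * s x v))]
    · rw [h.1, mul_neg]
      linarith [Real.exp_pos (ρ * s x v)]

-- By induction: a + b is at most twice the larger term, so half of the smaller exponent suffices
-- for the sum. These moments supply the dominating functions used below.
omit [IsProbabilityMeasure P] in
lemma exists_integrable_exp_sum_abs (M : LocalModel P r s H) {ι : Type*} (t : Finset ι)
    [IsFiniteMeasure P] (v : ι → E) :
    ∃ ρ : ℝ, 0 < ρ ∧ Integrable (fun x => Real.exp (ρ * ∑ i ∈ t, |s x (v i)|)) P := by
  classical
  induction t using Finset.induction_on with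
  | empty => exact ⟨1, one_pos, by simp⟩
  | insert i t hi ih =>
    obtain ⟨ρ, hρ, h1⟩ := ih
    obtain ⟨σ, hσ, h2⟩ := M.exists_integrable_exp_abs (v i)
    have hmeas : Measurable fun x => ∑ i ∈ t, |s x (v i)| :=
      Finset.measurable_sum _ fun i _ => (M.measurable_score (v i)).abs
    refine ⟨min ρ σ / 2, by positivity, (h1.add h2).mono' ?_ (Eventually.of_forall fun x => ?_)⟩
    · refine (Real.measurable_exp.comp (Measurable.const_mul ?_ _)).aestronglyMeasurable
      exact Finset.measurable_sum _ fun i _ => (M.measurable_score (v i)).abs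
    · rw [Real.norm_eq_abs, Real.abs_exp, Finset.sum_insert hi, Pi.add_apply]
      set a := |s x (v i)| with ha
      set b := ∑ i ∈ t, |s x (v i)| with hb
      have ha0 : 0 ≤ a := abs_nonneg _
      have hb0 : 0 ≤ b := Finset.sum_nonneg fun i _ => abs_nonneg _
      have hm1 : min ρ σ ≤ ρ := min_le_left _ _
      have hm2 : min ρ σ ≤ σ := min_le_right _ _
      rcases le_total a b with hab | hab
      · have : Real.exp (min ρ σ / 2 * (a + b)) ≤ Real.exp (ρ * b) :=
          Real.exp_le_exp.2 (by nlinarith [(by positivity : 0 < min ρ σ)])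
        linarith [Real.exp_pos (σ * a)]
      · have : Real.exp (min ρ σ / 2 * (a + b)) ≤ Real.exp (σ * a) :=
          Real.exp_le_exp.2 (by nlinarith [(by positivity : 0 < min ρ σ)])
        linarith [Real.exp_pos (ρ * b)]

omit [IsProbabilityMeasure P] in
lemma memLp_score (M : LocalModel P r s H) (v : E) : MemLp (fun x => s x v) 2 P := by
  obtain ⟨ρ, hρ, h⟩ := M.exists_integrable_exp_abs v
  refine (memLp_two_iff_integrable_sq (M.measurable_score v).aestronglyMeasurable).2 ?_
  refine (h.const_mul (2 / ρ ^ 2)).mono'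
    ((M.measurable_score v).pow_const 2).aestronglyMeasurable (Eventually.of_forall fun x => ?_)
  have h1 := Real.quadratic_le_exp_of_nonneg (x := ρ * |s x v|) (by positivity)
  rw [Real.norm_eq_abs, abs_pow, div_mul_eq_mul_div, le_div_iff₀ (by positivity)]
  nlinarith [abs_nonneg (s x v), mul_nonneg hρ.le (abs_nonneg (s x v))]

omit [IsProbabilityMeasure P] in
lemma integrable_score_mul (M : LocalModel P r s H) (v w : E) :
    Integrable (fun x => s x v * s x w) P :=
  (M.memLp_score v).integrable_mul (M.memLp_score w)

lemma integrable_score (M : LocalModel P r s H) (v : E) : Integrable (fun x => s x v) P :=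
  (M.memLp_score v).integrable (by norm_num)

/-- From 1 + t s(v) ≤ exp(t s(v)) and E exp(t s(v)) ≤ exp(C t² ‖v‖²) one gets t E s(v) = O(t²),
hence E s(v) ≤ 0; the same for -v gives equality. -/
lemma integral_score (M : LocalModel P r s H) (v : E) : ∫ x, s x v ∂P = 0 := by
  suffices h : ∀ v : E, ∫ x, s x v ∂P ≤ 0 by
    refine le_antisymm (h v) ?_
    have := h (-v)
    simp only [map_neg, integral_neg] at this
    linarith
  intro v
  obtain ⟨C, hC0, hC⟩ := M.exists_integral_exp_score_le
  have h1 : Tendsto (fun t : ℝ => t • v) (𝓝[>] 0) (𝓝 0) := by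
    have : Tendsto (fun t : ℝ => t • v) (𝓝 0) (𝓝 ((0 : ℝ) • v)) :=
      (continuous_id.smul continuous_const).tendsto 0
    rw [zero_smul] at this
    exact this.mono_left nhdsWithin_le_nhds
  have h2 : Tendsto (fun t : ℝ => C * (t ^ 2 * ‖v‖ ^ 2)) (𝓝[>] 0) (𝓝 0) := by
    have : Tendsto (fun t : ℝ => C * (t ^ 2 * ‖v‖ ^ 2)) (𝓝 0) (𝓝 (C * (0 ^ 2 * ‖v‖ ^ 2))) :=
      (by fun_prop : Continuous fun t : ℝ => C * (t ^ 2 * ‖v‖ ^ 2)).tendsto 0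
    simp only [ne_eq, OfNat.ofNat_ne_zero, not_false_eq_true, zero_pow, zero_mul, mul_zero] at this
    exact this.mono_left nhdsWithin_le_nhds
  have h3 : Tendsto (fun t : ℝ => 2 * (C * (t * ‖v‖ ^ 2))) (𝓝[>] 0) (𝓝 0) := by
    have : Tendsto (fun t : ℝ => 2 * (C * (t * ‖v‖ ^ 2))) (𝓝 0) (𝓝 (2 * (C * (0 * ‖v‖ ^ 2)))) :=
      (by fun_prop : Continuous fun t : ℝ => 2 * (C * (t * ‖v‖ ^ 2))).tendsto 0
    simp only [zero_mul, mul_zero] at this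
    exact this.mono_left nhdsWithin_le_nhds
  refine ge_of_tendsto h3 ?_
  filter_upwards [h1.eventually hC, h2.eventually (eventually_le_nhds one_pos),
    self_mem_nhdsWithin] with t h4 h5 (h6 : 0 < t)
  obtain ⟨h7, h8⟩ := h4
  have h9 : ∫ x, (1 + s x (t • v)) ∂P ≤ ∫ x, Real.exp (s x (t • v)) ∂P :=
    integral_mono ((integrable_const _).add (M.integrable_score _)) h7 fun x => by
      dsimp only
      linarith [Real.add_one_le_exp (s x (t • v))]
  rw [integral_add (integrable_const _) (M.integrable_score _)] at h9
  simp only [integral_const, probReal_univ, smul_eq_mul, mul_one, map_smul,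
    integral_const_mul] at h9
  have hn : C * ‖t • v‖ ^ 2 = C * (t ^ 2 * ‖v‖ ^ 2) := by
    rw [norm_smul, mul_pow, Real.norm_eq_abs, sq_abs]
  simp only [map_smul, smul_eq_mul, hn] at h8
  have h0 : 0 ≤ C * (t ^ 2 * ‖v‖ ^ 2) := by positivity
  have h10 := Real.abs_exp_sub_one_le (x := C * (t ^ 2 * ‖v‖ ^ 2)) (by rwa [abs_of_nonneg h0])
  rw [abs_of_nonneg h0] at h10
  have h11 := (le_abs_self _).trans h10
  have h12 : t * ∫ x, s x v ∂P ≤ t * (2 * (C * (t * ‖v‖ ^ 2))) := by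
    calc t * ∫ x, s x v ∂P ≤ 2 * (C * (t ^ 2 * ‖v‖ ^ 2)) := by linarith
      _ = t * (2 * (C * (t * ‖v‖ ^ 2))) := by ring
  exact le_of_mul_le_mul_left h12 h6

end LocalModel

end

end StudentT

/-! ### Second order expansion of exponential moments and the information identity. -/

namespace StudentT

section

variable {X : Type*} [MeasurableSpace X] {E : Type*} [NormedAddCommGroup E] [NormedSpace ℝ E]

namespace LocalModel

variable {P : Measure X} [IsProbabilityMeasure P] {r : E → X → ℝ} {s : X → E →L[ℝ] ℝ}
  {H : X → E →L[ℝ] E →L[ℝ] ℝ}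

lemma tendsto_smul_nhdsGT_zero (v : E) : Tendsto (fun t : ℝ => t • v) (𝓝[>] 0) (𝓝 0) := by
  have : Tendsto (fun t : ℝ => t • v) (𝓝 0) (𝓝 ((0 : ℝ) • v)) :=
    (continuous_id.smul continuous_const).tendsto 0
  rw [zero_smul] at this
  exact this.mono_left nhdsWithin_le_nhds

omit [IsProbabilityMeasure P] in
lemma tendsto_remainder_div_sq (M : LocalModel P r s H) (h : E) (x : X) :
    Tendsto (fun τ : ℝ => (r (τ • h) x - s x (τ • h)) / τ ^ 2) (𝓝[>] 0) (𝓝 (H x h h / 2)) := by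
  rw [Metric.tendsto_nhds]
  intro ε hε
  have h1 := (tendsto_smul_nhdsGT_zero h).eventually
    (M.expansion (ε / (2 * (‖h‖ ^ 2 + 1))) (by positivity))
  filter_upwards [h1, self_mem_nhdsWithin] with τ h2 (h3 : 0 < τ)
  have h4 := h2 x
  rw [norm_smul, Real.norm_of_nonneg h3.le, (H x).map_smul, smul_apply,
    (H x h).map_smul, smul_eq_mul, smul_eq_mul] at h4
  have h5 : (r (τ • h) x - s x (τ • h)) / τ ^ 2 - H x h h / 2 =
      (r (τ • h) x - s x (τ • h) - τ * (τ * H x h h) / 2) / τ ^ 2 := by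
    field_simp
  rw [Real.dist_eq, h5, abs_div, abs_of_pos (by positivity : 0 < τ ^ 2),
    div_lt_iff₀ (by positivity)]
  refine h4.trans_lt ?_
  have h6 : ε / (2 * (‖h‖ ^ 2 + 1)) * (τ * ‖h‖) ^ 2 =
      ε * τ ^ 2 * (‖h‖ ^ 2 / (2 * (‖h‖ ^ 2 + 1))) := by ring
  have h7 : ‖h‖ ^ 2 / (2 * (‖h‖ ^ 2 + 1)) < 1 := by
    rw [div_lt_one (by positivity)]
    nlinarith [sq_nonneg ‖h‖]
  rw [h6]
  exact mul_lt_of_lt_one_right (by positivity) h7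

lemma norm_cexp_sub_taylor_one_le (z : ℂ) :
    ‖Complex.exp z - 1 - z‖ ≤ ‖z‖ ^ 2 * Real.exp ‖z‖ := by
  have := Complex.norm_exp_sub_sum_le_norm_mul_exp z 2
  simpa [Finset.sum_range_succ, sub_sub] using this

lemma norm_cexp_sub_taylor_two_le (z : ℂ) :
    ‖Complex.exp z - 1 - z - z ^ 2 / 2‖ ≤ ‖z‖ ^ 3 * Real.exp ‖z‖ := by
  have := Complex.norm_exp_sub_sum_le_norm_mul_exp z 3
  simpa [Finset.sum_range_succ, sub_sub, add_assoc] using this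

/-- If `ζ τ = τ p + τ² c + o(τ²)` then `exp (ζ τ) = 1 + τ p + τ² (p² / 2 + c) + o(τ²)`. -/
lemma tendsto_cexp_taylor {ζ : ℝ → ℂ} {p c : ℂ}
    (h : Tendsto (fun τ : ℝ => (ζ τ - τ * p) / (τ : ℂ) ^ 2) (𝓝[>] 0) (𝓝 c)) :
    Tendsto (fun τ : ℝ => (Complex.exp (ζ τ) - 1 - τ * p) / (τ : ℂ) ^ 2) (𝓝[>] 0)
      (𝓝 (p ^ 2 / 2 + c)) := by
  have hτ : Tendsto (fun τ : ℝ => (τ : ℂ)) (𝓝[>] 0) (𝓝 0) := by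
    have : Tendsto (fun τ : ℝ => (τ : ℂ)) (𝓝 0) (𝓝 ((0 : ℝ) : ℂ)) :=
      Complex.continuous_ofReal.tendsto 0
    exact (by simpa using this : Tendsto (fun τ : ℝ => (τ : ℂ)) (𝓝 0) (𝓝 0)).mono_left
      nhdsWithin_le_nhds
  have hη : Tendsto (fun τ : ℝ => ζ τ / τ) (𝓝[>] 0) (𝓝 p) := by
    have h1 := (hτ.mul h).const_add p
    rw [zero_mul, add_zero] at h1
    refine h1.congr' ?_
    filter_upwards [self_mem_nhdsWithin] with τ (h3 : 0 < τ)
    have : (τ : ℂ) ≠ 0 := by exact_mod_cast h3.ne'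
    field_simp
    ring
  have hζ : Tendsto ζ (𝓝[>] 0) (𝓝 0) := by
    have h1 := hτ.mul hη
    rw [zero_mul] at h1
    refine h1.congr' ?_
    filter_upwards [self_mem_nhdsWithin] with τ (h3 : 0 < τ)
    have : (τ : ℂ) ≠ 0 := by exact_mod_cast h3.ne'
    field_simp
  have hA : Tendsto (fun τ : ℝ => (Complex.exp (ζ τ) - 1 - ζ τ - ζ τ ^ 2 / 2) / (τ : ℂ) ^ 2)
      (𝓝[>] 0) (𝓝 0) := by
    have hb : Tendsto (fun τ : ℝ => ‖ζ τ‖ * ‖ζ τ / τ‖ ^ 2 * Real.exp ‖ζ τ‖) (𝓝[>] 0) (𝓝 0) := by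
      have := (hζ.norm.mul (hη.norm.pow 2)).mul ((Real.continuous_exp.tendsto _).comp hζ.norm)
      simpa using this
    refine squeeze_zero_norm' ?_ hb
    filter_upwards [self_mem_nhdsWithin] with τ (h3 : 0 < τ)
    rw [norm_div, norm_pow, Complex.norm_real, Real.norm_of_nonneg h3.le, norm_div,
      Complex.norm_real, Real.norm_of_nonneg h3.le, div_le_iff₀ (by positivity)]
    refine (norm_cexp_sub_taylor_two_le _).trans (le_of_eq ?_)
    field_simp
  have hB := (hA.add ((hη.pow 2).div_const 2)).add h
  rw [zero_add] at hB
  refine hB.congr' ?_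
  filter_upwards [self_mem_nhdsWithin] with τ (h3 : 0 < τ)
  have : (τ : ℂ) ≠ 0 := by exact_mod_cast h3.ne'
  field_simp
  ring

omit [IsProbabilityMeasure P] in
/-- Polynomial factors do not affect the integrability of small exponential moments. -/
lemma integrable_sq_mul_exp {q : X → ℝ} (hq : Measurable q) (hq0 : ∀ x, 0 ≤ q x) {ρ : ℝ}
    (hρ : 0 < ρ) (hInt : Integrable (fun x => Real.exp (ρ * q x)) P) (A B : ℝ) :
    Integrable (fun x => (A * q x + B) ^ 2 * Real.exp (ρ / 2 * q x + B)) P := by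
  refine (hInt.const_mul ((2 * A ^ 2 * (8 / ρ ^ 2) + 2 * B ^ 2) * Real.exp B)).mono' ?_
    (Eventually.of_forall fun x => ?_)
  · exact ((((hq.const_mul A).add_const B).pow_const 2).mul (Real.measurable_exp.comp
      ((hq.const_mul (ρ / 2)).add_const B))).aestronglyMeasurable
  · have h1 := Real.quadratic_le_exp_of_nonneg (x := ρ / 2 * q x)
      (mul_nonneg (by positivity) (hq0 x))
    -- One half of the exponent ρ pays for the polynomial factor, through y² / 2 ≤ exp y at y = ρ q
    -- / 2; the other half remains in the integrand.
    have hq2 : q x ^ 2 ≤ 8 / ρ ^ 2 * Real.exp (ρ / 2 * q x) := by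
      rw [div_mul_eq_mul_div, le_div_iff₀ (by positivity)]
      nlinarith [hq0 x, mul_nonneg hρ.le (hq0 x)]
    have h1' : 1 ≤ Real.exp (ρ / 2 * q x) :=
      Real.one_le_exp (mul_nonneg (by positivity) (hq0 x))
    have h2 : (A * q x + B) ^ 2 ≤
        (2 * A ^ 2 * (8 / ρ ^ 2) + 2 * B ^ 2) * Real.exp (ρ / 2 * q x) := by
      have h3 : (A * q x + B) ^ 2 ≤ 2 * A ^ 2 * q x ^ 2 + 2 * B ^ 2 := by
        nlinarith [sq_nonneg (A * q x - B)]
      have h4 : 2 * A ^ 2 * q x ^ 2 ≤ 2 * A ^ 2 * (8 / ρ ^ 2 * Real.exp (ρ / 2 * q x)) :=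
        mul_le_mul_of_nonneg_left hq2 (by positivity)
      have h5 : 2 * B ^ 2 ≤ 2 * B ^ 2 * Real.exp (ρ / 2 * q x) :=
        le_mul_of_one_le_right (by positivity) h1'
      linarith
    have h6 : Real.exp (ρ * q x) = Real.exp (ρ / 2 * q x) * Real.exp (ρ / 2 * q x) := by
      rw [← Real.exp_add]; ring_nf
    rw [Real.norm_eq_abs, abs_of_nonneg (by positivity), Real.exp_add, h6]
    calc _ ≤ ((2 * A ^ 2 * (8 / ρ ^ 2) + 2 * B ^ 2) * Real.exp (ρ / 2 * q x)) *
          (Real.exp (ρ / 2 * q x) * Real.exp B) := by gcongr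
      _ = _ := by ring

/-- Second order expansion of joint exponential moments of the score and the log-likelihood
ratio of one observation, with the mean of the Hessian. -/
lemma tendsto_integral_cexp_aux (M : LocalModel P r s H) (a h : E) (α β : ℂ) :
    (∀ᶠ τ : ℝ in 𝓝[>] 0, Integrable
        (fun x => Complex.exp (τ * α * s x a + β * r (τ • h) x)) P) ∧
    Tendsto (fun τ : ℝ => (∫ x, Complex.exp (τ * α * s x a + β * r (τ • h) x) ∂P - 1) /
      (τ : ℂ) ^ 2) (𝓝[>] 0)
      (𝓝 (∫ x, ((α * s x a + β * s x h) ^ 2 / 2 + β * (H x h h / 2)) ∂P)) := by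
  obtain ⟨C, hC0, hC⟩ := M.exists_remainder_bound
  obtain ⟨ρ, hρ, hInt⟩ := M.exists_integrable_exp_sum_abs Finset.univ ![a, h]
  simp only [Fin.sum_univ_two, Matrix.cons_val_zero, Matrix.cons_val_one] at hInt
  set q : X → ℝ := fun x => |s x a| + |s x h| with hq
  set A : ℝ := ‖α‖ + ‖β‖ with hA
  set B : ℝ := ‖β‖ * (C * ‖h‖ ^ 2) with hB
  have hA0 : 0 ≤ A := by positivity
  have hB0 : 0 ≤ B := by positivity
  have hq0 : ∀ x, 0 ≤ q x := fun x => by positivity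
  have hp : ∀ x, ‖α * s x a + β * s x h‖ ≤ A * q x := fun x => by
    refine (norm_add_le _ _).trans ?_
    rw [norm_mul, norm_mul, Complex.norm_real, Complex.norm_real, Real.norm_eq_abs,
      Real.norm_eq_abs, hA, hq]
    nlinarith [norm_nonneg α, norm_nonneg β, abs_nonneg (s x a), abs_nonneg (s x h)]
  let ζ : ℝ → X → ℂ := fun τ x => τ * α * s x a + β * r (τ • h) x
  let p : X → ℂ := fun x => α * s x a + β * s x h
  have hζp : ∀ τ x, ζ τ x - τ * p x = β * ((r (τ • h) x - s x (τ • h) : ℝ) : ℂ) := fun τ x => by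
    simp only [ζ, p, map_smul, smul_eq_mul]
    push_cast
    ring
  let F : ℝ → X → ℂ := fun τ x => (Complex.exp (ζ τ x) - 1 - τ * p x) / (τ : ℂ) ^ 2
  have hpm : Measurable p := by
    have h1 := M.measurable_score a
    have h2 := M.measurable_score h
    exact ((Complex.measurable_ofReal.comp h1).const_mul α).add
      ((Complex.measurable_ofReal.comp h2).const_mul β)
  have hFm : ∀ᶠ τ in 𝓝[>] 0, AEStronglyMeasurable (F τ) P := by
    filter_upwards [(tendsto_smul_nhdsGT_zero h).eventually M.measurable_ratio] with τ h1
    have h2 := M.measurable_score a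
    have h3 : Measurable (ζ τ) :=
      ((Complex.measurable_ofReal.comp h2).const_mul (τ * α)).add
        ((Complex.measurable_ofReal.comp h1).const_mul β)
    exact ((((Complex.measurable_exp.comp h3).sub_const 1).sub
      (hpm.const_mul _)).div_const _).aestronglyMeasurable
  -- The exponential remainder is at most ‖ζ‖² exp ‖ζ‖. Here ‖ζ‖ ≤ τ (A q + B), which is at most ρ q
  -- / 2 + B once τ A ≤ ρ / 2 and τ ≤ 1. The last B bounds the second order part (ζ - τ p) / τ².
  let bound : X → ℝ := fun x => (A * q x + B) ^ 2 * Real.exp (ρ / 2 * q x + B) + B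
  have hbound_int : Integrable bound P := by
    have h3 : Measurable q := (M.measurable_score a).abs.add (M.measurable_score h).abs
    exact (integrable_sq_mul_exp h3 hq0 hρ hInt A B).add (integrable_const B)
  have hsmall : ∀ᶠ τ : ℝ in 𝓝[>] 0, τ * A ≤ ρ / 2 ∧ τ ≤ 1 := by
    have h1 : Tendsto (fun τ : ℝ => τ * A) (𝓝[>] 0) (𝓝 0) := by
      have : Tendsto (fun τ : ℝ => τ * A) (𝓝 0) (𝓝 (0 * A)) :=
        (continuous_id.mul continuous_const).tendsto 0
      rw [zero_mul] at this
      exact this.mono_left nhdsWithin_le_nhds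
    have h2 : Tendsto (fun τ : ℝ => τ) (𝓝[>] 0) (𝓝 0) := tendsto_id.mono_left nhdsWithin_le_nhds
    exact (h1.eventually (eventually_le_nhds (by positivity))).and
      (h2.eventually (eventually_le_nhds one_pos))
  have hF_le : ∀ᶠ τ in 𝓝[>] 0, ∀ᵐ x ∂P, ‖F τ x‖ ≤ bound x := by
    filter_upwards [(tendsto_smul_nhdsGT_zero h).eventually hC, hsmall, self_mem_nhdsWithin]
      with τ h1 h2 (h3 : 0 < τ)
    refine Eventually.of_forall fun x => ?_
    have h4 : ‖ζ τ x - τ * p x‖ ≤ τ ^ 2 * B := by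
      rw [hζp, norm_mul, Complex.norm_real, Real.norm_eq_abs]
      refine (mul_le_mul_of_nonneg_left (h1 x) (norm_nonneg β)).trans (le_of_eq ?_)
      rw [norm_smul, Real.norm_of_nonneg h3.le, hB]
      ring
    have h5 : ‖ζ τ x‖ ≤ τ * (A * q x + B) := by
      have h6 : ζ τ x = (ζ τ x - τ * p x) + τ * p x := by ring
      rw [h6]
      refine (norm_add_le _ _).trans ?_
      rw [norm_mul, Complex.norm_real, Real.norm_of_nonneg h3.le]
      have h7 := mul_le_mul_of_nonneg_left (hp x) h3.le
      have h8 : τ ^ 2 * B ≤ τ * B := by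
        rw [sq, mul_assoc]
        exact mul_le_of_le_one_left (by positivity) h2.2
      have h9 : ‖p x‖ = ‖α * s x a + β * s x h‖ := rfl
      rw [h9]
      linarith
    have h6 : ‖ζ τ x‖ ≤ ρ / 2 * q x + B := by
      refine h5.trans ?_
      have := mul_le_mul_of_nonneg_right h2.1 (hq0 x)
      have := mul_le_of_le_one_left hB0 h2.2
      nlinarith
    have h7 : F τ x = (Complex.exp (ζ τ x) - 1 - ζ τ x) / (τ : ℂ) ^ 2 +
        (ζ τ x - τ * p x) / (τ : ℂ) ^ 2 := by
      simp only [F]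
      rw [← add_div]
      ring_nf
    rw [h7]
    refine (norm_add_le _ _).trans (add_le_add ?_ ?_)
    · rw [norm_div, norm_pow, Complex.norm_real, Real.norm_of_nonneg h3.le,
        div_le_iff₀ (by positivity)]
      refine (norm_cexp_sub_taylor_one_le _).trans ?_
      calc ‖ζ τ x‖ ^ 2 * Real.exp ‖ζ τ x‖
          ≤ (τ * (A * q x + B)) ^ 2 * Real.exp (ρ / 2 * q x + B) := by gcongr
        _ = _ := by ring
    · rw [norm_div, norm_pow, Complex.norm_real, Real.norm_of_nonneg h3.le,
        div_le_iff₀ (by positivity)]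
      linarith
  have hF_lim : ∀ᵐ x ∂P, Tendsto (fun τ => F τ x) (𝓝[>] 0)
      (𝓝 (p x ^ 2 / 2 + β * (H x h h / 2))) := by
    refine Eventually.of_forall fun x => tendsto_cexp_taylor ?_
    have h1 := ((Complex.continuous_ofReal.tendsto _).comp
      (M.tendsto_remainder_div_sq h x)).const_mul β
    refine (h1.congr fun τ => ?_).trans (le_of_eq ?_)
    · rw [hζp]
      simp only [Function.comp_apply]
      push_cast
      ring
    · push_cast
      rfl
  have hlim := tendsto_integral_filter_of_dominated_convergence bound hFm hF_le hbound_int hF_lim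
  have hpint : Integrable p P :=
    ((M.integrable_score a).ofReal.const_mul α).add ((M.integrable_score h).ofReal.const_mul β)
  -- Centring of the scores removes the term of order τ, so the quotient in the statement is exactly
  -- the integral of `F τ`.
  have hp0 : ∫ x, p x ∂P = 0 := by
    have h1 : ∫ x, p x ∂P = α * ∫ x, ((s x a : ℝ) : ℂ) ∂P + β * ∫ x, ((s x h : ℝ) : ℂ) ∂P := by
      rw [← integral_const_mul, ← integral_const_mul]
      exact integral_add ((M.integrable_score a).ofReal.const_mul α)
        ((M.integrable_score h).ofReal.const_mul β)
    rw [h1, integral_complex_ofReal, integral_complex_ofReal, M.integral_score, M.integral_score]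
    simp
  have hexp : ∀ τ : ℝ, 0 < τ → ∀ x,
      Complex.exp (ζ τ x) = (τ : ℂ) ^ 2 * F τ x + (1 + τ * p x) := fun τ hτ x => by
    have : (τ : ℂ) ≠ 0 := by exact_mod_cast hτ.ne'
    simp only [F]
    field_simp
    ring
  have hFi : ∀ᶠ τ in 𝓝[>] 0, Integrable (F τ) P := by
    filter_upwards [hFm, hF_le] with τ h1 h2
    exact hbound_int.mono' h1 h2
  refine ⟨?_, hlim.congr' ?_⟩
  · filter_upwards [hFi, self_mem_nhdsWithin] with τ h1 (h2 : 0 < τ)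
    have : (fun x => Complex.exp (ζ τ x)) = fun x => (τ : ℂ) ^ 2 * F τ x + (1 + τ * p x) :=
      funext (hexp τ h2)
    change Integrable (fun x => Complex.exp (ζ τ x)) P
    rw [this]
    exact (h1.const_mul _).add ((integrable_const _).add (hpint.const_mul _))
  · filter_upwards [hFi, self_mem_nhdsWithin] with τ h1 (h2 : 0 < τ)
    have hτ : (τ : ℂ) ≠ 0 := by exact_mod_cast h2.ne'
    have h3 : ∫ x, Complex.exp (ζ τ x) ∂P = (τ : ℂ) ^ 2 * ∫ x, F τ x ∂P + 1 := by
      simp_rw [hexp τ h2]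
      rw [integral_add (h1.const_mul _) ((integrable_const _).fun_add (hpint.const_mul _)),
        integral_add (integrable_const _) (hpint.const_mul _), integral_const_mul,
        integral_const_mul, hp0]
      simp
    change _ = (∫ x, Complex.exp (ζ τ x) ∂P - 1) / (τ : ℂ) ^ 2
    rw [h3]
    field_simp
    ring

lemma integrable_hess (M : LocalModel P r s H) (v w : E) : Integrable (fun x => H x v w) P := by
  obtain ⟨C, hC⟩ := M.hess_bdd
  refine Integrable.of_bound (M.measurable_hess v w).aestronglyMeasurable (C * ‖v‖ * ‖w‖)
    (Eventually.of_forall fun x => ?_)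
  exact ((H x v).le_opNorm w).trans (mul_le_mul_of_nonneg_right
    (((H x).le_opNorm v).trans (mul_le_mul_of_nonneg_right (hC x) (norm_nonneg v)))
    (norm_nonneg w))

lemma integral_sq_score (M : LocalModel P r s H) (α β : ℂ) (a h : E) :
    ∫ x, ((α * s x a + β * s x h) ^ 2 / 2 + β * (H x h h / 2)) ∂P =
      α ^ 2 * info P s a a / 2 + α * β * info P s a h + β ^ 2 * info P s h h / 2 +
        β * ((∫ x, H x h h ∂P : ℝ) / 2) := by
  have e : ∀ x, ((α * s x a + β * s x h) ^ 2 / 2 + β * (H x h h / 2) : ℂ) =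
      α ^ 2 / 2 * ((s x a * s x a : ℝ) : ℂ) + (α * β * ((s x a * s x h : ℝ) : ℂ) +
        (β ^ 2 / 2 * ((s x h * s x h : ℝ) : ℂ) + β / 2 * ((H x h h : ℝ) : ℂ))) := fun x => by
    push_cast
    ring
  simp_rw [e]
  have i1 : Integrable (fun x => ((s x a * s x a : ℝ) : ℂ)) P := (M.integrable_score_mul a a).ofReal
  have i2 : Integrable (fun x => ((s x a * s x h : ℝ) : ℂ)) P := (M.integrable_score_mul a h).ofReal
  have i3 : Integrable (fun x => ((s x h * s x h : ℝ) : ℂ)) P := (M.integrable_score_mul h h).ofReal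
  have i4 : Integrable (fun x => ((H x h h : ℝ) : ℂ)) P := (M.integrable_hess h h).ofReal
  rw [integral_add (i1.const_mul _) ((i2.const_mul _).fun_add ((i3.const_mul _).fun_add (i4.const_mul _))),
    integral_add (i2.const_mul _) ((i3.const_mul _).fun_add (i4.const_mul _)),
    integral_add (i3.const_mul _) (i4.const_mul _), integral_const_mul, integral_const_mul,
    integral_const_mul, integral_const_mul]
  simp only [integral_complex_ofReal, info]
  ring

/-- The information identity on the diagonal. -/
lemma integral_hess_self (M : LocalModel P r s H) (h : E) :
    ∫ x, H x h h ∂P = -info P s h h := by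
  -- With α = 0 and β = 1 the exponential is a likelihood ratio of integral one, so its second order
  -- coefficient must vanish.
  have h1 := (M.tendsto_integral_cexp_aux 0 h 0 1).2
  rw [M.integral_sq_score] at h1
  have h2 : Tendsto (fun _ : ℝ => (0 : ℂ)) (𝓝[>] 0)
      (𝓝 (0 ^ 2 * info P s 0 0 / 2 + 0 * 1 * info P s 0 h + 1 ^ 2 * info P s h h / 2 +
        1 * ((∫ x, H x h h ∂P : ℝ) / 2))) := by
    refine h1.congr' ?_
    filter_upwards [(tendsto_smul_nhdsGT_zero h).eventually M.integral_exp] with τ h3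
    have h4 : ∫ x, Complex.exp (τ * 0 * s x 0 + 1 * r (τ • h) x) ∂P = 1 := by
      have : ∀ x, Complex.exp (τ * 0 * s x 0 + 1 * r (τ • h) x) =
          ((Real.exp (r (τ • h) x) : ℝ) : ℂ) := fun x => by
        push_cast
        ring_nf
      simp_rw [this]
      rw [integral_complex_ofReal, h3]
      simp
    rw [h4]
    simp
  have h5 := tendsto_nhds_unique h2 tendsto_const_nhds
  have h6 : ((info P s h h / 2 + (∫ x, H x h h ∂P) / 2 : ℝ) : ℂ) = 0 := by
    rw [← h5]
    push_cast
    ring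
  have h7 : info P s h h / 2 + (∫ x, H x h h ∂P) / 2 = 0 := by exact_mod_cast h6
  linarith

/-- The information identity. -/
lemma integral_hess (M : LocalModel P r s H) (v w : E) :
    ∫ x, H x v w ∂P = -info P s v w := by
  -- Polarization, by symmetry of the Hessian and of the information.
  have h1 := M.integral_hess_self (v + w)
  have h2 := M.integral_hess_self v
  have h3 := M.integral_hess_self w
  have e1 : ∫ x, H x (v + w) (v + w) ∂P =
      ∫ x, H x v v ∂P + (2 * ∫ x, H x v w ∂P + ∫ x, H x w w ∂P) := by
    rw [← integral_const_mul, ← integral_add ((M.integrable_hess v w).const_mul 2)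
      (M.integrable_hess w w), ← integral_add (M.integrable_hess v v)
      (((M.integrable_hess v w).const_mul 2).fun_add (M.integrable_hess w w))]
    refine integral_congr_ae (Eventually.of_forall fun x => ?_)
    simp only [map_add, add_apply]
    rw [M.hess_symm x w v]
    ring
  have e2 : info P s (v + w) (v + w) = info P s v v + (2 * info P s v w + info P s w w) := by
    simp only [info]
    rw [← integral_const_mul, ← integral_add ((M.integrable_score_mul v w).const_mul 2)
      (M.integrable_score_mul w w), ← integral_add (M.integrable_score_mul v v)
      (((M.integrable_score_mul v w).const_mul 2).fun_add (M.integrable_score_mul w w))]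
    refine integral_congr_ae (Eventually.of_forall fun x => ?_)
    simp only [map_add]
    ring
  linarith

/-- Second order expansion of joint exponential moments of the score and the log-likelihood
ratio of one observation. -/
lemma tendsto_integral_cexp (M : LocalModel P r s H) (a h : E) (α β : ℂ) :
    Tendsto (fun τ : ℝ => (∫ x, Complex.exp (τ * α * s x a + β * r (τ • h) x) ∂P - 1) /
      (τ : ℂ) ^ 2) (𝓝[>] 0)
      (𝓝 (α ^ 2 * info P s a a / 2 + α * β * info P s a h +
        (β ^ 2 - β) * info P s h h / 2)) := by
  have h1 := (M.tendsto_integral_cexp_aux a h α β).2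
  rw [M.integral_sq_score, M.integral_hess] at h1
  convert h1 using 2
  push_cast
  ring

end LocalModel

end

end StudentT

/-! ### Gaussian limits for samples, contiguity and local alternatives. -/

namespace StudentT

section

variable {X : Type*} [MeasurableSpace X] {E : Type*} [NormedAddCommGroup E] [NormedSpace ℝ E]

/-- The central sequence: the scaled sum of the scores. -/
def centralSeq (s : X → E →L[ℝ] ℝ) {n : ℕ} (x : Fin n → X) : E →L[ℝ] ℝ :=
  (√(n : ℝ))⁻¹ • ∑ i, s (x i)

omit [MeasurableSpace X] in
lemma centralSeq_apply (s : X → E →L[ℝ] ℝ) {n : ℕ} (x : Fin n → X) (v : E) :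
    centralSeq s x v = (√(n : ℝ))⁻¹ * ∑ i, s (x i) v := by
  simp [centralSeq]

/-- The log-likelihood ratio of a sample at the local parameter `h / √n`. -/
def logRatio (r : E → X → ℝ) (h : E) {n : ℕ} (x : Fin n → X) : ℝ :=
  ∑ i, r ((√(n : ℝ))⁻¹ • h) (x i)

/-- The law of a sample at the local parameter `h / √n`. -/
def localLaw (P : Measure X) (r : E → X → ℝ) (h : E) (n : ℕ) : Measure (Fin n → X) :=
  Measure.pi fun _ =>
    P.withDensity fun x => ENNReal.ofReal (Real.exp (r ((√(n : ℝ))⁻¹ • h) x))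

lemma tendsto_inv_sqrt_nat : Tendsto (fun n : ℕ => (√(n : ℝ))⁻¹) atTop (𝓝[>] 0) := by
  refine tendsto_nhdsWithin_iff.2 ⟨?_, ?_⟩
  · exact tendsto_inv_atTop_zero.comp
      (Real.tendsto_sqrt_atTop.comp tendsto_natCast_atTop_atTop)
  · filter_upwards [eventually_gt_atTop 0] with n hn
    exact inv_pos.2 (Real.sqrt_pos.2 (by exact_mod_cast hn))

lemma tendsto_inv_sqrt_nat_smul (h : E) :
    Tendsto (fun n : ℕ => (√(n : ℝ))⁻¹ • h) atTop (𝓝 0) :=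
  (LocalModel.tendsto_smul_nhdsGT_zero h).comp tendsto_inv_sqrt_nat

namespace LocalModel

variable {P : Measure X} [IsProbabilityMeasure P] {r : E → X → ℝ} {s : X → E →L[ℝ] ℝ}
  {H : X → E →L[ℝ] E →L[ℝ] ℝ}

omit [IsProbabilityMeasure P] in
lemma measurable_centralSeq (M : LocalModel P r s H) (v : E) (n : ℕ) :
    Measurable fun x : Fin n → X => centralSeq s x v := by
  simp_rw [centralSeq_apply]
  exact (Finset.measurable_sum _ fun i _ =>
    (M.measurable_score v).comp (measurable_pi_apply i)).const_mul _

omit [IsProbabilityMeasure P] in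
lemma measurable_logRatio (M : LocalModel P r s H) (h : E) :
    ∀ᶠ n in atTop, Measurable fun x : Fin n → X => logRatio r h x := by
  filter_upwards [(tendsto_inv_sqrt_nat_smul h).eventually M.measurable_ratio] with n hn
  exact Finset.measurable_sum _ fun i _ => hn.comp (measurable_pi_apply i)

-- Factorization over the observations: the moment of a sample is the n-th power of the moment of
-- one observation at τ = n^(-1/2).
omit [MeasurableSpace X] in
lemma cexp_central_logRatio (a h : E) (α β : ℂ) {n : ℕ} (x : Fin n → X) :
    Complex.exp (α * centralSeq s x a + β * logRatio r h x) =
      ∏ i, Complex.exp (((√(n : ℝ))⁻¹ : ℝ) * α * s (x i) a +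
        β * r ((√(n : ℝ))⁻¹ • h) (x i)) := by
  rw [← Complex.exp_sum]
  congr 1
  rw [centralSeq_apply, logRatio, Finset.sum_add_distrib, ← Finset.mul_sum, ← Finset.mul_sum]
  push_cast
  ring

/-- Joint exponential moments of the central sequence and the log-likelihood ratio converge to
those of the Gaussian limit experiment. -/
lemma tendsto_integral_cexp_sample (M : LocalModel P r s H) (a h : E) (α β : ℂ) :
    (∀ᶠ n in atTop, Integrable (fun x : Fin n → X =>
      Complex.exp (α * centralSeq s x a + β * logRatio r h x)) (Measure.pi fun _ => P)) ∧
    Tendsto (fun n : ℕ => ∫ x : Fin n → X,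
      Complex.exp (α * centralSeq s x a + β * logRatio r h x) ∂Measure.pi fun _ => P) atTop
      (𝓝 (Complex.exp (α ^ 2 * info P s a a / 2 + α * β * info P s a h +
        (β ^ 2 - β) * info P s h h / 2))) := by
  constructor
  · filter_upwards [tendsto_inv_sqrt_nat.eventually (M.tendsto_integral_cexp_aux a h α β).1]
      with n hn
    simp_rw [cexp_central_logRatio]
    exact Integrable.fintype_prod fun _ => hn
  · have h1 := (M.tendsto_integral_cexp a h α β).comp tendsto_inv_sqrt_nat
    let g : ℕ → ℂ := fun n => ∫ x, Complex.exp (((√(n : ℝ))⁻¹ : ℝ) * α * s x a +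
        β * r ((√(n : ℝ))⁻¹ • h) x) ∂P - 1
    -- As τ² = 1 / n, the expansion for one observation is the limit of n g(n), and (1 + g(n))^n
    -- tends to its exponential.
    have h2 : Tendsto (fun n : ℕ => n * g n) atTop (𝓝 (α ^ 2 * info P s a a / 2 +
        α * β * info P s a h + (β ^ 2 - β) * info P s h h / 2)) := by
      refine h1.congr fun n => ?_
      simp only [Function.comp_apply]
      have h3 : (((√(n : ℝ))⁻¹ : ℝ) : ℂ) ^ 2 = ((n : ℂ))⁻¹ := by
        rw [← Complex.ofReal_pow, inv_pow, Real.sq_sqrt (Nat.cast_nonneg n)]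
        push_cast
        rfl
      rw [h3, div_inv_eq_mul, mul_comm]
    refine (Complex.tendsto_one_add_pow_exp_of_tendsto h2).congr fun n => ?_
    simp_rw [cexp_central_logRatio]
    rw [integral_fintype_prod_eq_pow (fun y => Complex.exp (((√(n : ℝ))⁻¹ : ℝ) * α * s y a +
      β * r ((√(n : ℝ))⁻¹ • h) y))]
    simp [g]

lemma tendsto_integral_exp_sample (M : LocalModel P r s H) (a h : E) (α β : ℝ) :
    (∀ᶠ n in atTop, Integrable (fun x : Fin n → X =>
      Real.exp (α * centralSeq s x a + β * logRatio r h x)) (Measure.pi fun _ => P)) ∧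
    Tendsto (fun n : ℕ => ∫ x : Fin n → X,
      Real.exp (α * centralSeq s x a + β * logRatio r h x) ∂Measure.pi fun _ => P) atTop
      (𝓝 (Real.exp (α ^ 2 * info P s a a / 2 + α * β * info P s a h +
        (β ^ 2 - β) * info P s h h / 2))) := by
  obtain ⟨h1, h2⟩ := M.tendsto_integral_cexp_sample a h α β
  have e : ∀ (n : ℕ) (x : Fin n → X), Complex.exp (α * centralSeq s x a + β * logRatio r h x) =
      ((Real.exp (α * centralSeq s x a + β * logRatio r h x) : ℝ) : ℂ) := fun n x => by
    push_cast
    rfl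
  constructor
  · filter_upwards [h1] with n hn
    simp_rw [e] at hn
    refine hn.re.congr (Eventually.of_forall fun x => ?_)
    simp only [RCLike.re_to_complex, Complex.ofReal_re]
  · have h3 := (Complex.continuous_re.tendsto _).comp h2
    simp_rw [e] at h3
    refine (h3.congr fun n => ?_).trans (le_of_eq ?_)
    · simp only [Function.comp_apply]
      rw [integral_complex_ofReal, Complex.ofReal_re]
    · congr 1
      rw [← Complex.ofReal_re (Real.exp _)]
      congr 1
      push_cast
      rfl

lemma localLaw_eq (M : LocalModel P r s H) (h : E) :
    ∀ᶠ n in atTop, IsProbabilityMeasure (localLaw P r h n) ∧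
      localLaw P r h n = (Measure.pi fun _ => P).withDensity
        fun x => ENNReal.ofReal (Real.exp (logRatio r h x)) := by
  filter_upwards [(tendsto_inv_sqrt_nat_smul h).eventually M.measurable_ratio,
    (tendsto_inv_sqrt_nat_smul h).eventually M.integrable_exp,
    (tendsto_inv_sqrt_nat_smul h).eventually M.integral_exp] with n h1 h2 h3
  have hp : IsProbabilityMeasure (P.withDensity fun x =>
      ENNReal.ofReal (Real.exp (r ((√(n : ℝ))⁻¹ • h) x))) := by
    refine ⟨?_⟩
    rw [withDensity_apply _ MeasurableSet.univ, Measure.restrict_univ,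
      ← ofReal_integral_eq_lintegral_ofReal h2
        (Eventually.of_forall fun x => (Real.exp_pos _).le), h3, ENNReal.ofReal_one]
  refine ⟨by unfold localLaw; infer_instance, ?_⟩
  rw [localLaw, pi_withDensity P (by fun_prop)]
  congr 1
  ext x
  rw [logRatio, Real.exp_sum, ENNReal.ofReal_prod_of_nonneg fun i _ => (Real.exp_pos _).le]

lemma integral_localLaw (M : LocalModel P r s H) (h : E) :
    ∀ᶠ n in atTop, ∀ f : (Fin n → X) → ℂ, ∫ x, f x ∂localLaw P r h n =
      ∫ x, (Real.exp (logRatio r h x) : ℂ) * f x ∂Measure.pi fun _ => P := by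
  filter_upwards [M.localLaw_eq h, M.measurable_logRatio h] with n h1 h2 f
  rw [h1.2, integral_withDensity_eq_integral_toReal_smul (by fun_prop)
    (Eventually.of_forall fun x => ENNReal.ofReal_lt_top)]
  refine integral_congr_ae (Eventually.of_forall fun x => ?_)
  simp only
  rw [ENNReal.toReal_ofReal (Real.exp_pos _).le]
  rfl

/-- Contiguity of the local alternatives. -/
lemma whp_localLaw_le (M : LocalModel P r s H) (h : E) :
    whp (fun n => localLaw P r h n) ≤ whp fun n => Measure.pi fun _ : Fin n => P := by
  intro A hA
  change Tendsto _ _ _ at hA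
  change Tendsto _ _ _
  -- The exponent β = 2 shows that second moments of the likelihood ratios stay bounded, here by B.
  obtain ⟨hi, hl⟩ := M.tendsto_integral_exp_sample 0 h 0 2
  set B : ℝ := Real.exp (0 ^ 2 * info P s 0 0 / 2 + 0 * 2 * info P s 0 h +
    (2 ^ 2 - 2) * info P s h h / 2) + 1 with hB
  have hB0 : 0 < B := by positivity
  have hle := hl.eventually (eventually_le_nhds (lt_add_one _))
  rw [ENNReal.tendsto_nhds_zero] at hA ⊢
  intro ε hε
  obtain ⟨e, he0, hee⟩ : ∃ e : ℝ, 0 < e ∧ ENNReal.ofReal e + ENNReal.ofReal e ≤ ε := by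
    obtain ⟨e, he0, hee⟩ := ENNReal.lt_iff_exists_nnreal_btwn.1 hε
    refine ⟨e / 2, half_pos (by exact_mod_cast he0), ?_⟩
    rw [← ENNReal.ofReal_add (by positivity) (by positivity), add_halves]
    simpa using hee.le
  set K : ℝ := B / e with hK
  have hK0 : 0 < K := by positivity
  filter_upwards [hi, hle, M.localLaw_eq h, M.measurable_logRatio h,
    hA (ENNReal.ofReal (e / K)) (by simpa using by positivity)] with n h1 h2 h3 h4 h5
  set μ : Measure (Fin n → X) := Measure.pi fun _ => P
  set S : Set (Fin n → X) := {ω | (⟨n, ω⟩ : Σ n, Fin n → X) ∉ A}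
  -- The inequality y ≤ K + y² / K splits the mass of an event into K times its probability under
  -- `μ`, which is small, and at most B / K = e.
  have h6 : ∀ x : Fin n → X, ENNReal.ofReal (Real.exp (logRatio r h x)) ≤
      ENNReal.ofReal K + ENNReal.ofReal
        (K⁻¹ * Real.exp (0 * centralSeq s x 0 + 2 * logRatio r h x)) := fun x => by
    rw [← ENNReal.ofReal_add hK0.le (by positivity)]
    refine ENNReal.ofReal_le_ofReal ?_
    rw [zero_mul, zero_add, two_mul, Real.exp_add]
    set y := Real.exp (logRatio r h x)
    have hy : 0 < y := Real.exp_pos _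
    have : K + K⁻¹ * (y * y) - y = K⁻¹ * ((K - y / 2) ^ 2 + 3 / 4 * y ^ 2) := by
      field_simp
      ring
    have : 0 ≤ K⁻¹ * ((K - y / 2) ^ 2 + 3 / 4 * y ^ 2) := by positivity
    linarith
  -- Events of `whp` need not be measurable, so a measurable hull of the same `μ`-measure is used.
  calc localLaw P r h n S ≤ localLaw P r h n (toMeasurable μ S) :=
        measure_mono (subset_toMeasurable μ S)
    _ = ∫⁻ x in toMeasurable μ S, ENNReal.ofReal (Real.exp (logRatio r h x)) ∂μ := by
        rw [h3.2, withDensity_apply _ (measurableSet_toMeasurable μ S)]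
    _ ≤ ∫⁻ x in toMeasurable μ S, (ENNReal.ofReal K + ENNReal.ofReal
        (K⁻¹ * Real.exp (0 * centralSeq s x 0 + 2 * logRatio r h x))) ∂μ :=
        lintegral_mono h6
    _ = ENNReal.ofReal K * μ S + ∫⁻ x in toMeasurable μ S, ENNReal.ofReal
        (K⁻¹ * Real.exp (0 * centralSeq s x 0 + 2 * logRatio r h x)) ∂μ := by
        rw [lintegral_add_left measurable_const, lintegral_const, Measure.restrict_apply_univ,
          measure_toMeasurable]
    _ ≤ ENNReal.ofReal K * ENNReal.ofReal (e / K) + ∫⁻ x, ENNReal.ofReal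
        (K⁻¹ * Real.exp (0 * centralSeq s x 0 + 2 * logRatio r h x)) ∂μ := by
        gcongr
        exact Measure.restrict_le_self
    _ = ENNReal.ofReal e + ENNReal.ofReal
        (K⁻¹ * ∫ x, Real.exp (0 * centralSeq s x 0 + 2 * logRatio r h x) ∂μ) := by
        rw [← ENNReal.ofReal_mul hK0.le, mul_div_cancel₀ _ hK0.ne', ← integral_const_mul,
          ofReal_integral_eq_lintegral_ofReal (h1.const_mul _)
            (Eventually.of_forall fun x => by positivity)]
    _ ≤ ENNReal.ofReal e + ENNReal.ofReal e := by
        gcongr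
        calc K⁻¹ * ∫ x, Real.exp (0 * centralSeq s x 0 + 2 * logRatio r h x) ∂μ
            ≤ K⁻¹ * B := by gcongr
          _ = e := by rw [hK]; field_simp
    _ ≤ ε := hee

/-- The characteristic function of the central sequence under local alternatives. -/
lemma tendsto_charFun_localLaw (M : LocalModel P r s H) (a h : E) (u : ℝ) :
    Tendsto (fun n => ∫ x, Complex.exp (u * centralSeq s x a * Complex.I) ∂localLaw P r h n)
      atTop (𝓝 (Complex.exp (u * info P s a h * Complex.I - u ^ 2 * info P s a a / 2))) := by
  -- Le Cam's third lemma: β = 1 inserts the likelihood ratio, which changes the measure, and α = iu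
  -- gives the characteristic function, with mean shift I(a, h).
  have h1 := (M.tendsto_integral_cexp_sample a h (u * Complex.I) 1).2
  have e : (u * Complex.I) ^ 2 * info P s a a / 2 + u * Complex.I * 1 * info P s a h +
      (1 ^ 2 - 1) * info P s h h / 2 =
      u * info P s a h * Complex.I - u ^ 2 * info P s a a / 2 := by
    rw [mul_pow, Complex.I_sq]
    ring
  rw [e] at h1
  refine h1.congr' ?_
  filter_upwards [M.integral_localLaw h] with n hn
  rw [hn]
  refine integral_congr_ae (Eventually.of_forall fun x => ?_)
  simp only
  rw [Complex.ofReal_exp, ← Complex.exp_add]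
  ring_nf

end LocalModel

end

end StudentT

/-! ### Tightness, truncation and mean square approximation of likelihood ratios. -/

namespace StudentT

section

section Tools

/-- A measure on a product both of whose marginals range over tight sets ranges over a tight
set. -/
lemma isTightMeasureSet_range_prod {ι A B : Type*} [TopologicalSpace A] [TopologicalSpace B]
    [MeasurableSpace A] [MeasurableSpace B] {μ : ι → Measure (A × B)}
    (h1 : IsTightMeasureSet (Set.range fun i => (μ i).map Prod.fst))
    (h2 : IsTightMeasureSet (Set.range fun i => (μ i).map Prod.snd)) :
    IsTightMeasureSet (Set.range μ) := by
  rw [isTightMeasureSet_iff_exists_isCompact_measure_compl_le] at *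
  intro ε hε
  obtain ⟨K, hK, hK'⟩ := h1 (ε / 2) (ENNReal.half_pos hε.ne')
  obtain ⟨K₂, hK₂, hK₂'⟩ := h2 (ε / 2) (ENNReal.half_pos hε.ne')
  refine ⟨K ×ˢ K₂, hK.prod hK₂, ?_⟩
  rintro _ ⟨i, rfl⟩
  have e1 := (Measure.le_map_apply measurable_fst.aemeasurable Kᶜ).trans (hK' _ ⟨i, rfl⟩)
  have e2 := (Measure.le_map_apply measurable_snd.aemeasurable K₂ᶜ).trans (hK₂' _ ⟨i, rfl⟩)
  calc μ i (K ×ˢ K₂)ᶜ ≤ μ i (Prod.fst ⁻¹' Kᶜ ∪ Prod.snd ⁻¹' K₂ᶜ) := by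
        refine measure_mono fun z hz => ?_
        by_contra hc
        simp only [Set.mem_union, Set.mem_preimage, Set.mem_compl_iff, not_or, not_not] at hc
        exact hz ⟨hc.1, hc.2⟩
    _ ≤ ε / 2 + ε / 2 := (measure_union_le _ _).trans (add_le_add e1 e2)
    _ = ε := ENNReal.add_halves ε

/-- Interchange of limits for uniformly good approximations. -/
lemma tendsto_of_approx {ι : Type*} {l : Filter ι} {f : ι → ℂ} {a : ℂ} {b : ℝ → ι → ℂ}
    {c : ℝ → ℂ} {B : ℝ} (hb : ∀ R, 0 < R → Tendsto (b R) l (𝓝 (c R)))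
    (hf : ∀ R, 0 < R → ∀ᶠ i in l, ‖f i - b R i‖ ≤ B / R)
    (ha : ∀ R, 0 < R → ‖c R - a‖ ≤ B / R) : Tendsto f l (𝓝 a) := by
  rw [Metric.tendsto_nhds]
  intro ε hε
  set R : ℝ := 4 * (|B| + 1) / ε with hR
  have hR0 : 0 < R := by positivity
  have hBR : B / R ≤ ε / 4 := by
    rw [div_le_iff₀ hR0, hR]
    have : ε / 4 * (4 * (|B| + 1) / ε) = |B| + 1 := by field_simp
    rw [this]
    linarith [le_abs_self B]
  filter_upwards [(Metric.tendsto_nhds.1 (hb R hR0)) (ε / 4) (by positivity), hf R hR0]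
    with i h1 h2
  rw [dist_eq_norm] at h1 ⊢
  have h3 : f i - a = (f i - b R i) + ((b R i - c R) + (c R - a)) := by ring
  rw [h3]
  have := (norm_add_le (f i - b R i) ((b R i - c R) + (c R - a))).trans
    (add_le_add_right (norm_add_le (b R i - c R) (c R - a)) _)
  linarith [ha R hR0]

lemma cexp_ofReal_mul_I_norm (u y : ℝ) : ‖Complex.exp (u * y * Complex.I)‖ = 1 := by
  have := Complex.norm_exp_ofReal_mul_I (u * y)
  push_cast at this
  exact this

/-- The bounded function `(y, d) ↦ e^{iuy} min(e^{td}, R)`. -/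
def truncExp (u t R : ℝ) : (ℝ × ℝ) →ᵇ ℂ :=
  BoundedContinuousFunction.ofNormedAddCommGroup
    (fun z => Complex.exp (u * z.1 * Complex.I) * ((min (Real.exp (t * z.2)) R : ℝ) : ℂ))
    (by fun_prop) (|R|) (fun z => by
      rw [norm_mul, cexp_ofReal_mul_I_norm, one_mul, Complex.norm_real, Real.norm_eq_abs]
      rcases le_total (Real.exp (t * z.2)) R with h | h
      · rw [min_eq_left h, abs_of_pos (Real.exp_pos _)]
        exact h.trans (le_abs_self R)
      · rw [min_eq_right h])

lemma truncExp_apply (u t R : ℝ) (z : ℝ × ℝ) : truncExp u t R z =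
    Complex.exp (u * z.1 * Complex.I) * ((min (Real.exp (t * z.2)) R : ℝ) : ℂ) := rfl

/-- The error is nonzero only where exp(t d) > R, and there exp(t d) ≤ exp(2 t d) / R. Bounded
second exponential moments thus make the truncation uniformly good. -/
lemma norm_sub_truncExp_le (u t : ℝ) {R : ℝ} (hR : 0 < R) (z : ℝ × ℝ) :
    ‖Complex.exp (u * z.1 * Complex.I + t * z.2) - truncExp u t R z‖ ≤
      Real.exp (2 * t * z.2) / R := by
  have h1 : Complex.exp (u * z.1 * Complex.I + t * z.2) - truncExp u t R z =
      Complex.exp (u * z.1 * Complex.I) *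
        ((Real.exp (t * z.2) - min (Real.exp (t * z.2)) R : ℝ) : ℂ) := by
    rw [truncExp_apply, Complex.exp_add]
    push_cast
    ring
  rw [h1, norm_mul, cexp_ofReal_mul_I_norm, one_mul, Complex.norm_real, Real.norm_eq_abs]
  have h2 : Real.exp (2 * t * z.2) = Real.exp (t * z.2) * Real.exp (t * z.2) := by
    rw [← Real.exp_add]; ring_nf
  rcases le_total (Real.exp (t * z.2)) R with h | h
  · rw [min_eq_left h, sub_self, abs_zero]
    positivity
  · rw [min_eq_right h, abs_of_nonneg (by linarith), h2, le_div_iff₀ hR]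
    nlinarith [Real.exp_pos (t * z.2)]

end Tools

section Gaussian

variable {π : Measure (ℝ × ℝ)} {J : NNReal}

lemma integrable_exp_snd (h : π.map Prod.snd = gaussianReal 0 J) (t : ℝ) :
    Integrable (fun z : ℝ × ℝ => Real.exp (t * z.2)) π := by
  have h1 : Integrable (fun d : ℝ => Real.exp (t * d)) (π.map Prod.snd) := by
    rw [h]
    exact integrable_exp_mul_gaussianReal t
  exact h1.comp_measurable measurable_snd

lemma integrable_exp_abs_snd (h : π.map Prod.snd = gaussianReal 0 J) (t : ℝ) :
    Integrable (fun z : ℝ × ℝ => Real.exp (t * |z.2|)) π := by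
  refine ((integrable_exp_snd h t).add (integrable_exp_snd h (-t))).mono' (by fun_prop)
    (Eventually.of_forall fun z => ?_)
  simp only [Real.norm_eq_abs, Real.abs_exp, Pi.add_apply]
  rcases abs_cases z.2 with h | h
  · rw [h.1]
    linarith [Real.exp_pos (-t * z.2)]
  · rw [h.1, mul_neg, ← neg_mul]
    linarith [Real.exp_pos (t * z.2)]

/-- Exponential moments in a coordinate with Gaussian distribution depend holomorphically on the
exponent. -/
lemma differentiable_integral_cexp (h : π.map Prod.snd = gaussianReal 0 J) (u : ℝ) :
    Differentiable ℂ fun w : ℂ =>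
      ∫ z, Complex.exp (u * z.1 * Complex.I + w * z.2) ∂π := by
  intro w₀
  have hle : ∀ w : ℂ, ∀ z : ℝ × ℝ, ‖Complex.exp (u * z.1 * Complex.I + w * z.2)‖ ≤
      Real.exp (‖w‖ * |z.2|) := fun w z => by
    rw [Complex.exp_add, norm_mul, cexp_ofReal_mul_I_norm, one_mul]
    refine (Complex.norm_exp_le_exp_norm _).trans (le_of_eq ?_)
    rw [norm_mul, Complex.norm_real, Real.norm_eq_abs]
  -- On the unit ball about w₀ the exponent has size at most (‖w₀‖ + 1) |d|; one further exp |d|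
  -- absorbs the factor d produced by differentiation, whence ‖w₀‖ + 2.
  have key := hasDerivAt_integral_of_dominated_loc_of_deriv_le
    (F := fun (w : ℂ) (z : ℝ × ℝ) => Complex.exp (u * z.1 * Complex.I + w * z.2))
    (F' := fun (w : ℂ) (z : ℝ × ℝ) => Complex.exp (u * z.1 * Complex.I + w * z.2) * z.2)
    (μ := π) (x₀ := w₀) (s := Metric.ball w₀ 1)
    (bound := fun z => Real.exp ((‖w₀‖ + 2) * |z.2|)) (Metric.ball_mem_nhds _ one_pos)
    (Eventually.of_forall fun w => by fun_prop) ?_ (by fun_prop) ?_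
    (integrable_exp_abs_snd h _) ?_
  · exact key.2.differentiableAt
  · exact (integrable_exp_abs_snd h ‖w₀‖).mono' (by fun_prop)
      (Eventually.of_forall fun z => hle w₀ z)
  · refine Eventually.of_forall fun z w hw => ?_
    have hw' : ‖w‖ ≤ ‖w₀‖ + 1 := by
      have h1 : ‖w - w₀‖ < 1 := by simpa [dist_eq_norm] using hw
      have h2 := norm_add_le (w - w₀) w₀
      rw [sub_add_cancel] at h2
      linarith
    rw [norm_mul, Complex.norm_real, Real.norm_eq_abs]
    have h3 : |z.2| ≤ Real.exp |z.2| := (le_add_of_nonneg_right zero_le_one).trans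
      (Real.add_one_le_exp _)
    calc _ ≤ Real.exp ((‖w₀‖ + 1) * |z.2|) * Real.exp |z.2| := by
          refine mul_le_mul ((hle w z).trans ?_) h3 (abs_nonneg _) (Real.exp_pos _).le
          exact Real.exp_le_exp.2 (mul_le_mul_of_nonneg_right hw' (abs_nonneg _))
      _ = _ := by rw [← Real.exp_add]; ring_nf
  · refine Eventually.of_forall fun z w _ => ?_
    have h1 : HasDerivAt (fun w : ℂ => u * z.1 * Complex.I + w * z.2) (z.2 : ℂ) w := by
      simpa using ((hasDerivAt_id w).mul_const (z.2 : ℂ)).const_add (u * z.1 * Complex.I : ℂ)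
    exact h1.cexp

end Gaussian

section Convolution

variable {X : Type*} [MeasurableSpace X] {E : Type*} [NormedAddCommGroup E] [NormedSpace ℝ E]
  {P : Measure X} [IsProbabilityMeasure P] {r : E → X → ℝ} {s : X → E →L[ℝ] ℝ}
  {H : X → E →L[ℝ] E →L[ℝ] ℝ}

namespace LocalModel

omit [IsProbabilityMeasure P] in
lemma info_smul_smul (v : E) (t : ℝ) : info P s (t • v) (t • v) = t ^ 2 * info P s v v := by
  simp only [info, map_smul, smul_eq_mul]
  rw [← integral_const_mul]
  congr 1
  ext x
  ring

omit [IsProbabilityMeasure P] in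
lemma info_smul_right (v w : E) (t : ℝ) : info P s v (t • w) = t * info P s v w := by
  simp only [info, map_smul, smul_eq_mul]
  rw [← integral_const_mul]
  congr 1
  ext x
  ring

/-- Local asymptotic normality in quadratic mean of the likelihood ratios. -/
lemma tendsto_integral_sq_ratio_sub (M : LocalModel P r s H) (v : E) (t : ℝ) :
    (∀ᶠ n in atTop, Integrable (fun x : Fin n → X => (Real.exp (logRatio r (t • v) x) -
      Real.exp (t * centralSeq s x v - t ^ 2 * info P s v v / 2)) ^ 2)
      (Measure.pi fun _ => P)) ∧
    Tendsto (fun n : ℕ => ∫ x : Fin n → X, (Real.exp (logRatio r (t • v) x) -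
      Real.exp (t * centralSeq s x v - t ^ 2 * info P s v v / 2)) ^ 2 ∂Measure.pi fun _ => P)
      atTop (𝓝 0) := by
  set J := info P s v v with hJ
  obtain ⟨i1, l1⟩ := M.tendsto_integral_exp_sample v (t • v) 0 2
  obtain ⟨i2, l2⟩ := M.tendsto_integral_exp_sample v (t • v) t 1
  obtain ⟨i3, l3⟩ := M.tendsto_integral_exp_sample v (t • v) (2 * t) 0
  -- Expanding the square leaves three exponential moments, with exponents (0, 2), (t, 1) and (2t,
  -- 0). With their coefficients they tend to exp(t² J) times 1, -2 and 1.
  have e : ∀ (n : ℕ) (x : Fin n → X), (Real.exp (logRatio r (t • v) x) -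
      Real.exp (t * centralSeq s x v - t ^ 2 * J / 2)) ^ 2 =
      Real.exp (0 * centralSeq s x v + 2 * logRatio r (t • v) x) +
      (-2 * Real.exp (-(t ^ 2 * J / 2)) *
        Real.exp (t * centralSeq s x v + 1 * logRatio r (t • v) x) +
      Real.exp (-(t ^ 2 * J)) *
        Real.exp (2 * t * centralSeq s x v + 0 * logRatio r (t • v) x)) := fun n x => by
    rw [sub_sq, mul_assoc (-2 : ℝ), ← Real.exp_add, ← Real.exp_add, ← Real.exp_nat_mul,
      ← Real.exp_nat_mul, mul_assoc (2 : ℝ) (Real.exp _), ← Real.exp_add]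
    push_cast
    ring_nf
  simp_rw [e]
  constructor
  · filter_upwards [i1, i2, i3] with n h1 h2 h3
    exact h1.fun_add ((h2.const_mul _).fun_add (h3.const_mul _))
  · have l4 := l1.add ((l2.const_mul (-2 * Real.exp (-(t ^ 2 * J / 2)))).add
      (l3.const_mul (Real.exp (-(t ^ 2 * J)))))
    have e0 : Real.exp (0 ^ 2 * info P s v v / 2 + 0 * 2 * info P s v (t • v) +
        (2 ^ 2 - 2) * info P s (t • v) (t • v) / 2) + (-2 * Real.exp (-(t ^ 2 * J / 2)) *
        Real.exp (t ^ 2 * info P s v v / 2 + t * 1 * info P s v (t • v) +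
        (1 ^ 2 - 1) * info P s (t • v) (t • v) / 2) + Real.exp (-(t ^ 2 * J)) *
        Real.exp ((2 * t) ^ 2 * info P s v v / 2 + 2 * t * 0 * info P s v (t • v) +
        (0 ^ 2 - 0) * info P s (t • v) (t • v) / 2)) = 0 := by
      rw [info_smul_smul, info_smul_right, ← hJ, mul_assoc (-2 : ℝ), ← Real.exp_add,
        ← Real.exp_add]
      ring_nf
    rw [e0] at l4
    refine l4.congr' ?_
    filter_upwards [i1, i2, i3] with n h1 h2 h3
    rw [integral_add h1 ((h2.const_mul _).fun_add (h3.const_mul _)),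
      integral_add (h2.const_mul _) (h3.const_mul _), integral_const_mul, integral_const_mul]

/-- Joint exponential moments of a statistic and the central sequence, from the limits of its
characteristic function under the local alternatives. -/
lemma tendsto_integral_cexp_of_tendstoLaw (M : LocalModel P r s H) (v : E)
    {Y : ∀ n, (Fin n → X) → ℝ} (hY : ∀ n, Measurable (Y n)) {L : Measure ℝ}
    [IsProbabilityMeasure L] (t u : ℝ)
    (h : TendstoLaw (fun n => localLaw P r (t • v) n) (fun n x => Y n x - t) L) :
    Tendsto (fun n => ∫ x, Complex.exp (u * Y n x * Complex.I + t * centralSeq s x v)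
      ∂Measure.pi fun _ : Fin n => P) atTop
      (𝓝 (Complex.exp (u * t * Complex.I + t ^ 2 * info P s v v / 2) * charFun L u)) := by
  set J := info P s v v with hJ
  have h1 := (tendstoLaw_iff_charFun ((M.localLaw_eq (t • v)).mono fun n hn => hn.1)
    (fun n => (hY n).sub_const t)).1 h u
  -- The hypothesis under the local law becomes a statement under P weighted by the likelihood
  -- ratio; the centring t comes out as a phase.
  have h2 : Tendsto (fun n => ∫ x, (Real.exp (logRatio r (t • v) x) : ℂ) *
      Complex.exp (u * Y n x * Complex.I) ∂Measure.pi fun _ : Fin n => P) atTop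
      (𝓝 (Complex.exp (u * t * Complex.I) * charFun L u)) := by
    refine (h1.const_mul (Complex.exp (u * t * Complex.I))).congr' ?_
    filter_upwards [M.integral_localLaw (t • v)] with n hn
    rw [hn, ← integral_const_mul]
    refine integral_congr_ae (Eventually.of_forall fun x => ?_)
    simp only
    rw [mul_left_comm, ← Complex.exp_add]
    push_cast
    ring_nf
  have h3 : Tendsto (fun n => ∫ x, (Real.exp (t * centralSeq s x v - t ^ 2 * J / 2) : ℂ) *
      Complex.exp (u * Y n x * Complex.I) ∂Measure.pi fun _ : Fin n => P) atTop
      (𝓝 (Complex.exp (u * t * Complex.I) * charFun L u)) := by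
    obtain ⟨hi, hl⟩ := M.tendsto_integral_sq_ratio_sub v t
    rw [← hJ] at hi hl
    have hi1 := (M.tendsto_integral_exp_sample v (t • v) 0 1).1
    have hi2 := (M.tendsto_integral_exp_sample v (t • v) t 0).1
    have hd : Tendsto (fun n => ∫ x, (Real.exp (logRatio r (t • v) x) : ℂ) *
        Complex.exp (u * Y n x * Complex.I) ∂(Measure.pi fun _ : Fin n => P) -
        ∫ x, (Real.exp (t * centralSeq s x v - t ^ 2 * J / 2) : ℂ) *
        Complex.exp (u * Y n x * Complex.I) ∂Measure.pi fun _ : Fin n => P) atTop (𝓝 0) := by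
      rw [Metric.tendsto_nhds]
      intro ε hε
      filter_upwards [hi, hi1, hi2, hl.eventually (gt_mem_nhds (by positivity : 0 < ε ^ 2 / 4))]
        with n k1 k2 k3 k4
      have m1 : Measurable fun x : Fin n → X => Complex.exp (u * Y n x * Complex.I) := by
        have := hY n
        fun_prop
      have k2' : Integrable (fun x : Fin n → X => (Real.exp (logRatio r (t • v) x) : ℂ) *
          Complex.exp (u * Y n x * Complex.I)) (Measure.pi fun _ => P) := by
        refine Integrable.mul_bdd (c := 1) ?_ m1.aestronglyMeasurable
          (Eventually.of_forall fun x => (cexp_ofReal_mul_I_norm _ _).le)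
        simpa using k2.ofReal (𝕜 := ℂ)
      have k3' : Integrable (fun x : Fin n → X =>
          (Real.exp (t * centralSeq s x v - t ^ 2 * J / 2) : ℂ) *
          Complex.exp (u * Y n x * Complex.I)) (Measure.pi fun _ => P) := by
        refine Integrable.mul_bdd (c := 1) ?_ m1.aestronglyMeasurable
          (Eventually.of_forall fun x => (cexp_ofReal_mul_I_norm _ _).le)
        have := (k3.const_mul (Real.exp (-(t ^ 2 * J / 2)))).ofReal (𝕜 := ℂ)
        refine this.congr (Eventually.of_forall fun x => ?_)
        simp only [← Real.exp_add]
        ring_nf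
        rfl
      rw [dist_zero_right, ← integral_sub k2' k3']
      -- The inequality |w| ≤ ε / 4 + w² / ε passes from the mean square approximation to the mean
      -- one.
      have hb : ∀ x : Fin n → X, ‖(Real.exp (logRatio r (t • v) x) : ℂ) *
          Complex.exp (u * Y n x * Complex.I) -
          (Real.exp (t * centralSeq s x v - t ^ 2 * J / 2) : ℂ) *
          Complex.exp (u * Y n x * Complex.I)‖ ≤ ε / 4 + ε⁻¹ *
          (Real.exp (logRatio r (t • v) x) -
            Real.exp (t * centralSeq s x v - t ^ 2 * J / 2)) ^ 2 := fun x => by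
        rw [← sub_mul, norm_mul, cexp_ofReal_mul_I_norm, mul_one, ← Complex.ofReal_sub,
          Complex.norm_real, Real.norm_eq_abs]
        set w := Real.exp (logRatio r (t • v) x) -
            Real.exp (t * centralSeq s x v - t ^ 2 * J / 2)
        have : ε / 4 + ε⁻¹ * w ^ 2 - |w| = ε⁻¹ * (ε / 2 - |w|) ^ 2 := by
          rw [← sq_abs w]
          field_simp
          ring
        have : 0 ≤ ε⁻¹ * (ε / 2 - |w|) ^ 2 := by positivity
        linarith
      calc _ ≤ ∫ x : Fin n → X, (ε / 4 + ε⁻¹ * (Real.exp (logRatio r (t • v) x) -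
            Real.exp (t * centralSeq s x v - t ^ 2 * J / 2)) ^ 2) ∂Measure.pi fun _ => P :=
            norm_integral_le_of_norm_le ((integrable_const _).fun_add (k1.const_mul _))
              (Eventually.of_forall hb)
        _ = ε / 4 + ε⁻¹ * ∫ x : Fin n → X, (Real.exp (logRatio r (t • v) x) -
            Real.exp (t * centralSeq s x v - t ^ 2 * J / 2)) ^ 2 ∂Measure.pi fun _ => P := by
            rw [integral_add (integrable_const _) (k1.const_mul _), integral_const_mul]
            simp
        _ < ε / 4 + ε⁻¹ * (ε ^ 2 / 4) := by gcongr
        _ ≤ ε := by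
            have : ε⁻¹ * (ε ^ 2 / 4) = ε / 4 := by field_simp
            linarith
    simpa using h2.sub hd
  have h4 := h3.const_mul (Complex.exp (t ^ 2 * J / 2))
  rw [← mul_assoc, ← Complex.exp_add, add_comm] at h4
  refine h4.congr fun n => ?_
  rw [← integral_const_mul]
  refine integral_congr_ae (Eventually.of_forall fun x => ?_)
  simp only
  rw [Complex.ofReal_exp, ← mul_assoc, ← Complex.exp_add, ← Complex.exp_add]
  push_cast
  ring_nf

end LocalModel

end Convolution

end

end StudentT

/-! ### Regularity of asymptotically linear statistics and the convolution theorem. -/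

namespace StudentT

section

variable {X : Type*} [MeasurableSpace X] {E : Type*} [NormedAddCommGroup E] [NormedSpace ℝ E]
  {P : Measure X} [IsProbabilityMeasure P] {r : E → X → ℝ} {s : X → E →L[ℝ] ℝ}
  {H : X → E →L[ℝ] E →L[ℝ] ℝ}

namespace LocalModel

omit [IsProbabilityMeasure P] in
lemma localLaw_zero (hr : ∀ x, r 0 x = 0) (n : ℕ) :
    localLaw P r 0 n = Measure.pi fun _ => P := by
  simp [localLaw, hr]

/-- A statistic that is asymptotically equivalent to the efficient linear one is asymptotically
normal, and regular, under all local alternatives. -/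
theorem tendstoLaw_of_asymptotically_linear (M : LocalModel P r s H) {v : E} {J : ℝ}
    (hJ0 : 0 < J) (hJ : info P s v v = J) {κ : E → ℝ} (hκ : ∀ h, info P s v h = J * κ h)
    {Y : ∀ n, (Fin n → X) → ℝ} (hY : ∀ n, Measurable (Y n))
    (hlin : Tendsto (fun z : Σ n, Fin n → X => Y z.1 z.2 - J⁻¹ * centralSeq s z.2 v)
      (whp fun n => Measure.pi fun _ : Fin n => P) (𝓝 0)) (h : E) :
    TendstoLaw (fun n => localLaw P r h n) (fun n x => Y n x - κ h)
      (gaussianReal 0 J⁻¹.toNNReal) := by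
  rw [tendstoLaw_iff_charFun ((M.localLaw_eq h).mono fun n hn => hn.1)
    (fun n => (hY n).sub_const _)]
  intro u
  refine tendsto_charFun_of_sub ((M.localLaw_eq h).mono fun n hn => hn.1)
    (W := fun n x => J⁻¹ * centralSeq s x v - κ h) (fun n => (hY n).sub_const _)
    (fun n => ((M.measurable_centralSeq v n).const_mul _).sub_const _) ?_ u ?_
  -- Contiguity carries the o_P(1) remainder over to the local alternatives.
  · refine (hlin.mono_left (M.whp_localLaw_le h)).congr fun z => ?_
    ring
  -- At frequency u / J the mean shift J κ(h) becomes κ(h), which the centring removes.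
  · have h1 := (M.tendsto_charFun_localLaw v h (u * J⁻¹)).const_mul
      (Complex.exp (-(u * κ h * Complex.I)))
    rw [← Complex.exp_add, hκ, hJ] at h1
    have e : -(u * κ h * Complex.I) + (((u * J⁻¹ : ℝ) : ℂ) * ((J * κ h : ℝ) : ℂ) * Complex.I -
        ((u * J⁻¹ : ℝ) : ℂ) ^ 2 * J / 2) = u * (0 : ℝ) * Complex.I - (J⁻¹.toNNReal : ℝ) * u ^ 2 / 2 := by
      have hJc : (J : ℂ) ≠ 0 := by exact_mod_cast hJ0.ne'
      rw [Real.coe_toNNReal _ (inv_nonneg.2 hJ0.le)]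
      push_cast
      field_simp
      ring
    rw [e] at h1
    rw [charFun_gaussianReal]
    refine h1.congr fun n => ?_
    rw [← integral_const_mul]
    refine integral_congr_ae (Eventually.of_forall fun x => ?_)
    simp only
    rw [← Complex.exp_add]
    push_cast
    ring_nf

/-- The limits of the joint law of a regular statistic and the efficient central sequence. -/
lemma exists_joint_limit (M : LocalModel P r s H) (v : E) (hr : ∀ x, r 0 x = 0)
    {Y : ∀ n, (Fin n → X) → ℝ} (hY : ∀ n, Measurable (Y n)) {L : Measure ℝ}
    [IsProbabilityMeasure L]
    (h : ∀ t : ℝ, TendstoLaw (fun n => localLaw P r (t • v) n) (fun n x => Y n x - t) L) :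
    ∃ π : Measure (ℝ × ℝ), IsProbabilityMeasure π ∧
      π.map Prod.snd = gaussianReal 0 (info P s v v).toNNReal ∧
      ∀ t u : ℝ, ∫ z, Complex.exp (u * z.1 * Complex.I + t * z.2) ∂π =
        Complex.exp (u * t * Complex.I + t ^ 2 * info P s v v / 2) * charFun L u := by
  set J := info P s v v with hJ
  have hJ0 : 0 ≤ J := integral_nonneg fun x => mul_self_nonneg _
  let Z : ∀ n, (Fin n → X) → ℝ × ℝ := fun n x => (Y n x, centralSeq s x v)
  have hZ : ∀ n, Measurable (Z n) := fun n => (hY n).prodMk (M.measurable_centralSeq v n)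
  let μ : ℕ → ProbabilityMeasure (ℝ × ℝ) := fun n =>
    ⟨(Measure.pi fun _ : Fin n => P).map (Z n),
      Measure.isProbabilityMeasure_map (hZ n).aemeasurable⟩
  have hμ : ∀ n, (μ n : Measure (ℝ × ℝ)) = (Measure.pi fun _ : Fin n => P).map (Z n) :=
    fun n => rfl
  have hfst : ∀ n, ((μ n : Measure (ℝ × ℝ))).map Prod.fst =
      (Measure.pi fun _ : Fin n => P).map (Y n) := fun n => by
    rw [hμ, Measure.map_map measurable_fst (hZ n)]
    rfl
  have hsnd : ∀ n, ((μ n : Measure (ℝ × ℝ))).map Prod.snd =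
      (Measure.pi fun _ : Fin n => P).map (fun x => centralSeq s x v) := fun n => by
    rw [hμ, Measure.map_map measurable_snd (hZ n)]
    rfl
  have hlim : ∀ t u : ℝ, Tendsto (fun n => ∫ x, Complex.exp (u * Y n x * Complex.I +
      t * centralSeq s x v) ∂Measure.pi fun _ : Fin n => P) atTop
      (𝓝 (Complex.exp (u * t * Complex.I + t ^ 2 * J / 2) * charFun L u)) := fun t u =>
    M.tendsto_integral_cexp_of_tendstoLaw v hY t u (h t)
  -- The case t = 0 gives convergence of the first marginal. Both marginals are then tight by
  -- continuity of the limiting characteristic functions, and so are the joint laws.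
  have hcY : ∀ u : ℝ, Tendsto (fun n => charFun (((μ n : Measure (ℝ × ℝ))).map Prod.fst) u) atTop
      (𝓝 (charFun L u)) := fun u => by
    have h1 := hlim 0 u
    simp only [Complex.ofReal_zero, zero_mul, mul_zero, add_zero, ne_eq, OfNat.ofNat_ne_zero,
      not_false_eq_true, zero_pow, zero_div, Complex.exp_zero, one_mul] at h1
    refine h1.congr fun n => ?_
    rw [hfst, charFun_apply_real, integral_map (hY n).aemeasurable (by fun_prop)]
  have hcD : ∀ u : ℝ, Tendsto (fun n => charFun (((μ n : Measure (ℝ × ℝ))).map Prod.snd) u) atTop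
      (𝓝 (charFun (gaussianReal 0 J.toNNReal) u)) := fun u => by
    have h1 := M.tendsto_charFun_localLaw v 0 u
    rw [charFun_gaussianReal, Real.coe_toNNReal _ hJ0]
    have e : info P s v 0 = 0 := by simp [info]
    rw [e, ← hJ] at h1
    refine (h1.congr fun n => ?_).trans (le_of_eq ?_)
    · rw [hsnd, charFun_apply_real,
        integral_map (M.measurable_centralSeq v n).aemeasurable (by fun_prop),
        localLaw_zero hr]
    · congr 2
      push_cast
      ring
  have htight : IsTightMeasureSet {((ρ : ProbabilityMeasure (ℝ × ℝ)) : Measure (ℝ × ℝ)) |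
      ρ ∈ Set.range μ} := by
    have h1 : IsTightMeasureSet (Set.range fun n => (μ n : Measure (ℝ × ℝ))) := by
      have : ∀ n, IsProbabilityMeasure ((μ n : Measure (ℝ × ℝ)).map Prod.fst) := fun n =>
        Measure.isProbabilityMeasure_map measurable_fst.aemeasurable
      have : ∀ n, IsProbabilityMeasure ((μ n : Measure (ℝ × ℝ)).map Prod.snd) := fun n =>
        Measure.isProbabilityMeasure_map measurable_snd.aemeasurable
      refine isTightMeasureSet_range_prod ?_ ?_
      · exact isTightMeasureSet_of_tendsto_charFun (continuous_charFun.continuousAt) hcY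
      · exact isTightMeasureSet_of_tendsto_charFun (continuous_charFun.continuousAt) hcD
    convert h1 using 1
    ext ρ
    simp
  have hcompact := isCompact_closure_of_isTightMeasureSet htight
  -- A limit along a nonprincipal ultrafilter plays the role of a subsequential limit.
  obtain ⟨π, -, hπ⟩ := hcompact.ultrafilter_le_nhds ((hyperfilter ℕ).map μ)
    (by
      rw [Ultrafilter.coe_map]
      exact (tendsto_principal.2 (Eventually.of_forall fun n => subset_closure ⟨n, rfl⟩)))
  have hπ' : Tendsto μ (hyperfilter ℕ) (𝓝 π) := hπ
  rw [ProbabilityMeasure.tendsto_iff_forall_integral_rclike_tendsto ℂ] at hπ'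
  have hmarg : (π : Measure (ℝ × ℝ)).map Prod.snd = gaussianReal 0 J.toNNReal := by
    have : IsProbabilityMeasure ((π : Measure (ℝ × ℝ)).map Prod.snd) :=
      Measure.isProbabilityMeasure_map measurable_snd.aemeasurable
    refine Measure.ext_of_charFun (funext fun u => ?_)
    refine tendsto_nhds_unique ?_ ((hcD u).mono_left Nat.hyperfilter_le_atTop)
    let f : (ℝ × ℝ) →ᵇ ℂ := BoundedContinuousFunction.ofNormedAddCommGroup
      (fun z => Complex.exp (u * z.2 * Complex.I)) (by fun_prop) 1
      (fun z => (cexp_ofReal_mul_I_norm _ _).le)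
    have hf : ∀ ρ : Measure (ℝ × ℝ), charFun (ρ.map Prod.snd) u = ∫ z, f z ∂ρ := fun ρ => by
      rw [charFun_apply_real, integral_map measurable_snd.aemeasurable (by fun_prop)]
      rfl
    simp_rw [hf]
    exact hπ' f
  refine ⟨π, inferInstance, hmarg, fun t u => ?_⟩
  refine tendsto_nhds_unique ?_ ((hlim t u).mono_left Nat.hyperfilter_le_atTop)
  -- The function exp(iuy + td) is unbounded, so weak convergence applies only to its truncations;
  -- moments at 2t control the truncation error along the sequence and at the limit.
  obtain ⟨i1, l1⟩ := M.tendsto_integral_exp_sample v 0 (2 * t) 0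
  obtain ⟨i2, -⟩ := M.tendsto_integral_exp_sample v 0 t 0
  simp only [zero_mul, add_zero] at i1 i2 l1
  obtain ⟨B₁, hB₁⟩ : ∃ B₁ : ℝ, ∀ᶠ n in atTop, ∫ x : Fin n → X,
      Real.exp (2 * t * centralSeq s x v) ∂(Measure.pi fun _ => P) ≤ B₁ :=
    ⟨_, l1.eventually (eventually_le_nhds (lt_add_one _))⟩
  have hexp2 := integrable_exp_snd hmarg (2 * t)
  set B : ℝ := max B₁ (∫ z, Real.exp (2 * t * z.2) ∂(π : Measure (ℝ × ℝ))) with hB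
  refine tendsto_of_approx (b := fun R n => ∫ z, truncExp u t R z ∂(μ n : Measure (ℝ × ℝ)))
    (c := fun R => ∫ z, truncExp u t R z ∂(π : Measure (ℝ × ℝ))) (B := B)
    (fun R _ => hπ' (truncExp u t R)) (fun R hR => Nat.hyperfilter_le_atTop ?_) (fun R hR => ?_)
  · filter_upwards [i1, i2, hB₁] with n k1 k2 k3
    rw [hμ, integral_map (hZ n).aemeasurable (by fun_prop)]
    have hm : Measurable fun x : Fin n → X => centralSeq s x v := M.measurable_centralSeq v n
    have hYn := hY n
    have j1 : Integrable (fun x : Fin n → X => Complex.exp (u * Y n x * Complex.I +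
        t * centralSeq s x v)) (Measure.pi fun _ => P) := by
      refine k2.mono' (by fun_prop) (Eventually.of_forall fun x => ?_)
      rw [Complex.exp_add, norm_mul, cexp_ofReal_mul_I_norm, one_mul, ← Complex.ofReal_mul,
        Complex.norm_exp_ofReal]
    have j2 : Integrable (fun x : Fin n → X => truncExp u t R (Z n x))
        (Measure.pi fun _ => P) := by
      refine Integrable.of_bound ?_ ‖truncExp u t R‖
        (Eventually.of_forall fun x => (truncExp u t R).norm_coe_le_norm _)
      exact ((truncExp u t R).continuous.measurable.comp (hZ n)).aestronglyMeasurable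
    rw [← integral_sub j1 j2]
    refine (norm_integral_le_of_norm_le (k1.div_const R)
      (Eventually.of_forall fun x => norm_sub_truncExp_le u t hR (Z n x))).trans ?_
    rw [integral_div]
    exact div_le_div_of_nonneg_right (k3.trans (le_max_left _ _)) hR.le
  · have j1 : Integrable (fun z : ℝ × ℝ => Complex.exp (u * z.1 * Complex.I + t * z.2))
        (π : Measure (ℝ × ℝ)) := by
      refine (integrable_exp_snd hmarg t).mono' (by fun_prop) (Eventually.of_forall fun z => ?_)
      rw [Complex.exp_add, norm_mul, cexp_ofReal_mul_I_norm, one_mul, ← Complex.ofReal_mul,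
        Complex.norm_exp_ofReal]
    rw [norm_sub_rev, ← integral_sub j1 ((truncExp u t R).integrable _)]
    refine (norm_integral_le_of_norm_le (hexp2.div_const R)
      (Eventually.of_forall fun z => norm_sub_truncExp_le u t hR z)).trans ?_
    rw [integral_div]
    exact div_le_div_of_nonneg_right (le_max_right _ _) hR.le

/-- **Convolution theorem** along a one-dimensional family of local alternatives. -/
theorem exists_eq_conv (M : LocalModel P r s H) {v : E} {J : ℝ} (hJ0 : 0 < J)
    (hJ : info P s v v = J) (hr : ∀ x, r 0 x = 0) {Y : ∀ n, (Fin n → X) → ℝ}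
    (hY : ∀ n, Measurable (Y n)) {L : Measure ℝ} [IsProbabilityMeasure L]
    (h : ∀ t : ℝ, TendstoLaw (fun n => localLaw P r (t • v) n) (fun n x => Y n x - t) L) :
    ∃ N : Measure ℝ, IsProbabilityMeasure N ∧
      L = Measure.conv (gaussianReal 0 J⁻¹.toNNReal) N := by
  obtain ⟨π, hπ, hmarg, hchar⟩ := M.exists_joint_limit v hr hY h
  rw [hJ] at hmarg hchar
  have hJc : (J : ℂ) ≠ 0 := by exact_mod_cast hJ0.ne'
  have hW : Measurable fun z : ℝ × ℝ => z.1 - J⁻¹ * z.2 := by fun_prop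
  have hN : IsProbabilityMeasure (π.map fun z : ℝ × ℝ => z.1 - J⁻¹ * z.2) :=
    Measure.isProbabilityMeasure_map hW.aemeasurable
  refine ⟨_, hN, Measure.ext_of_charFun (funext fun u => ?_)⟩
  -- Both sides are entire in w and agree at positive reals, which accumulate at 0.
  have hext : ∀ w : ℂ, ∫ z, Complex.exp (u * z.1 * Complex.I + w * z.2) ∂π =
      Complex.exp (u * w * Complex.I + w ^ 2 * J / 2) * charFun L u := by
    have h1 : AnalyticOnNhd ℂ (fun w : ℂ => ∫ z, Complex.exp (u * z.1 * Complex.I + w * z.2) ∂π)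
        Set.univ := Complex.analyticOnNhd_univ_iff_differentiable.2
      (differentiable_integral_cexp hmarg u)
    have h2 : AnalyticOnNhd ℂ (fun w : ℂ =>
        Complex.exp (u * w * Complex.I + w ^ 2 * J / 2) * charFun L u) Set.univ :=
      Complex.analyticOnNhd_univ_iff_differentiable.2 (by fun_prop)
    have h3 := h1.eqOn_of_preconnected_of_frequently_eq h2 isPreconnected_univ
      (Set.mem_univ (0 : ℂ)) ?_
    · exact fun w => h3 (Set.mem_univ w)
    · have h4 : Tendsto (fun t : ℝ => (t : ℂ)) (𝓝[>] 0) (𝓝[≠] 0) := by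
        refine tendsto_nhdsWithin_iff.2 ⟨?_, ?_⟩
        · have : Tendsto (fun τ : ℝ => (τ : ℂ)) (𝓝 0) (𝓝 ((0 : ℝ) : ℂ)) :=
            Complex.continuous_ofReal.tendsto 0
          exact (by simpa using this : Tendsto (fun τ : ℝ => (τ : ℂ)) (𝓝 0) (𝓝 0)).mono_left
            nhdsWithin_le_nhds
        · filter_upwards [self_mem_nhdsWithin] with t (ht : 0 < t)
          simpa using ht.ne'
      exact h4.frequently (Frequently.of_forall fun t => hchar t u)
  -- At w = -iu / J the integrand is exp(iu(y - d / J)), so the left side is the characteristic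
  -- function of the second convolution factor.
  have h5 := hext (-(u * Complex.I / J))
  rw [charFun_conv, charFun_gaussianReal, charFun_apply_real (μ := π.map _),
    integral_map hW.aemeasurable (by fun_prop)]
  have h6 : ∀ z : ℝ × ℝ, Complex.exp (u * ((z.1 - J⁻¹ * z.2 : ℝ) : ℂ) * Complex.I) =
      Complex.exp (u * z.1 * Complex.I + -(u * Complex.I / J) * z.2) := fun z => by
    push_cast
    congr 1
    field_simp
    ring
  simp_rw [h6]
  rw [h5, ← mul_assoc, ← Complex.exp_add, Real.coe_toNNReal _ (inv_nonneg.2 hJ0.le)]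
  have h7 : (u * (0 : ℝ) * Complex.I - ((J⁻¹ : ℝ) : ℂ) * u ^ 2 / 2 +
      (u * -(u * Complex.I / J) * Complex.I + (-(u * Complex.I / J)) ^ 2 * J / 2) : ℂ) = 0 := by
    push_cast
    field_simp
    ring_nf
    simp only [Complex.I_sq]
    ring
  rw [h7, Complex.exp_zero, one_mul]

end LocalModel

end

end StudentT

/-! ### Law of large numbers, one-step estimation and continuity of the information. -/

namespace StudentT

section

variable {X : Type*} [MeasurableSpace X] {E : Type*} [NormedAddCommGroup E] [NormedSpace ℝ E]
  {P : Measure X} [IsProbabilityMeasure P] {r : E → X → ℝ} {s : X → E →L[ℝ] ℝ}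
  {H : X → E →L[ℝ] E →L[ℝ] ℝ}

section MeanAndVariance

/-- The second moment of a centred sum of independent copies. -/
lemma integral_sq_sum_pi {g : X → ℝ} (hg : MemLp g 2 P) (hm : ∫ x, g x ∂P = 0) (n : ℕ) :
    Integrable (fun x : Fin n → X => (∑ i, g (x i)) ^ 2) (Measure.pi fun _ => P) ∧
      ∫ x : Fin n → X, (∑ i, g (x i)) ^ 2 ∂(Measure.pi fun _ => P) = n * ∫ x, g x ^ 2 ∂P := by
  have h1 : MemLp (fun x : Fin n → X => ∑ i, g (x i)) 2 (Measure.pi fun _ => P) :=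
    memLp_finsetSum _ fun i _ => hg.comp_measurePreserving (measurePreserving_eval _ i)
  refine ⟨h1.integrable_sq, ?_⟩
  have h2 := variance_sum_pi (μ := fun _ : Fin n => P) (X := fun _ => g) fun _ => hg
  have h3 : (∑ i : Fin n, fun ω : Fin n → X => g (ω i)) = fun x : Fin n → X => ∑ i, g (x i) := by
    ext x
    simp
  have h4 : ∫ x : Fin n → X, ∑ i, g (x i) ∂(Measure.pi fun _ => P) = 0 := by
    have hi : ∀ i : Fin n, Integrable (fun x : Fin n → X => g (x i)) (Measure.pi fun _ => P) :=
      fun i => (hg.comp_measurePreserving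
        (measurePreserving_eval (fun _ : Fin n => P) i)).integrable (by norm_num)
    rw [integral_finsetSum _ fun i _ => hi i]
    refine Finset.sum_eq_zero fun i _ => ?_
    have h5 := integral_map (μ := Measure.pi fun _ : Fin n => P) (φ := Function.eval i) (f := g)
      (measurable_pi_apply i).aemeasurable
    rw [(measurePreserving_eval (fun _ : Fin n => P) i).map_eq] at h5
    exact (h5 hg.aestronglyMeasurable).symm.trans hm
  rw [h3, variance_of_integral_eq_zero h1.aestronglyMeasurable.aemeasurable h4] at h2
  simp only [Finset.sum_const, Finset.card_univ, Fintype.card_fin, nsmul_eq_mul] at h2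
  rw [variance_of_integral_eq_zero hg.aestronglyMeasurable.aemeasurable hm] at h2
  exact h2

/-- The weak law of large numbers. -/
lemma tendsto_mean_whp {g : X → ℝ} (hg : MemLp g 2 P) :
    Tendsto (fun z : Σ n, Fin n → X => (z.1 : ℝ)⁻¹ * ∑ i, g (z.2 i))
      (whp fun n => Measure.pi fun _ : Fin n => P) (𝓝 (∫ x, g x ∂P)) := by
  set m := ∫ x, g x ∂P with hm
  have hg0 : MemLp (fun x => g x - m) 2 P := hg.sub (memLp_const m)
  have hm0 : ∫ x, (g x - m) ∂P = 0 := by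
    rw [integral_sub (hg.integrable (by norm_num)) (integrable_const _)]
    simp [hm]
  have h1 : Tendsto (fun z : Σ n, Fin n → X => (z.1 : ℝ)⁻¹ * ∑ i, (g (z.2 i) - m))
      (whp fun n => Measure.pi fun _ : Fin n => P) (𝓝 0) := by
    refine tendsto_whp_zero_of_sq (b := fun n => (n : ℝ)⁻¹ * ∫ x, (g x - m) ^ 2 ∂P) ?_ ?_ ?_
    · refine Eventually.of_forall fun n => ?_
      simp_rw [mul_pow]
      exact (integral_sq_sum_pi hg0 hm0 n).1.const_mul _
    · filter_upwards [eventually_gt_atTop 0] with n hn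
      simp_rw [mul_pow]
      rw [integral_const_mul, (integral_sq_sum_pi hg0 hm0 n).2]
      refine le_of_eq ?_
      have : (n : ℝ) ≠ 0 := by exact_mod_cast hn.ne'
      field_simp
    · have := tendsto_inv_atTop_zero.comp (tendsto_natCast_atTop_atTop (R := ℝ))
      simpa using this.mul_const (∫ x, (g x - m) ^ 2 ∂P)
  have h2 := h1.add_const m
  rw [zero_add] at h2
  refine h2.congr' ?_
  filter_upwards [tendsto_fst_whp.eventually (eventually_gt_atTop 0)] with z hz
  have : (z.1 : ℝ) ≠ 0 := by exact_mod_cast hz.ne'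
  rw [Finset.sum_sub_distrib]
  simp only [Finset.sum_const, Finset.card_univ, Fintype.card_fin, nsmul_eq_mul]
  field_simp
  ring

end MeanAndVariance

namespace LocalModel

/-- The second moment equals the information in direction v for every n > 0, and for n = 0 the
sequence is 0. -/
lemma boundedInProb_centralSeq (M : LocalModel P r s H) (v : E) :
    BoundedInProb (fun n => Measure.pi fun _ : Fin n => P)
      fun z => centralSeq s z.2 v := by
  have h0 := fun n : ℕ => integral_sq_sum_pi (M.memLp_score v) (M.integral_score v) n
  refine boundedInProb_of_sq (B := ∫ x, s x v ^ 2 ∂P) (fun n => ?_) fun n => ?_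
  · simp_rw [centralSeq_apply, mul_pow]
    exact (h0 n).1.const_mul _
  · simp_rw [centralSeq_apply, mul_pow]
    rw [integral_const_mul, (h0 n).2, inv_pow, Real.sq_sqrt (Nat.cast_nonneg n), ← mul_assoc]
    refine mul_le_of_le_one_left (integral_nonneg fun x => sq_nonneg _) ?_
    rcases Nat.eq_zero_or_pos n with h | h
    · simp [h]
    · rw [inv_mul_cancel₀ (by exact_mod_cast h.ne')]

omit [IsProbabilityMeasure P] in
lemma info_sum_smul (M : LocalModel P r s H) {ι : Type*} (t : Finset ι) (c : ι → ℝ) (b : ι → E)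
    (v : E) : info P s (∑ j ∈ t, c j • b j) v = ∑ j ∈ t, c j * info P s (b j) v := by
  simp only [info, map_sum, map_smul, smul_eq_mul, Finset.sum_mul]
  rw [integral_finsetSum _ fun j _ => ?_]
  · refine Finset.sum_congr rfl fun j _ => ?_
    rw [← integral_const_mul]
    congr 1
    ext x
    ring
  · refine ((M.integrable_score_mul (b j) v).const_mul (c j)).congr
      (Eventually.of_forall fun x => ?_)
    simp only
    ring

lemma memLp_hess (M : LocalModel P r s H) (v w : E) : MemLp (fun x => H x v w) 2 P := by
  obtain ⟨C, hC⟩ := M.hess_bdd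
  refine MemLp.of_bound (M.measurable_hess v w).aestronglyMeasurable (C * ‖v‖ * ‖w‖)
    (Eventually.of_forall fun x => ?_)
  exact ((H x v).le_opNorm w).trans (mul_le_mul_of_nonneg_right
    (((H x).le_opNorm v).trans (mul_le_mul_of_nonneg_right (hC x) (norm_nonneg v)))
    (norm_nonneg w))

variable [FiniteDimensional ℝ E]

/-- Asymptotic linearity of the central sequence, in a random direction and at a random parameter
that is root-`n` consistent. -/
lemma tendsto_centralSeq_sub (M : LocalModel P r s H) {S : E → X → E →L[ℝ] ℝ}
    (hS : ∀ ε : ℝ, 0 < ε → ∀ᶠ h in 𝓝 (0 : E), ∀ x, ‖S h x - s x - H x h‖ ≤ ε * ‖h‖)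
    {d w : (Σ n, Fin n → X) → E} {v : E}
    (hd : BoundedInProb (fun n => Measure.pi fun _ : Fin n => P)
      fun z => √(z.1 : ℝ) * ‖d z‖)
    (hw : Tendsto w (whp fun n => Measure.pi fun _ : Fin n => P) (𝓝 v)) :
    Tendsto (fun z => centralSeq (S (d z)) z.2 (w z) - centralSeq s z.2 v +
      info P s (√(z.1 : ℝ) • d z) v) (whp fun n => Measure.pi fun _ : Fin n => P) (𝓝 0) := by
  set l := whp fun n => Measure.pi fun _ : Fin n => P with hl
  -- In a basis a random direction becomes finitely many random coefficients, multiplying sums in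
  -- fixed directions to which the moment bounds apply.
  let b := Module.finBasis ℝ E
  have hcoord : ∀ j, ∃ C : ℝ, 0 ≤ C ∧ ∀ e : E, |b.repr e j| ≤ C * ‖e‖ := fun j => by
    let f : E →L[ℝ] ℝ := LinearMap.toContinuousLinearMap (b.coord j)
    exact ⟨‖f‖, norm_nonneg _, fun e => f.le_opNorm e⟩
  choose C hC0 hC using hcoord
  have hd0 : Tendsto d l (𝓝 0) := by
    rw [tendsto_zero_iff_norm_tendsto_zero]
    exact hd.tendsto_div_sqrt
  have hwv : Tendsto (fun z => w z - v) l (𝓝 0) := by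
    simpa using hw.sub_const v
  have hnpos : ∀ᶠ z : Σ n, Fin n → X in l, 0 < z.1 :=
    tendsto_fst_whp.eventually (eventually_gt_atTop 0)
  -- the change of direction
  have t1 : Tendsto (fun z : Σ n, Fin n → X => centralSeq s z.2 (w z - v)) l (𝓝 0) := by
    have e : ∀ z : Σ n, Fin n → X, centralSeq s z.2 (w z - v) =
        ∑ j, centralSeq s z.2 (b j) * b.repr (w z - v) j := fun z => by
      conv_lhs => rw [← b.sum_repr (w z - v)]
      simp only [map_sum, map_smul, smul_eq_mul]
      exact Finset.sum_congr rfl fun j _ => mul_comm _ _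
    simp_rw [e]
    rw [show (0 : ℝ) = ∑ _j : Fin (Module.finrank ℝ E), (0 : ℝ) by simp]
    refine tendsto_finsetSum _ fun j _ => ?_
    refine (M.boundedInProb_centralSeq (b j)).mul_tendsto_zero ?_
    refine squeeze_zero_norm (fun z => hC j (w z - v)) ?_
    simpa using hwv.norm.const_mul (C j)
  -- the Hessian in the limiting direction
  have t2 : Tendsto (fun z : Σ n, Fin n → X =>
      (z.1 : ℝ)⁻¹ * ∑ i, H (z.2 i) (√(z.1 : ℝ) • d z) v + info P s (√(z.1 : ℝ) • d z) v) l
      (𝓝 0) := by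
    have e : ∀ z : Σ n, Fin n → X,
        (z.1 : ℝ)⁻¹ * ∑ i, H (z.2 i) (√(z.1 : ℝ) • d z) v + info P s (√(z.1 : ℝ) • d z) v =
        ∑ j, b.repr (√(z.1 : ℝ) • d z) j *
          ((z.1 : ℝ)⁻¹ * ∑ i, H (z.2 i) (b j) v + info P s (b j) v) := fun z => by
      set c := b.repr (√(z.1 : ℝ) • d z) with hc
      have h1 : (√(z.1 : ℝ) • d z) = ∑ j, c j • b j := (b.sum_repr _).symm
      rw [h1, M.info_sum_smul]
      simp only [map_sum, map_smul, sum_apply, smul_apply, smul_eq_mul, mul_add,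
        Finset.sum_add_distrib]
      congr 1
      rw [Finset.sum_comm, Finset.mul_sum]
      refine Finset.sum_congr rfl fun j _ => ?_
      rw [← Finset.mul_sum]
      ring
    simp_rw [e]
    rw [show (0 : ℝ) = ∑ _j : Fin (Module.finrank ℝ E), (0 : ℝ) by simp]
    refine tendsto_finsetSum _ fun j _ => ?_
    refine BoundedInProb.mul_tendsto_zero ((hd.const_mul (C j)).mono fun z => ?_) ?_
    · refine (hC j _).trans (le_of_eq ?_)
      rw [norm_smul, Real.norm_of_nonneg (Real.sqrt_nonneg _), abs_of_nonneg]
      exact mul_nonneg (hC0 j) (by positivity)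
    · have := (tendsto_mean_whp (M.memLp_hess (b j) v)).add_const (info P s (b j) v)
      rwa [M.integral_hess, neg_add_cancel] at this
  -- the Hessian in the change of direction
  obtain ⟨K, hK⟩ := M.hess_bdd
  have t3 : Tendsto (fun z : Σ n, Fin n → X =>
      (z.1 : ℝ)⁻¹ * ∑ i, H (z.2 i) (√(z.1 : ℝ) • d z) (w z - v)) l (𝓝 0) := by
    have hb : Tendsto (fun z : Σ n, Fin n → X => |K| * ((√(z.1 : ℝ) * ‖d z‖) * ‖w z - v‖)) l
        (𝓝 0) := by
      have := (hd.mul_tendsto_zero (by simpa using hwv.norm)).const_mul |K|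
      simpa using this
    refine squeeze_zero_norm' ?_ hb
    filter_upwards [hnpos] with z hz
    have hz' : (0 : ℝ) < z.1 := by exact_mod_cast hz
    rw [norm_mul, norm_inv, Real.norm_of_nonneg hz'.le, inv_mul_le_iff₀ hz']
    refine (norm_sum_le _ _).trans ?_
    calc ∑ i, ‖H (z.2 i) (√(z.1 : ℝ) • d z) (w z - v)‖
        ≤ ∑ _i : Fin z.1, |K| * ((√(z.1 : ℝ) * ‖d z‖) * ‖w z - v‖) := by
          refine Finset.sum_le_sum fun i _ => ?_
          refine ((H (z.2 i) _).le_opNorm _).trans ?_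
          rw [← mul_assoc]
          refine mul_le_mul_of_nonneg_right (((H (z.2 i)).le_opNorm _).trans ?_) (norm_nonneg _)
          rw [norm_smul, Real.norm_of_nonneg (Real.sqrt_nonneg _)]
          exact mul_le_mul_of_nonneg_right ((hK _).trans (le_abs_self K)) (by positivity)
      _ = _ := by
          rw [Finset.sum_const, Finset.card_univ, Fintype.card_fin, nsmul_eq_mul]
  -- the remainder of the expansion of the score
  have t4 : Tendsto (fun z : Σ n, Fin n → X => (√(z.1 : ℝ))⁻¹ *
      ∑ i, (S (d z) (z.2 i) - s (z.2 i) - H (z.2 i) (d z)) (w z)) l (𝓝 0) := by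
    refine BoundedInProb.tendsto_zero_of_le (W := fun z => (‖v‖ + 1) * (√(z.1 : ℝ) * ‖d z‖))
      (hd.const_mul _) fun ε hε => ?_
    filter_upwards [hnpos, hd0.eventually (hS ε hε),
      hw.norm.eventually (eventually_le_nhds (lt_add_one ‖v‖))] with z hz h1 h2
    have hz' : (0 : ℝ) < z.1 := by exact_mod_cast hz
    have hs : 0 < √(z.1 : ℝ) := Real.sqrt_pos.2 hz'
    rw [abs_mul, abs_of_pos (inv_pos.2 hs), inv_mul_le_iff₀ hs,
      abs_of_nonneg (by positivity : 0 ≤ (‖v‖ + 1) * (√(z.1 : ℝ) * ‖d z‖))]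
    calc |∑ i, (S (d z) (z.2 i) - s (z.2 i) - H (z.2 i) (d z)) (w z)|
        ≤ ∑ i, |(S (d z) (z.2 i) - s (z.2 i) - H (z.2 i) (d z)) (w z)| :=
          Finset.abs_sum_le_sum_abs _ _
      _ ≤ ∑ _i : Fin z.1, (ε * ‖d z‖) * (‖v‖ + 1) := by
          refine Finset.sum_le_sum fun i _ => ?_
          refine ((S (d z) (z.2 i) - s (z.2 i) - H (z.2 i) (d z)).le_opNorm (w z)).trans ?_
          exact mul_le_mul (h1 _) h2 (norm_nonneg _) (by positivity)
      _ = √(z.1 : ℝ) * √(z.1 : ℝ) * ((ε * ‖d z‖) * (‖v‖ + 1)) := by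
          rw [Finset.sum_const, Finset.card_univ, Fintype.card_fin, nsmul_eq_mul,
            Real.mul_self_sqrt hz'.le]
      _ = _ := by ring
  -- The underlying identity is S_d(w) = s(v) + s(w - v) + H(d, v) + H(d, w - v) + (S_d - s - H
  -- d)(w), summed over the sample. The mean of H(d, v) is what the information term compensates.
  have t5 := ((t1.add t2).add t3).add t4
  simp only [add_zero] at t5
  refine t5.congr' ?_
  filter_upwards [hnpos] with z hz
  have hz' : (0 : ℝ) < z.1 := by exact_mod_cast hz
  have hs : 0 < √(z.1 : ℝ) := Real.sqrt_pos.2 hz'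
  have e1 : (z.1 : ℝ)⁻¹ = (√(z.1 : ℝ))⁻¹ * (√(z.1 : ℝ))⁻¹ := by
    rw [← mul_inv, Real.mul_self_sqrt hz'.le]
  rw [centralSeq_apply, centralSeq_apply, centralSeq_apply, e1]
  simp only [sub_apply, map_sub, map_smul, smul_apply, smul_eq_mul, Finset.sum_sub_distrib,
    ← Finset.mul_sum]
  field_simp
  ring

/-- Asymptotic linearity of one-step estimators. -/
lemma tendsto_oneStep_sub (M : LocalModel P r s H) {S : E → X → E →L[ℝ] ℝ}
    (hS : ∀ ε : ℝ, 0 < ε → ∀ᶠ h in 𝓝 (0 : E), ∀ x, ‖S h x - s x - H x h‖ ≤ ε * ‖h‖)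
    {d w : (Σ n, Fin n → X) → E} {j : (Σ n, Fin n → X) → ℝ} {v : E} {J : ℝ} (hJ0 : 0 < J)
    {κ : E →L[ℝ] ℝ} (hκ : ∀ h, info P s v h = J * κ h)
    (hd : BoundedInProb (fun n => Measure.pi fun _ : Fin n => P) fun z => √(z.1 : ℝ) * ‖d z‖)
    (hw : Tendsto w (whp fun n => Measure.pi fun _ : Fin n => P) (𝓝 v))
    (hj : Tendsto j (whp fun n => Measure.pi fun _ : Fin n => P) (𝓝 J)) :
    Tendsto (fun z => (√(z.1 : ℝ) * κ (d z) + (j z)⁻¹ * centralSeq (S (d z)) z.2 (w z)) -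
      J⁻¹ * centralSeq s z.2 v) (whp fun n => Measure.pi fun _ : Fin n => P) (𝓝 0) := by
  have h1 := M.tendsto_centralSeq_sub hS hd hw
  have hj' := hj.inv₀ hJ0.ne'
  have h2 : Tendsto (fun z => (j z)⁻¹ - J⁻¹) (whp fun n => Measure.pi fun _ : Fin n => P)
      (𝓝 0) := by simpa using hj'.sub_const J⁻¹
  have h3 : Tendsto (fun z => 1 - (j z)⁻¹ * J) (whp fun n => Measure.pi fun _ : Fin n => P)
      (𝓝 0) := by
    have := (hj'.mul_const J).const_sub 1
    rwa [inv_mul_cancel₀ hJ0.ne', sub_self] at this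
  have hκb : BoundedInProb (fun n => Measure.pi fun _ : Fin n => P)
      fun z : Σ n, Fin n → X => √(z.1 : ℝ) * κ (d z) := by
    refine (hd.const_mul ‖κ‖).mono fun z => ?_
    rw [abs_mul, abs_mul, abs_of_nonneg (norm_nonneg κ), abs_of_nonneg (Real.sqrt_nonneg _),
      abs_of_nonneg (by positivity : 0 ≤ √(z.1 : ℝ) * ‖d z‖), mul_left_comm]
    exact mul_le_mul_of_nonneg_left (κ.le_opNorm (d z)) (Real.sqrt_nonneg _)
  -- Since I(√n d, v) = J √n κ(d), the preliminary error √n κ(d) survives only with the factor 1 - J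
  -- / j. The other errors come from replacing j by J and from the linearization.
  have h4 := ((hκb.mul_tendsto_zero h3).add
    ((M.boundedInProb_centralSeq v).mul_tendsto_zero h2)).add (hj'.mul h1)
  simp only [add_zero, mul_zero] at h4
  refine h4.congr fun z => ?_
  rw [info_comm, hκ, map_smul, smul_eq_mul]
  ring

/-- Continuity of the Fisher information. -/
lemma tendsto_info (M : LocalModel P r s H) {S : E → X → E →L[ℝ] ℝ}
    (hS : ∀ ε : ℝ, 0 < ε → ∀ᶠ h in 𝓝 (0 : E), ∀ x, ‖S h x - s x - H x h‖ ≤ ε * ‖h‖)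
    (hSm : ∀ᶠ h in 𝓝 (0 : E), ∀ v, Measurable fun x => S h x v) (v w : E) :
    Tendsto (fun h => info (P.withDensity fun x => ENNReal.ofReal (Real.exp (r h x))) (S h) v w)
      (𝓝 0) (𝓝 (info P s v w)) := by
  let b := Module.finBasis ℝ E
  have hcoord : ∀ j, ∃ C : ℝ, 0 ≤ C ∧ ∀ e : E, |b.repr e j| ≤ C * ‖e‖ := fun j => by
    let f : E →L[ℝ] ℝ := LinearMap.toContinuousLinearMap (b.coord j)
    exact ⟨‖f‖, norm_nonneg _, fun e => f.le_opNorm e⟩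
  choose C hC0 hC using hcoord
  set D : ℝ := ∑ j, C j with hD
  have hD0 : 0 ≤ D := Finset.sum_nonneg fun j _ => hC0 j
  obtain ⟨ρ, hρ, hInt⟩ := M.exists_integrable_exp_sum_abs Finset.univ b
  set q : X → ℝ := fun x => ∑ j, |s x (b j)| with hq
  have hq0 : ∀ x, 0 ≤ q x := fun x => Finset.sum_nonneg fun j _ => abs_nonneg _
  have hqm : Measurable q := Finset.measurable_sum _ fun j _ => (M.measurable_score (b j)).abs
  have hsq : ∀ x e, |s x e| ≤ D * ‖e‖ * q x := fun x e => by
    have h1 : s x e = ∑ j, b.repr e j * s x (b j) := by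
      conv_lhs => rw [← b.sum_repr e]
      simp only [map_sum, map_smul, smul_eq_mul]
    rw [h1]
    refine (Finset.abs_sum_le_sum_abs _ _).trans ?_
    calc ∑ j, |b.repr e j * s x (b j)| ≤ ∑ j, (C j * ‖e‖) * q x := by
          refine Finset.sum_le_sum fun j _ => ?_
          rw [abs_mul]
          exact mul_le_mul (hC j e) (Finset.single_le_sum (f := fun j => |s x (b j)|)
            (fun j _ => abs_nonneg _) (Finset.mem_univ j)) (abs_nonneg _)
            (mul_nonneg (hC0 j) (norm_nonneg _))
      _ = _ := by rw [← Finset.sum_mul, ← Finset.sum_mul]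
  obtain ⟨K, hK⟩ := M.hess_bdd
  obtain ⟨R, hR0, hR⟩ := M.exists_remainder_bound
  have hSb : ∀ᶠ h in 𝓝 (0 : E), ∀ x, ‖S h x - s x‖ ≤ (|K| + 1) * ‖h‖ := by
    filter_upwards [hS 1 one_pos] with h hh x
    have h1 : S h x - s x = (S h x - s x - H x h) + H x h := by abel
    rw [h1]
    refine (norm_add_le _ _).trans ?_
    have h2 := ((H x).le_opNorm h).trans
      (mul_le_mul_of_nonneg_right ((hK x).trans (le_abs_self K)) (norm_nonneg h))
    linarith [hh x]
  have hn0 : Tendsto (fun h : E => ‖h‖) (𝓝 0) (𝓝 0) := by simpa using tendsto_norm_zero (E := E)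
  have hlim : ∀ x e, Tendsto (fun h => S h x e) (𝓝 0) (𝓝 (s x e)) := fun x e => by
    rw [tendsto_iff_norm_sub_tendsto_zero]
    have h0 : Tendsto (fun h : E => (|K| + 1) * ‖h‖ * ‖e‖) (𝓝 0) (𝓝 0) := by
      simpa using (hn0.const_mul (|K| + 1)).mul_const ‖e‖
    refine squeeze_zero_norm' ?_ h0
    filter_upwards [hSb] with h hh
    rw [norm_norm, ← sub_apply]
    exact ((S h x - s x).le_opNorm e).trans (mul_le_mul_of_nonneg_right (hh x) (norm_nonneg e))
  have hrlim : ∀ x, Tendsto (fun h => r h x) (𝓝 0) (𝓝 0) := fun x => by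
    have h0 : Tendsto (fun h : E => R * ‖h‖ ^ 2 + ‖s x h‖) (𝓝 0) (𝓝 0) := by
      have h1 : Tendsto (fun h : E => s x h) (𝓝 0) (𝓝 0) := by
        simpa using (s x).continuous.tendsto 0
      simpa using ((hn0.pow 2).const_mul R).add h1.norm
    refine squeeze_zero_norm' ?_ h0
    filter_upwards [hR] with h hh
    have h1 : r h x = (r h x - s x h) + s x h := by ring
    rw [h1]
    exact (norm_add_le _ _).trans (add_le_add_left (hh x) _)
  -- A and B are chosen so that A q + B bounds both scores and ρ q / 2 + B bounds the log-likelihood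
  -- ratio, for all small h; dominated convergence then applies after the change of measure to P.
  set A : ℝ := D * (‖v‖ + ‖w‖) with hA
  set B : ℝ := (|K| + 1) * (‖v‖ + ‖w‖) + R with hB
  have hA0 : 0 ≤ A := by positivity
  have hB0 : 0 ≤ B := by positivity
  have hbi := integrable_sq_mul_exp hqm hq0 hρ hInt A B
  have key : Tendsto (fun h => ∫ x, Real.exp (r h x) * (S h x v * S h x w) ∂P) (𝓝 0)
      (𝓝 (∫ x, Real.exp 0 * (s x v * s x w) ∂P)) := by
    refine tendsto_integral_filter_of_dominated_convergence _ ?_ ?_ hbi ?_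
    · filter_upwards [M.measurable_ratio, hSm] with h h1 h2
      exact ((Real.measurable_exp.comp h1).mul ((h2 v).mul (h2 w))).aestronglyMeasurable
    · have hsm : ∀ᶠ h in 𝓝 (0 : E), D * ‖h‖ ≤ ρ / 2 := by
        have h1 : Tendsto (fun h : E => D * ‖h‖) (𝓝 0) (𝓝 0) := by simpa using hn0.const_mul D
        exact h1.eventually (eventually_le_nhds (by positivity))
      filter_upwards [hsm, hSb, hR, hn0.eventually (eventually_le_nhds one_pos)]
        with h h1 h2 h3 h4
      refine Eventually.of_forall fun x => ?_
      have hSe : ∀ e, ‖e‖ ≤ ‖v‖ + ‖w‖ → |S h x e| ≤ A * q x + B := fun e he => by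
        have k1 : S h x e = s x e + (S h x - s x) e := by rw [sub_apply]; ring
        rw [k1]
        refine (abs_add_le _ _).trans ?_
        have k2 := ((S h x - s x).le_opNorm e).trans
          (mul_le_mul_of_nonneg_right (h2 x) (norm_nonneg e))
        rw [Real.norm_eq_abs] at k2
        have k3 : (|K| + 1) * ‖h‖ * ‖e‖ ≤ (|K| + 1) * 1 * (‖v‖ + ‖w‖) := by gcongr
        have k4 : D * ‖e‖ * q x ≤ A * q x := by
          have := hq0 x
          rw [hA]
          gcongr
        linarith [hsq x e]
      have hr : r h x ≤ ρ / 2 * q x + B := by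
        have k1 := (abs_le.1 (h3 x)).2
        have k2 := (le_abs_self _).trans (hsq x h)
        have k3 := mul_le_mul_of_nonneg_right h1 (hq0 x)
        have k4 : R * ‖h‖ ^ 2 ≤ R := mul_le_of_le_one_right hR0 (pow_le_one₀ (norm_nonneg _) h4)
        have k5 : 0 ≤ (|K| + 1) * (‖v‖ + ‖w‖) := by positivity
        linarith
      rw [norm_mul, norm_mul, Real.norm_eq_abs, Real.abs_exp, Real.norm_eq_abs, Real.norm_eq_abs,
        mul_comm, sq]
      have k6 := hSe v (by linarith [norm_nonneg w])
      have k7 := hSe w (by linarith [norm_nonneg v])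
      gcongr
    · refine Eventually.of_forall fun x => ?_
      exact ((Real.continuous_exp.tendsto 0).comp (hrlim x)).mul ((hlim x v).mul (hlim x w))
  simp only [Real.exp_zero, one_mul] at key
  refine key.congr' ?_
  filter_upwards [M.measurable_ratio] with h h1
  rw [info, integral_withDensity_eq_integral_toReal_smul (by fun_prop)
    (Eventually.of_forall fun x => ENNReal.ofReal_lt_top)]
  refine integral_congr_ae (Eventually.of_forall fun x => ?_)
  simp only
  rw [ENNReal.toReal_ofReal (Real.exp_pos _).le, smul_eq_mul]

end LocalModel

end

end StudentT

/-! ### Taylor expansions that are uniform over a compact set. -/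

namespace StudentT

section

variable {E G : Type*} [NormedAddCommGroup E] [NormedSpace ℝ E] [NormedAddCommGroup G]
  [NormedSpace ℝ G]

/-- The partial derivative in the first variable. -/
def partialD (F : E × G → ℝ) (p : E × G) : E →L[ℝ] ℝ :=
  (fderiv ℝ F p).comp (ContinuousLinearMap.inl ℝ E G)

/-- The second partial derivative in the first variable. -/
def partialD₂ (F : E × G → ℝ) (p : E × G) : E →L[ℝ] E →L[ℝ] ℝ :=
  (fderiv ℝ (partialD F) p).comp (ContinuousLinearMap.inl ℝ E G)

section PartialDerivatives

variable {F : E × G → ℝ} {θ : E} {u : G}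

lemma hasFDerivAt_prodMk_right (θ : E) (u : G) :
    HasFDerivAt (fun η : E => (η, u)) (ContinuousLinearMap.inl ℝ E G) θ :=
  hasFDerivAt_prodMk_left θ u

lemma hasFDerivAt_partialD (h : ContDiffAt ℝ 2 F (θ, u)) :
    HasFDerivAt (fun η => F (η, u)) (partialD F (θ, u)) θ := by
  have h1 : HasFDerivAt F (fderiv ℝ F (θ, u)) (θ, u) :=
    (h.differentiableAt (by norm_num)).hasFDerivAt
  exact h1.comp θ (hasFDerivAt_prodMk_right θ u)

lemma contDiffAt_partialD (h : ContDiffAt ℝ 2 F (θ, u)) : ContDiffAt ℝ 1 (partialD F) (θ, u) := by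
  have h1 : ContDiffAt ℝ 1 (fderiv ℝ F) (θ, u) := h.fderiv_right (by norm_num)
  exact h1.clm_comp contDiffAt_const

lemma hasFDerivAt_partialD₂ (h : ContDiffAt ℝ 2 F (θ, u)) :
    HasFDerivAt (fun η => partialD F (η, u)) (partialD₂ F (θ, u)) θ := by
  have h1 : HasFDerivAt (partialD F) (fderiv ℝ (partialD F) (θ, u)) (θ, u) :=
    ((contDiffAt_partialD h).differentiableAt (by norm_num)).hasFDerivAt
  exact h1.comp θ (hasFDerivAt_prodMk_right θ u)

lemma continuousAt_partialD₂ (h : ContDiffAt ℝ 2 F (θ, u)) :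
    ContinuousAt (partialD₂ F) (θ, u) := by
  have h1 : ContDiffAt ℝ 0 (fderiv ℝ (partialD F)) (θ, u) :=
    (contDiffAt_partialD h).fderiv_right (by norm_num)
  exact (h1.clm_comp contDiffAt_const).continuousAt

lemma eventually_contDiffAt_left (h : ContDiffAt ℝ 2 F (θ, u)) :
    ∀ᶠ η in 𝓝 θ, ContDiffAt ℝ 2 F (η, u) := by
  have h1 : ContinuousAt (fun η : E => (η, u)) θ := by fun_prop
  exact h1.eventually (h.eventually (by simp))

lemma partialD₂_symm (h : ContDiffAt ℝ 2 F (θ, u)) (v w : E) :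
    partialD₂ F (θ, u) v w = partialD₂ F (θ, u) w v :=
  second_derivative_symmetric_of_eventually (f := fun η => F (η, u))
    ((eventually_contDiffAt_left h).mono fun _ hη => hasFDerivAt_partialD hη)
    (hasFDerivAt_partialD₂ h) v w

end PartialDerivatives

section Uniform

variable {F : E × G → ℝ} {Θ : Set E} {K : Set G} {θ : E}

-- Continuity at each (θ, u) gives product neighbourhoods, and compactness of `K` makes the
-- neighbourhood of θ independent of u.
set_option maxSynthPendingDepth 5 in
lemma eventually_norm_partialD₂_sub_le (hK : IsCompact K)
    (hF : ∀ u ∈ K, ContDiffAt ℝ 2 F (θ, u)) {ε : ℝ} (hε : 0 < ε) :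
    ∀ᶠ η in 𝓝 θ, ∀ u ∈ K, ‖partialD₂ F (η, u) - partialD₂ F (θ, u)‖ ≤ ε := by
  refine hK.eventually_forall_of_forall_eventually fun u hu => ?_
  have h1 := continuousAt_partialD₂ (hF u hu)
  have h2 : ContinuousAt (fun z : E × G => partialD₂ F (θ, z.2)) (θ, u) := by
    have hc : ContinuousAt (fun z : E × G => (θ, z.2)) (θ, u) := by fun_prop
    exact ContinuousAt.comp_of_eq h1 hc rfl
  have h3 : Tendsto (fun z : E × G => ‖partialD₂ F z - partialD₂ F (θ, z.2)‖) (𝓝 (θ, u))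
      (𝓝 0) := by
    have := (h1.sub h2).norm
    rw [ContinuousAt] at this
    simpa using this
  exact h3.eventually (eventually_le_nhds hε)

/-- First order expansion of the partial derivative, uniform in a compact set. -/
lemma eventually_norm_partialD_sub_le (hΘ : IsOpen Θ) (hK : IsCompact K)
    (hF : ∀ η ∈ Θ, ∀ u ∈ K, ContDiffAt ℝ 2 F (η, u)) (hθ : θ ∈ Θ) {ε : ℝ} (hε : 0 < ε) :
    ∀ᶠ h in 𝓝 (0 : E), ∀ u ∈ K,
      ‖partialD F (θ + h, u) - partialD F (θ, u) - partialD₂ F (θ, u) h‖ ≤ ε * ‖h‖ := by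
  obtain ⟨δ, hδ, hball⟩ := Metric.eventually_nhds_iff_ball.1
    ((hΘ.eventually_mem hθ).and (eventually_norm_partialD₂_sub_le hK (hF θ hθ) hε))
  filter_upwards [Metric.ball_mem_nhds (0 : E) hδ] with h hh u hu
  have h1 := (convex_ball θ δ).norm_image_sub_le_of_norm_hasFDerivWithin_le'
    (f := fun η => partialD F (η, u)) (f' := fun η => partialD₂ F (η, u))
    (φ := partialD₂ F (θ, u)) (C := ε) (x := θ) (y := θ + h)
    (fun η hη => (hasFDerivAt_partialD₂ (hF η (hball η hη).1 u hu)).hasFDerivWithinAt)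
    (fun η hη => (hball η hη).2 u hu) (Metric.mem_ball_self hδ) (by simpa using hh)
  simpa using h1

/-- Second order expansion, uniform in a compact set. -/
lemma eventually_abs_sub_taylor_le (hΘ : IsOpen Θ) (hK : IsCompact K)
    (hF : ∀ η ∈ Θ, ∀ u ∈ K, ContDiffAt ℝ 2 F (η, u)) (hθ : θ ∈ Θ) {ε : ℝ} (hε : 0 < ε) :
    ∀ᶠ h in 𝓝 (0 : E), ∀ u ∈ K,
      |F (θ + h, u) - F (θ, u) - partialD F (θ, u) h - partialD₂ F (θ, u) h h / 2| ≤
        ε * ‖h‖ ^ 2 := by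
  have h0 : Tendsto (fun h : E => θ + h) (𝓝 0) (𝓝 θ) := by
    simpa using (tendsto_const_nhds (x := θ)).add (tendsto_id (x := 𝓝 (0 : E)))
  obtain ⟨δ, hδ, hball⟩ := Metric.eventually_nhds_iff_ball.1
    ((h0.eventually (hΘ.eventually_mem hθ)).and
      (eventually_norm_partialD_sub_le hΘ hK hF hθ hε))
  filter_upwards [Metric.ball_mem_nhds (0 : E) hδ] with h hh u hu
  rw [mem_ball_zero_iff] at hh
  -- By symmetry of the second derivative, half the quadratic form has derivative `partialD₂ F (θ,
  -- u) e`. The difference then has derivative within ε ‖h‖ of `partialD F (θ, u)` on the ball of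
  -- radius ‖h‖, and the mean value inequality gives ε ‖h‖².
  have hd : ∀ e ∈ Metric.closedBall (0 : E) ‖h‖, HasFDerivWithinAt
      (fun e => F (θ + e, u) - partialD₂ F (θ, u) e e / 2)
      (partialD F (θ + e, u) - partialD₂ F (θ, u) e) (Metric.closedBall (0 : E) ‖h‖) e := by
    intro e he
    rw [mem_closedBall_zero_iff] at he
    have he' : e ∈ Metric.ball (0 : E) δ := by
      rw [mem_ball_zero_iff]
      exact he.trans_lt hh
    have k1 : HasFDerivAt (fun e => F (θ + e, u)) (partialD F (θ + e, u)) e := by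
      have := hasFDerivAt_partialD (hF _ (hball e he').1 u hu)
      have k2 : HasFDerivAt (fun e => θ + e) (ContinuousLinearMap.id ℝ E) e :=
        (hasFDerivAt_id e).const_add θ
      exact this.comp e k2
    have k3 : HasFDerivAt (fun e => partialD₂ F (θ, u) e e)
        ((2 : ℝ) • partialD₂ F (θ, u) e) e := by
      have k4 := ((partialD₂ F (θ, u)).hasFDerivAt (x := e)).clm_apply (hasFDerivAt_id e)
      refine k4.congr_fderiv ?_
      ext w
      have := partialD₂_symm (hF θ hθ u hu) w e
      simp [this, two_mul]
    have k5 := (k1.sub (k3.const_smul (2⁻¹ : ℝ))).hasFDerivWithinAt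
      (s := Metric.closedBall (0 : E) ‖h‖)
    refine (k5.congr_fderiv ?_).congr (fun y _ => ?_) ?_
    · rw [smul_smul]
      norm_num
    · simp only [Pi.sub_apply, Pi.smul_apply, smul_eq_mul]
      ring
    · simp only [Pi.sub_apply, Pi.smul_apply, smul_eq_mul]
      ring
  have h1 := (convex_closedBall (0 : E) ‖h‖).norm_image_sub_le_of_norm_hasFDerivWithin_le'
    (φ := partialD F (θ, u)) (C := ε * ‖h‖) (x := 0) (y := h) hd (fun e he => by
      rw [mem_closedBall_zero_iff] at he
      have he' : e ∈ Metric.ball (0 : E) δ := by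
        rw [mem_ball_zero_iff]
        exact he.trans_lt hh
      have k1 := (hball e he').2 u hu
      rw [sub_right_comm]
      exact k1.trans (mul_le_mul_of_nonneg_left he hε.le)) (by simp) (by simp)
  rw [Real.norm_eq_abs] at h1
  simp only [add_zero, map_zero, zero_div, sub_zero] at h1
  calc _ = |F (θ + h, u) - partialD₂ F (θ, u) h h / 2 - F (θ, u) - partialD F (θ, u) h| := by
        congr 1
        ring
    _ ≤ _ := h1.trans (le_of_eq (by ring))

variable {X : Type*} [TopologicalSpace X]

lemma continuous_partialD_comp {u : X → G} (hF : ∀ v ∈ K, ContDiffAt ℝ 2 F (θ, v))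
    (hu : Continuous u) (huK : ∀ x, u x ∈ K) : Continuous fun x => partialD F (θ, u x) := by
  refine continuous_iff_continuousAt.2 fun x => ?_
  exact ContinuousAt.comp (f := fun x => (θ, u x))
    (contDiffAt_partialD (hF _ (huK x))).continuousAt (by fun_prop)

lemma continuous_partialD₂_comp {u : X → G} (hF : ∀ v ∈ K, ContDiffAt ℝ 2 F (θ, v))
    (hu : Continuous u) (huK : ∀ x, u x ∈ K) : Continuous fun x => partialD₂ F (θ, u x) := by
  refine continuous_iff_continuousAt.2 fun x => ?_
  exact ContinuousAt.comp (f := fun x => (θ, u x))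
    (continuousAt_partialD₂ (hF _ (huK x))) (by fun_prop)

lemma continuous_comp_right {u : X → G} (hF : ∀ v ∈ K, ContDiffAt ℝ 2 F (θ, v))
    (hu : Continuous u) (huK : ∀ x, u x ∈ K) : Continuous fun x => F (θ, u x) := by
  refine continuous_iff_continuousAt.2 fun x => ?_
  exact ContinuousAt.comp (f := fun x => (θ, u x)) (hF _ (huK x)).continuousAt (by fun_prop)

set_option maxSynthPendingDepth 5 in
/-- Log-likelihoods that are smooth functions of the parameter and a statistic with compact range,
up to a part that is linear in the parameter, make up local models. -/
lemma localModel_of_contDiff [MeasurableSpace X] [OpensMeasurableSpace X] {P : Measure X} {u : X → G} {A : X → E →L[ℝ] ℝ}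
    (hΘ : IsOpen Θ) (hK : IsCompact K)
    (hF : ∀ η ∈ Θ, ∀ u ∈ K, ContDiffAt ℝ 2 F (η, u)) (hθ : θ ∈ Θ)
    (hu : Continuous u) (huK : ∀ x, u x ∈ K) (hA : Continuous A)
    (hInt : ∀ᶠ h in 𝓝 (0 : E),
      ∫ x, Real.exp (F (θ + h, u x) - F (θ, u x) + A x h) ∂P = 1) :
    LocalModel P (fun h x => F (θ + h, u x) - F (θ, u x) + A x h)
      (fun x => partialD F (θ, u x) + A x) (fun x => partialD₂ F (θ, u x)) where
  measurable_score v := by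
    have := (continuous_partialD_comp (hF θ hθ) hu huK).add hA
    exact (this.clm_apply continuous_const).measurable
  measurable_hess v w := by
    have := continuous_partialD₂_comp (hF θ hθ) hu huK
    exact ((this.clm_apply continuous_const).clm_apply continuous_const).measurable
  hess_symm x v w := partialD₂_symm (hF θ hθ _ (huK x)) v w
  hess_bdd := by
    have h1 : ContinuousOn (fun v => ‖partialD₂ F (θ, v)‖) K := by
      intro v hv
      have hc : ContinuousAt (fun v : G => (θ, v)) v := by fun_prop
      have h2 : ContinuousAt (fun v => partialD₂ F (θ, v)) v :=
        ContinuousAt.comp_of_eq (continuousAt_partialD₂ (hF θ hθ v hv)) hc rfl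
      exact h2.norm.continuousWithinAt
    obtain ⟨C, hC⟩ := hK.bddAbove_image h1
    exact ⟨C, fun x => hC ⟨u x, huK x, rfl⟩⟩
  measurable_ratio := by
    have h0 : Tendsto (fun h : E => θ + h) (𝓝 0) (𝓝 θ) := by
      simpa using (tendsto_const_nhds (x := θ)).add (tendsto_id (x := 𝓝 (0 : E)))
    filter_upwards [h0.eventually (hΘ.eventually_mem hθ)] with h hh
    exact (((continuous_comp_right (hF _ hh) hu huK).sub
      (continuous_comp_right (hF _ hθ) hu huK)).add (hA.clm_apply continuous_const)).measurable
  expansion ε hε := by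
    filter_upwards [eventually_abs_sub_taylor_le hΘ hK hF hθ hε] with h hh x
    refine le_of_eq_of_le ?_ (hh (u x) (huK x))
    congr 1
    rw [add_apply]
    ring
  integral_exp := hInt

end Uniform

end

end StudentT

/-! ### Normalization of the Student density. -/

namespace StudentT

section

variable {k : ℕ}

lemma lintegral_exp_neg_mul_dotProduct {b : ℝ} (hb : 0 < b) :
    ∫⁻ y : Fin k → ℝ, ENNReal.ofReal (Real.exp (-b * (y ⬝ᵥ y))) =
      ENNReal.ofReal ((Real.pi / b) ^ ((k : ℝ) / 2)) := by
  have h1 : (fun y : Fin k → ℝ => Real.exp (-b * (y ⬝ᵥ y))) =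
      fun y => ∏ i, Real.exp (-b * y i ^ 2) := by
    ext y
    rw [← Real.exp_sum, ← Finset.mul_sum]
    simp only [dotProduct, sq]
  have hInt : Integrable fun y : Fin k → ℝ => ∏ i, Real.exp (-b * y i ^ 2) :=
    Integrable.fintype_prod (f := fun _ t => Real.exp (-b * t ^ 2))
      fun _ => integrable_exp_neg_mul_sq hb
  rw [← ofReal_integral_eq_lintegral_ofReal (by rw [h1]; exact hInt)
    (Eventually.of_forall fun y => (Real.exp_pos _).le), h1,
    integral_fintype_prod_volume_eq_pow (fun t : ℝ => Real.exp (-b * t ^ 2)), integral_gaussian,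
    Fintype.card_fin, Real.sqrt_eq_rpow, ← Real.rpow_natCast, ← Real.rpow_mul (by positivity)]
  congr 2
  ring

lemma normConst_pos {ν : ℝ} (hν : 0 < ν) : 0 < normConst k ν := by
  have := Real.pi_pos
  refine div_pos (Real.Gamma_pos_of_pos (by positivity)) (mul_pos (by positivity) ?_)
  exact Real.Gamma_pos_of_pos (by positivity)

/-- The standard Student density is a Gamma mixture of Gaussian densities. -/
lemma lintegral_student_standard {ν : ℝ} (hν : 0 < ν) :
    ∫⁻ y : Fin k → ℝ, ENNReal.ofReal ((1 + y ⬝ᵥ y / ν) ^ (-((ν + k) / 2))) =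
      ENNReal.ofReal (normConst k ν)⁻¹ := by
  set a : ℝ := (ν + k) / 2 with ha
  have ha0 : 0 < a := by positivity
  have hpi := Real.pi_pos
  have hGa := Real.Gamma_pos_of_pos ha0
  have hGn := Real.Gamma_pos_of_pos (half_pos hν)
  have hr : ∀ y : Fin k → ℝ, 0 < 1 + y ⬝ᵥ y / ν := fun y => by
    have : 0 ≤ y ⬝ᵥ y := Finset.sum_nonneg fun i _ => mul_self_nonneg (y i)
    positivity
  -- The power (1 + |y|² / ν)^(-a) is an integral over t of a Gamma kernel times a Gaussian in y.
  -- After Tonelli, integrating y out leaves the Gamma(ν / 2, 1) density up to the constant.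
  let g : (Fin k → ℝ) → ℝ → ENNReal := fun y t => ENNReal.ofReal
    ((Set.Ioi (0 : ℝ)).indicator (fun t => (Real.Gamma a)⁻¹ * t ^ (a - 1) *
      Real.exp (-t) * Real.exp (-(t / ν) * (y ⬝ᵥ y))) t)
  have hg : Measurable (Function.uncurry g) := by
    refine ENNReal.measurable_ofReal.comp ?_
    have : (fun z : (Fin k → ℝ) × ℝ =>
        (Set.Ioi (0 : ℝ)).indicator (fun t => (Real.Gamma a)⁻¹ * t ^ (a - 1) *
          Real.exp (-t) * Real.exp (-(t / ν) * (z.1 ⬝ᵥ z.1))) z.2) =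
        (Prod.snd ⁻¹' Set.Ioi (0 : ℝ)).indicator fun z : (Fin k → ℝ) × ℝ =>
          (Real.Gamma a)⁻¹ * z.2 ^ (a - 1) * Real.exp (-z.2) *
            Real.exp (-(z.2 / ν) * (z.1 ⬝ᵥ z.1)) := by
      ext ⟨y, t⟩
      simp [Set.indicator]
    rw [this]
    refine Measurable.indicator ?_ (measurable_snd measurableSet_Ioi)
    have hd : Measurable fun z : (Fin k → ℝ) × ℝ => z.1 ⬝ᵥ z.1 := by
      unfold dotProduct
      fun_prop
    fun_prop
  have h1 : ∀ y : Fin k → ℝ, ENNReal.ofReal ((1 + y ⬝ᵥ y / ν) ^ (-a)) = ∫⁻ t, g y t := by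
    intro y
    rw [← mul_one (ENNReal.ofReal _), ← lintegral_gammaPDF_eq_one ha0 (hr y),
      ← lintegral_const_mul' _ _ ENNReal.ofReal_ne_top]
    -- The indicator excludes t = 0 while the Gamma density is not cut off there; the point is null.
    have h0 : ∀ᵐ t : ℝ, t ≠ 0 := by simp [ae_iff]
    refine lintegral_congr_ae ?_
    filter_upwards [h0] with t ht
    rcases lt_or_gt_of_ne ht with h | h
    · simp [gammaPDF_of_neg h, g, h.le]
    · rw [gammaPDF_of_nonneg h.le, ← ENNReal.ofReal_mul (Real.rpow_nonneg (hr y).le _)]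
      simp only [g]
      rw [Set.indicator_of_mem (Set.mem_Ioi.2 h)]
      congr 1
      rw [Real.rpow_neg (hr y).le, mul_assoc _ (Real.exp (-t)), ← Real.exp_add]
      have h2 : -t + -(t / ν) * (y ⬝ᵥ y) = -((1 + y ⬝ᵥ y / ν) * t) := by ring
      rw [h2]
      have h3 := (Real.rpow_pos_of_pos (hr y) a).ne'
      generalize (1 + y ⬝ᵥ y / ν) ^ a = R at h3
      field_simp
  simp_rw [h1]
  rw [lintegral_lintegral_swap hg.aemeasurable]
  have h2 : ∀ᵐ t : ℝ, ∫⁻ y : Fin k → ℝ, g y t =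
      ENNReal.ofReal (normConst k ν)⁻¹ * gammaPDF (ν / 2) 1 t := by
    have h0 : ∀ᵐ t : ℝ, t ≠ 0 := by simp [ae_iff]
    filter_upwards [h0] with t ht
    rcases lt_or_gt_of_ne ht with h | h
    · simp [gammaPDF_of_neg h, g, h.le]
    · rw [gammaPDF_of_nonneg h.le, ← ENNReal.ofReal_mul (inv_pos.2 (normConst_pos hν)).le]
      simp only [g]
      simp_rw [Set.indicator_of_mem (Set.mem_Ioi.2 h)]
      have hc : 0 ≤ (Real.Gamma a)⁻¹ * t ^ (a - 1) * Real.exp (-t) := by positivity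
      simp_rw [ENNReal.ofReal_mul hc]
      rw [lintegral_const_mul' _ _ ENNReal.ofReal_ne_top,
        lintegral_exp_neg_mul_dotProduct (div_pos h hν), ← ENNReal.ofReal_mul hc]
      congr 1
      have h3 : Real.pi / (t / ν) = Real.pi * ν / t := by field_simp
      have h4 : t ^ (a - 1) = t ^ (ν / 2 - 1) * t ^ ((k : ℝ) / 2) := by
        rw [← Real.rpow_add h]
        congr 1
        rw [ha]
        ring
      rw [h3, Real.div_rpow (by positivity) h.le, h4, normConst, inv_div, Real.one_rpow, one_mul]
      have h5 := (Real.rpow_pos_of_pos h ((k : ℝ) / 2)).ne'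
      field_simp
      rfl
  rw [lintegral_congr_ae h2, lintegral_const_mul' _ _ ENNReal.ofReal_ne_top,
    lintegral_gammaPDF_eq_one (half_pos hν) one_pos, mul_one]

open scoped MatrixOrder Matrix.Norms.L2Operator in
lemma exists_eq_transpose_mul_self {A : Matrix (Fin k) (Fin k) ℝ} (hA : A.PosDef) :
    ∃ B : Matrix (Fin k) (Fin k) ℝ, A = Bᵀ * B := by
  obtain ⟨B, hB⟩ := CStarAlgebra.nonneg_iff_eq_star_mul_self.mp hA.posSemidef.nonneg
  exact ⟨B, hB⟩

lemma dotProduct_transpose_mul_self_mulVec (B : Matrix (Fin k) (Fin k) ℝ) (y : Fin k → ℝ) :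
    y ⬝ᵥ ((Bᵀ * B) *ᵥ y) = (B *ᵥ y) ⬝ᵥ (B *ᵥ y) := by
  rw [← Matrix.mulVec_mulVec, Matrix.dotProduct_mulVec, Matrix.vecMul_transpose]

lemma measurable_density (V : Param k) : Measurable (density V) := by
  have h : Continuous (sqMahalanobis V.1 V.2.1) := by
    unfold sqMahalanobis
    fun_prop
  have := h.measurable
  unfold density
  fun_prop

lemma one_add_sqMahalanobis_pos {V : Param k} (hV : V ∈ paramSpace k) (x : Fin k → ℝ) :
    0 < 1 + sqMahalanobis V.1 V.2.1 x / V.2.2 := by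
  have h1 := hV.1.inv.posSemidef.dotProduct_mulVec_nonneg (x - V.1)
  have h2 : 0 ≤ sqMahalanobis V.1 V.2.1 x := by simpa [sqMahalanobis] using h1
  have := hV.2
  positivity

lemma density_pos {V : Param k} (hV : V ∈ paramSpace k) (x : Fin k → ℝ) : 0 < density V x :=
  mul_pos (mul_pos (normConst_pos hV.2) (Real.rpow_pos_of_pos hV.1.det_pos _))
    (Real.rpow_pos_of_pos (one_add_sqMahalanobis_pos hV x) _)

/-- The Student density integrates to one. -/
lemma lintegral_density {V : Param k} (hV : V ∈ paramSpace k) :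
    ∫⁻ x, ENNReal.ofReal (density V x) = 1 := by
  obtain ⟨m, S, ν⟩ := V
  obtain ⟨hS, hν⟩ := hV
  simp only at hS hν
  obtain ⟨B, hB⟩ := exists_eq_transpose_mul_self hS.inv
  have hd : 0 < S.det := hS.det_pos
  have hdB : B.det * B.det = S.det⁻¹ := by
    have := congrArg Matrix.det hB
    rw [Matrix.det_nonsing_inv, Ring.inverse_eq_inv', Matrix.det_mul, Matrix.det_transpose] at this
    exact this.symm
  have hB0 : B.det ≠ 0 := fun h => by
    rw [h, zero_mul] at hdB
    exact (inv_pos.2 hd).ne hdB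
  let g : (Fin k → ℝ) → ENNReal := fun y => ENNReal.ofReal ((1 + y ⬝ᵥ y / ν) ^ (-((ν + k) / 2)))
  have hg : Measurable g := by
    have h : Continuous fun y : Fin k → ℝ => y ⬝ᵥ y := by fun_prop
    have := h.measurable
    fun_prop
  have hc : 0 ≤ normConst k ν * S.det ^ (-(1 / 2) : ℝ) :=
    (mul_pos (normConst_pos hν) (Real.rpow_pos_of_pos hd _)).le
  have h1 : ∀ x, ENNReal.ofReal (density (m, S, ν) x) =
      ENNReal.ofReal (normConst k ν * S.det ^ (-(1 / 2) : ℝ)) * g (B *ᵥ (x - m)) := by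
    intro x
    rw [← ENNReal.ofReal_mul hc]
    simp only [density, sqMahalanobis]
    rw [hB, dotProduct_transpose_mul_self_mulVec]
  -- Standardization y = B(x - m) with S⁻¹ = Bᵀ B; the Jacobian |det B|⁻¹ = (det S)^(1/2) cancels
  -- the determinant in the density.
  have h2 : ∫⁻ x, g (B *ᵥ (x - m)) = ENNReal.ofReal |B.det⁻¹| * ∫⁻ y, g y := by
    rw [lintegral_sub_right_eq_self (fun x => g (B *ᵥ x)) m]
    have h3 := Real.map_matrix_volume_pi_eq_smul_volume_pi hB0
    have h4 : ∫⁻ y, g y ∂(Measure.map (Matrix.toLin' B) volume) = ∫⁻ x, g (B *ᵥ x) := by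
      rw [lintegral_map hg (LinearMap.continuous_on_pi _).measurable]
      rfl
    rw [← h4, h3, lintegral_smul_measure, smul_eq_mul]
  simp_rw [h1]
  rw [lintegral_const_mul' _ _ ENNReal.ofReal_ne_top, h2, lintegral_student_standard hν,
    ← ENNReal.ofReal_mul (abs_nonneg _), ← ENNReal.ofReal_mul hc, ← ENNReal.ofReal_one]
  congr 1
  have h5 : |B.det⁻¹| = S.det ^ ((1 / 2) : ℝ) := by
    rw [← Real.sqrt_eq_rpow, ← Real.sqrt_mul_self_eq_abs, ← mul_inv, hdB, inv_inv]
  rw [h5, Real.rpow_neg hd.le]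
  have h6 := (Real.rpow_pos_of_pos hd (1 / 2)).ne'
  have h7 := (normConst_pos (k := k) hν).ne'
  field_simp

lemma isProbabilityMeasure_law {V : Param k} (hV : V ∈ paramSpace k) :
    IsProbabilityMeasure (law V) :=
  ⟨by rw [law, withDensity_apply _ MeasurableSet.univ, Measure.restrict_univ,
    lintegral_density hV]⟩

end

end StudentT

/-! ### The Student family as a local model on the coordinates (μ, vech Σ, ν). -/

namespace StudentT

section

variable {k : ℕ}

/-- Coordinates `(μ, vech Σ, ν)` of the parameters. -/
abbrev Coord (k : ℕ) : Type := (Fin k → ℝ) × (VechIdx k → ℝ) × ℝ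

/-- The index in `vech` of an entry of a symmetric matrix. -/
def vechIdx (i j : Fin k) : VechIdx k := ⟨(min i j, max i j), min_le_max⟩

/-- The symmetric matrix with given `vech`. -/
def symMat (a : VechIdx k → ℝ) : Matrix (Fin k) (Fin k) ℝ := Matrix.of fun i j => a (vechIdx i j)

/-- The entries of a matrix on and above the diagonal. -/
def vech (S : Matrix (Fin k) (Fin k) ℝ) : VechIdx k → ℝ := fun p => S p.1.1 p.1.2

lemma vechIdx_comm (i j : Fin k) : vechIdx i j = vechIdx j i := by
  simp [vechIdx, min_comm, max_comm]

lemma symMat_isSymm (a : VechIdx k → ℝ) : (symMat a).IsSymm := by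
  ext i j
  simp [symMat, vechIdx_comm]

lemma symMat_vech {S : Matrix (Fin k) (Fin k) ℝ} (hS : S.IsSymm) : symMat (vech S) = S := by
  ext i j
  simp only [symMat, vech, vechIdx, Matrix.of_apply]
  rcases le_total i j with h | h
  · rw [min_eq_left h, max_eq_right h]
  · rw [min_eq_right h, max_eq_left h]
    exact hS.apply i j

lemma symMat_add (a b : VechIdx k → ℝ) : symMat (a + b) = symMat a + symMat b := rfl

lemma symMat_smul (t : ℝ) (a : VechIdx k → ℝ) : symMat (t • a) = t • symMat a := rfl

lemma symMat_single (p : VechIdx k) : symMat (Pi.single p 1) = symUnit p := by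
  ext i j
  simp [symMat, symUnit, Pi.single_apply, vechIdx, Subtype.ext_iff]

lemma symMat_eq_zero {a : VechIdx k → ℝ} (h : symMat a = 0) : a = 0 := by
  ext ⟨⟨i, j⟩, hij⟩
  have := congrFun (congrFun h i) j
  simp only [symMat, vechIdx, Matrix.of_apply] at this
  simp only at hij
  simpa [min_eq_left hij, max_eq_right hij] using this

/-- The parameter with given coordinates. -/
def toParam (θ : Coord k) : Param k := (θ.1, symMat θ.2.1, θ.2.2)

/-- The coordinates of a parameter. -/
def coord (V : Param k) : Coord k := (V.1, vech V.2.1, V.2.2)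

lemma toParam_coord {V : Param k} (hV : V.2.1.IsSymm) : toParam (coord V) = V := by
  simp [toParam, coord, symMat_vech hV]

/-- The coordinates of the points of the parameter space. -/
def coordSpace (k : ℕ) : Set (Coord k) := {θ | toParam θ ∈ paramSpace k}

lemma isSymm_of_mem_paramSpace {V : Param k} (hV : V ∈ paramSpace k) : V.2.1.IsSymm := by
  have := hV.1.isHermitian
  rwa [Matrix.IsHermitian, Matrix.conjTranspose_eq_transpose_of_trivial] at this

lemma coord_mem {V : Param k} (hV : V ∈ paramSpace k) : coord V ∈ coordSpace k := by
  rw [coordSpace, Set.mem_ofPred_eq, toParam_coord (isSymm_of_mem_paramSpace hV)]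
  exact hV

/-- Positivity of the quadratic form on the compact unit sphere persists under small changes of the
matrix, and homogeneity extends it to all nonzero vectors. -/
lemma isOpen_posDef_symMat : IsOpen {a : VechIdx k → ℝ | (symMat a).PosDef} := by
  refine isOpen_iff_mem_nhds.2 fun a ha => ?_
  have h1 : ∀ᶠ b in 𝓝 a, ∀ x ∈ Metric.sphere (0 : Fin k → ℝ) 1, 0 < x ⬝ᵥ (symMat b *ᵥ x) := by
    refine (isCompact_sphere _ _).eventually_forall_of_forall_eventually fun x hx => ?_
    have hc : Continuous fun z : (VechIdx k → ℝ) × (Fin k → ℝ) =>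
        z.2 ⬝ᵥ (symMat z.1 *ᵥ z.2) := by
      simp only [dotProduct, Matrix.mulVec, symMat, Matrix.of_apply]
      fun_prop
    have hx0 : x ≠ 0 := by
      rintro rfl
      simp at hx
    have := ha.dotProduct_mulVec_pos hx0
    exact hc.continuousAt.eventually (lt_mem_nhds (by simpa using this))
  filter_upwards [h1] with b hb
  refine Matrix.PosDef.of_dotProduct_mulVec_pos ?_ fun x hx => ?_
  · rw [Matrix.IsHermitian, Matrix.conjTranspose_eq_transpose_of_trivial]
    exact symMat_isSymm b
  · have hn : 0 < ‖x‖ := norm_pos_iff.2 hx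
    have h2 := hb (‖x‖⁻¹ • x) (by simp [norm_smul, hn.ne'])
    rw [Matrix.mulVec_smul, smul_dotProduct, dotProduct_smul, smul_eq_mul, smul_eq_mul,
      ← mul_assoc] at h2
    simpa using (pos_iff_pos_of_mul_pos h2).1 (by positivity)

lemma isOpen_coordSpace : IsOpen (coordSpace k) := by
  have h1 : IsOpen {θ : Coord k | (symMat θ.2.1).PosDef} :=
    isOpen_posDef_symMat.preimage (continuous_fst.comp continuous_snd)
  have h2 : IsOpen {θ : Coord k | 0 < θ.2.2} :=
    isOpen_lt continuous_const (continuous_snd.comp continuous_snd)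
  exact h1.inter h2

section Smooth

variable {E : Type*} [NormedAddCommGroup E] [NormedSpace ℝ E] {n : WithTop ℕ∞} {z : E}

lemma contDiffAt_det {A : E → Matrix (Fin k) (Fin k) ℝ}
    (hA : ∀ i j, ContDiffAt ℝ n (fun e => A e i j) z) : ContDiffAt ℝ n (fun e => (A e).det) z := by
  simp only [Matrix.det_apply]
  refine ContDiffAt.sum fun σ _ => ?_
  exact (contDiffAt_prod fun i _ => hA (σ i) i).const_smul _

/-- By Cramer's rule the entries of the inverse are quotients of determinants. -/
lemma contDiffAt_inv_matrix {A : E → Matrix (Fin k) (Fin k) ℝ}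
    (hA : ∀ i j, ContDiffAt ℝ n (fun e => A e i j) z) (h0 : (A z).det ≠ 0) (i j : Fin k) :
    ContDiffAt ℝ n (fun e => (A e)⁻¹ i j) z := by
  simp only [Matrix.inv_def, Ring.inverse_eq_inv', Matrix.smul_apply, smul_eq_mul,
    Matrix.adjugate_apply]
  refine ((contDiffAt_det hA).inv h0).mul (contDiffAt_det fun a b => ?_)
  by_cases h : a = j
  · subst h
    simp only [Matrix.updateRow_self]
    exact contDiffAt_const
  · simp only [Matrix.updateRow_ne h]
    exact hA a b

/-- The complex Gamma function is holomorphic, hence smooth, on the right half-plane. -/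
lemma contDiffAt_realGamma {s : ℝ} (hs : 0 < s) : ContDiffAt ℝ n Real.Gamma s := by
  have h1 : DifferentiableOn ℂ Complex.Gamma {w : ℂ | 0 < w.re} := fun w hw =>
    (Complex.differentiableAt_Gamma w fun m h => by
      rw [Set.mem_ofPred_eq, h] at hw
      simp only [Complex.neg_re, Complex.natCast_re] at hw
      linarith [Nat.cast_nonneg (α := ℝ) m]).differentiableWithinAt
  have h2 : IsOpen {w : ℂ | 0 < w.re} := isOpen_lt continuous_const Complex.continuous_re
  have h3 : ContDiffAt ℂ n Complex.Gamma (s : ℂ) :=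
    (h1.contDiffOn h2).contDiffAt (h2.mem_nhds (by simpa using hs))
  exact h3.real_of_complex

lemma contDiffAt_log_normConst {ν : ℝ} (hν : 0 < ν) :
    ContDiffAt ℝ n (fun ν => Real.log (normConst k ν)) ν := by
  have hpi := Real.pi_pos
  have h1 : ContDiffAt ℝ n (fun ν : ℝ => Real.Gamma ((ν + k) / 2)) ν := by
    have : ContDiffAt ℝ n (fun ν : ℝ => (ν + k) / 2) ν := by fun_prop
    exact ContDiffAt.comp ν (g := Real.Gamma) (contDiffAt_realGamma (by positivity)) this
  have h2 : ContDiffAt ℝ n (fun ν : ℝ => Real.Gamma (ν / 2)) ν := by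
    have : ContDiffAt ℝ n (fun ν : ℝ => ν / 2) ν := by fun_prop
    exact ContDiffAt.comp ν (g := Real.Gamma) (contDiffAt_realGamma (by positivity)) this
  have h3 : ContDiffAt ℝ n (fun ν : ℝ => (Real.pi * ν) ^ ((k : ℝ) / 2)) ν := by
    have : ContDiffAt ℝ n (fun ν : ℝ => Real.pi * ν) ν := by fun_prop
    exact this.rpow_const_of_ne (by positivity)
  have h4 : (Real.pi * ν) ^ ((k : ℝ) / 2) * Real.Gamma (ν / 2) ≠ 0 :=
    mul_ne_zero (Real.rpow_pos_of_pos (by positivity) _).ne'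
      (Real.Gamma_pos_of_pos (by positivity)).ne'
  exact (h1.div (h3.mul h2) h4).log (normConst_pos hν).ne'

end Smooth

/-- The homogenized quadratic form of the Student density. -/
def homQuad (p : Coord k × ℝ × (Fin k → ℝ)) : ℝ :=
  p.2.1 ^ 2 + (p.2.2 - p.2.1 • p.1.1) ⬝ᵥ
    ((symMat p.1.2.1)⁻¹ *ᵥ (p.2.2 - p.2.1 • p.1.1)) / p.1.2.2

/-- The log-density as a function of the coordinates and the direction of `(1, x)`, up to a term
that is linear in the coordinates. -/
def logLik (p : Coord k × ℝ × (Fin k → ℝ)) : ℝ :=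
  Real.log (normConst k p.1.2.2) - 1 / 2 * Real.log (symMat p.1.2.1).det -
    (p.1.2.2 + k) / 2 * Real.log (homQuad p)

/-- The unit sphere of `ℝ × ℝ^k`. -/
def unitSphere (k : ℕ) : Set (ℝ × (Fin k → ℝ)) := {u | u.1 ^ 2 + u.2 ⬝ᵥ u.2 = 1}

lemma dotProduct_self_nonneg' (y : Fin k → ℝ) : 0 ≤ y ⬝ᵥ y :=
  Finset.sum_nonneg fun i _ => mul_self_nonneg (y i)

lemma isCompact_unitSphere : IsCompact (unitSphere k) := by
  refine Metric.isCompact_of_isClosed_isBounded ?_ ?_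
  · have : Continuous fun u : ℝ × (Fin k → ℝ) => u.1 ^ 2 + u.2 ⬝ᵥ u.2 := by fun_prop
    exact isClosed_eq this continuous_const
  · refine (Metric.isBounded_closedBall (x := 0) (r := 1)).subset fun u hu => ?_
    rw [unitSphere, Set.mem_ofPred_eq] at hu
    have h0 := dotProduct_self_nonneg' u.2
    rw [mem_closedBall_zero_iff, Prod.norm_def, max_le_iff]
    refine ⟨?_, (pi_norm_le_iff_of_nonneg zero_le_one).2 fun i => ?_⟩
    · rw [Real.norm_eq_abs, ← sq_le_one_iff_abs_le_one]
      linarith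
    · rw [Real.norm_eq_abs, ← sq_le_one_iff_abs_le_one]
      have : u.2 i * u.2 i ≤ u.2 ⬝ᵥ u.2 :=
        Finset.single_le_sum (f := fun i => u.2 i * u.2 i) (fun j _ => mul_self_nonneg _)
          (Finset.mem_univ i)
      nlinarith [sq_nonneg u.1]

/-- Points with u.1 = 0 stand for observations at infinity: there the quadratic form of Σ⁻¹ is
positive because u.2 ≠ 0; elsewhere u.1² is positive. -/
lemma homQuad_pos {θ : Coord k} (hθ : θ ∈ coordSpace k) {u : ℝ × (Fin k → ℝ)}
    (hu : u ∈ unitSphere k) : 0 < homQuad (θ, u) := by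
  have hν : 0 < θ.2.2 := hθ.2
  have hS : (symMat θ.2.1)⁻¹.PosDef := hθ.1.inv
  rw [unitSphere, Set.mem_ofPred_eq] at hu
  have h1 : 0 ≤ (u.2 - u.1 • θ.1) ⬝ᵥ ((symMat θ.2.1)⁻¹ *ᵥ (u.2 - u.1 • θ.1)) := by
    simpa using hS.posSemidef.dotProduct_mulVec_nonneg (u.2 - u.1 • θ.1)
  rw [homQuad]
  by_cases h0 : u.1 = 0
  · rw [h0] at hu
    have h2 : u.2 ≠ 0 := by
      intro h
      simp [h] at hu
    have h3 := hS.dotProduct_mulVec_pos h2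
    simp only [star_trivial] at h3
    simp only [h0, zero_smul, sub_zero]
    positivity
  · positivity

lemma contDiffAt_homQuad {θ : Coord k} (hθ : θ ∈ coordSpace k) (u : ℝ × (Fin k → ℝ)) :
    ContDiffAt ℝ 2 homQuad (θ, u) := by
  have hν : θ.2.2 ≠ 0 := hθ.2.ne'
  have hd : (symMat θ.2.1).det ≠ 0 := hθ.1.det_pos.ne'
  have h1 : ∀ i j, ContDiffAt ℝ 2
      (fun p : Coord k × ℝ × (Fin k → ℝ) => (symMat p.1.2.1)⁻¹ i j) (θ, u) := fun i j =>
    contDiffAt_inv_matrix (A := fun p : Coord k × ℝ × (Fin k → ℝ) => symMat p.1.2.1)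
      (fun i j => by simp only [symMat, Matrix.of_apply]; fun_prop) hd i j
  have h2 : ∀ i, ContDiffAt ℝ 2
      (fun p : Coord k × ℝ × (Fin k → ℝ) => (p.2.2 - p.2.1 • p.1.1) i) (θ, u) := fun i => by
    simp only [Pi.sub_apply, Pi.smul_apply, smul_eq_mul]
    fun_prop
  unfold homQuad
  refine ContDiffAt.add (by fun_prop) (ContDiffAt.div ?_ (by fun_prop) hν)
  simp only [dotProduct, Matrix.mulVec]
  exact ContDiffAt.sum fun i _ => (h2 i).mul (ContDiffAt.sum fun j _ => (h1 i j).mul (h2 j))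

lemma contDiffAt_logLik {θ : Coord k} (hθ : θ ∈ coordSpace k) {u : ℝ × (Fin k → ℝ)}
    (hu : u ∈ unitSphere k) : ContDiffAt ℝ 2 logLik (θ, u) := by
  have h1 : ContDiffAt ℝ 2
      (fun p : Coord k × ℝ × (Fin k → ℝ) => Real.log (normConst k p.1.2.2)) (θ, u) := by
    have : ContDiffAt ℝ 2 (fun p : Coord k × ℝ × (Fin k → ℝ) => p.1.2.2) (θ, u) := by fun_prop
    exact ContDiffAt.comp (θ, u) (g := fun ν => Real.log (normConst k ν))
      (contDiffAt_log_normConst hθ.2) this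
  have h2 : ContDiffAt ℝ 2
      (fun p : Coord k × ℝ × (Fin k → ℝ) => Real.log (symMat p.1.2.1).det) (θ, u) :=
    (contDiffAt_det (A := fun p : Coord k × ℝ × (Fin k → ℝ) => symMat p.1.2.1)
      (fun i j => by simp only [symMat, Matrix.of_apply]; fun_prop)).log hθ.1.det_pos.ne'
  have h3 := (contDiffAt_homQuad hθ u).log (homQuad_pos hθ hu).ne'
  unfold logLik
  exact (h1.sub (contDiffAt_const.mul h2)).sub
    (ContDiffAt.mul (by fun_prop) h3)

/-- The direction of `(1, x)`. -/
def direction (x : Fin k → ℝ) : ℝ × (Fin k → ℝ) :=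
  ((√(1 + x ⬝ᵥ x))⁻¹, (√(1 + x ⬝ᵥ x))⁻¹ • x)

lemma one_add_dotProduct_pos (x : Fin k → ℝ) : 0 < 1 + x ⬝ᵥ x := by
  linarith [dotProduct_self_nonneg' x]

lemma direction_mem (x : Fin k → ℝ) : direction x ∈ unitSphere k := by
  have h := one_add_dotProduct_pos x
  simp only [unitSphere, direction, Set.mem_ofPred_eq, smul_dotProduct, dotProduct_smul,
    smul_eq_mul, inv_pow, Real.sq_sqrt h.le]
  rw [← mul_assoc, ← mul_inv, Real.mul_self_sqrt h.le]
  field_simp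

lemma continuous_direction : Continuous (direction (k := k)) := by
  have h1 : Continuous fun x : Fin k → ℝ => (√(1 + x ⬝ᵥ x))⁻¹ := by
    refine Continuous.inv₀ (by fun_prop) fun x => ?_
    exact (Real.sqrt_pos.2 (one_add_dotProduct_pos x)).ne'
  exact h1.prodMk (h1.smul continuous_id)

/-- Both `homQuad` and 1 + x ⬝ᵥ x are homogeneous of degree two in (1, x). Splitting off the norm
leaves a function on the compact sphere. -/
lemma homQuad_direction (θ : Coord k) (x : Fin k → ℝ) :
    1 + sqMahalanobis (toParam θ).1 (toParam θ).2.1 x / (toParam θ).2.2 =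
      (1 + x ⬝ᵥ x) * homQuad (θ, direction x) := by
  have h := one_add_dotProduct_pos x
  simp only [sqMahalanobis, toParam, homQuad, direction]
  rw [← smul_sub, Matrix.mulVec_smul, smul_dotProduct, dotProduct_smul, smul_eq_mul, smul_eq_mul,
    ← mul_assoc, ← mul_inv, Real.mul_self_sqrt h.le, inv_pow, Real.sq_sqrt h.le]
  field_simp

/-- The tail weight coordinate. -/
def tailCoord (k : ℕ) : Coord k →L[ℝ] ℝ :=
  (ContinuousLinearMap.snd ℝ (VechIdx k → ℝ) ℝ).comp
    (ContinuousLinearMap.snd ℝ (Fin k → ℝ) ((VechIdx k → ℝ) × ℝ))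

@[simp] lemma tailCoord_apply (θ : Coord k) : tailCoord k θ = θ.2.2 := rfl

/-- The part of the log-density that is linear in the coordinates. -/
def linearPart (x : Fin k → ℝ) : Coord k →L[ℝ] ℝ :=
  (-(1 / 2) * Real.log (1 + x ⬝ᵥ x)) • tailCoord k

lemma continuous_linearPart : Continuous (linearPart (k := k)) := by
  have : Continuous fun x : Fin k → ℝ => Real.log (1 + x ⬝ᵥ x) :=
    Continuous.log (by fun_prop) fun x => (one_add_dotProduct_pos x).ne'
  unfold linearPart
  exact (continuous_const.mul this).smul continuous_const

/-- The split-off norm contributes -(ν + k)/2 · log(1 + x ⬝ᵥ x): its ν part is unbounded in x but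
linear in the parameter, and its k part cancels in likelihood ratios. -/
lemma log_density {θ : Coord k} (hθ : θ ∈ coordSpace k) (x : Fin k → ℝ) :
    Real.log (density (toParam θ) x) = logLik (θ, direction x) + linearPart x θ -
      k / 2 * Real.log (1 + x ⬝ᵥ x) := by
  have h1 := one_add_sqMahalanobis_pos hθ x
  have h2 := normConst_pos (k := k) hθ.2
  have h3 := hθ.1.det_pos
  rw [density, Real.log_mul (mul_pos h2 (Real.rpow_pos_of_pos h3 _)).ne'
    (Real.rpow_pos_of_pos h1 _).ne', Real.log_mul h2.ne' (Real.rpow_pos_of_pos h3 _).ne',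
    Real.log_rpow h3, Real.log_rpow h1, homQuad_direction, Real.log_mul
    (one_add_dotProduct_pos x).ne' (homQuad_pos hθ (direction_mem x)).ne']
  simp only [toParam, logLik, linearPart, smul_apply, smul_eq_mul, tailCoord_apply]
  ring

/-- The score in the coordinates. -/
def score (θ : Coord k) (x : Fin k → ℝ) : Coord k →L[ℝ] ℝ :=
  partialD logLik (θ, direction x) + linearPart x

/-- The log-likelihood ratio in the coordinates. -/
def logLikRatio (θ h : Coord k) (x : Fin k → ℝ) : ℝ :=
  logLik (θ + h, direction x) - logLik (θ, direction x) + linearPart x h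

/-- The Hessian of the log-likelihood in the coordinates. -/
def hessian (θ : Coord k) (x : Fin k → ℝ) : Coord k →L[ℝ] Coord k →L[ℝ] ℝ :=
  partialD₂ logLik (θ, direction x)

lemma logLikRatio_zero (θ : Coord k) (x : Fin k → ℝ) : logLikRatio θ 0 x = 0 := by
  simp [logLikRatio]

lemma density_mul_exp {θ h : Coord k} (hθ : θ ∈ coordSpace k) (hh : θ + h ∈ coordSpace k)
    (x : Fin k → ℝ) :
    density (toParam (θ + h)) x = density (toParam θ) x * Real.exp (logLikRatio θ h x) := by
  rw [← Real.exp_log (density_pos hh x), ← Real.exp_log (density_pos hθ x), ← Real.exp_add,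
    log_density hθ, log_density hh, map_add, logLikRatio]
  congr 1
  ring

lemma measurable_logLikRatio {θ h : Coord k} (hθ : θ ∈ coordSpace k) (hh : θ + h ∈ coordSpace k) :
    Measurable (logLikRatio θ h) := by
  have h1 := continuous_comp_right (fun v hv => contDiffAt_logLik hθ hv) continuous_direction
    direction_mem
  have h2 := continuous_comp_right (fun v hv => contDiffAt_logLik hh hv) continuous_direction
    direction_mem
  exact ((h2.sub h1).add (continuous_linearPart.clm_apply continuous_const)).measurable

lemma law_add {θ h : Coord k} (hθ : θ ∈ coordSpace k) (hh : θ + h ∈ coordSpace k) :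
    law (toParam (θ + h)) = (law (toParam θ)).withDensity
      fun x => ENNReal.ofReal (Real.exp (logLikRatio θ h x)) := by
  rw [law, law, ← withDensity_mul _ (measurable_density _).ennreal_ofReal
    (measurable_logLikRatio hθ hh).exp.ennreal_ofReal]
  congr 1
  ext x
  rw [density_mul_exp hθ hh, ENNReal.ofReal_mul (density_pos hθ x).le, Pi.mul_apply]

lemma integral_law_eq {θ : Coord k} (hθ : θ ∈ coordSpace k) (g : (Fin k → ℝ) → ℝ) :
    ∫ x, g x ∂law (toParam θ) = ∫ x, density (toParam θ) x * g x := by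
  rw [law, integral_withDensity_eq_integral_toReal_smul (measurable_density _).ennreal_ofReal
    (Eventually.of_forall fun x => ENNReal.ofReal_lt_top)]
  refine integral_congr_ae (Eventually.of_forall fun x => ?_)
  simp only [ENNReal.toReal_ofReal (density_pos hθ x).le, smul_eq_mul]

lemma integral_density {V : Param k} (hV : V ∈ paramSpace k) : ∫ x, density V x = 1 := by
  rw [integral_eq_lintegral_of_nonneg_ae (Eventually.of_forall fun x => (density_pos hV x).le)
    (measurable_density V).aestronglyMeasurable, lintegral_density hV, ENNReal.toReal_one]

lemma eventually_add_mem {θ : Coord k} (hθ : θ ∈ coordSpace k) :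
    ∀ᶠ h in 𝓝 (0 : Coord k), θ + h ∈ coordSpace k := by
  have h0 : Tendsto (fun h : Coord k => θ + h) (𝓝 0) (𝓝 θ) := by
    simpa using (tendsto_const_nhds (x := θ)).add (tendsto_id (x := 𝓝 (0 : Coord k)))
  exact h0.eventually (isOpen_coordSpace.eventually_mem hθ)

lemma localModel {θ : Coord k} (hθ : θ ∈ coordSpace k) :
    LocalModel (law (toParam θ)) (logLikRatio θ) (score θ) (hessian θ) := by
  refine localModel_of_contDiff isOpen_coordSpace isCompact_unitSphere
    (fun η hη u hu => contDiffAt_logLik hη hu) hθ continuous_direction direction_mem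
    continuous_linearPart ?_
  filter_upwards [eventually_add_mem hθ] with h hh
  rw [integral_law_eq hθ, ← integral_density hh]
  exact integral_congr_ae (Eventually.of_forall fun x => (density_mul_exp hθ hh x).symm)

lemma eventually_norm_score_sub_le {θ : Coord k} (hθ : θ ∈ coordSpace k) (ε : ℝ) (hε : 0 < ε) :
    ∀ᶠ h in 𝓝 (0 : Coord k), ∀ x,
      ‖score (θ + h) x - score θ x - hessian θ x h‖ ≤ ε * ‖h‖ := by
  filter_upwards [eventually_norm_partialD_sub_le isOpen_coordSpace isCompact_unitSphere
    (fun η hη u hu => contDiffAt_logLik hη hu) hθ hε] with h hh x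
  have := hh _ (direction_mem x)
  simpa [score, hessian] using this

lemma hasFDerivAt_log_density {θ : Coord k} (hθ : θ ∈ coordSpace k) (x : Fin k → ℝ) :
    HasFDerivAt (fun η => Real.log (density (toParam η) x)) (score θ x) θ := by
  have h1 := hasFDerivAt_partialD (contDiffAt_logLik hθ (direction_mem x))
  have h2 := (h1.add (linearPart x).hasFDerivAt).sub_const (k / 2 * Real.log (1 + x ⬝ᵥ x))
  refine h2.congr_of_eventuallyEq ?_
  filter_upwards [isOpen_coordSpace.eventually_mem hθ] with η hη
  exact log_density hη x

lemma hasDerivAt_log_density {θ : Coord k} (hθ : θ ∈ coordSpace k) (x : Fin k → ℝ)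
    (v : Coord k) :
    HasDerivAt (fun t : ℝ => Real.log (density (toParam (θ + t • v)) x)) (score θ x v) 0 := by
  have h1 : HasDerivAt (fun t : ℝ => θ + t • v) v 0 := by
    simpa using ((hasDerivAt_id (0 : ℝ)).smul_const v).const_add θ
  have h2 : HasFDerivAt (fun η => Real.log (density (toParam η) x)) (score θ x)
      (θ + (0 : ℝ) • v) := by
    simpa using hasFDerivAt_log_density hθ x
  exact h2.comp_hasDerivAt 0 h1

/-- The unit vector of a scatter coordinate. -/
def scatterDir (p : VechIdx k) : Coord k := (0, Pi.single p 1, 0)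

/-- The unit vector of the tail weight coordinate. -/
def tailDir (k : ℕ) : Coord k := (0, 0, 1)

lemma scoreScatter_eq {θ : Coord k} (hθ : θ ∈ coordSpace k) (x : Fin k → ℝ) (p : VechIdx k) :
    scoreScatter (toParam θ) x p = score θ x (scatterDir p) := by
  rw [← (hasDerivAt_log_density hθ x (scatterDir p)).deriv, scoreScatter]
  congr 1
  ext t
  simp [toParam, scatterDir, symMat_add, symMat_smul, symMat_single]

lemma scoreTail_eq {θ : Coord k} (hθ : θ ∈ coordSpace k) (x : Fin k → ℝ) :
    scoreTail (toParam θ) x = score θ x (tailDir k) := by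
  have h1 := hasDerivAt_log_density hθ x (tailDir k)
  have h2 : HasDerivAt (fun ν : ℝ => ν - θ.2.2) 1 θ.2.2 := (hasDerivAt_id _).sub_const _
  have h3 : HasDerivAt (fun t : ℝ => Real.log (density (toParam (θ + t • tailDir k)) x))
    (score θ x (tailDir k)) (θ.2.2 - θ.2.2) := by rwa [sub_self]
  have h4 := HasDerivAt.comp (h := fun ν : ℝ => ν - θ.2.2) θ.2.2 h3 h2
  rw [mul_one] at h4
  rw [← h4.deriv, scoreTail]
  congr 1
  ext ν
  simp [toParam, tailDir]

lemma covariance_score {θ : Coord k} (hθ : θ ∈ coordSpace k) (v w : Coord k) :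
    cov[fun x => score θ x v, fun x => score θ x w; law (toParam θ)] =
      info (law (toParam θ)) (score θ) v w := by
  have := isProbabilityMeasure_law hθ
  have M := localModel hθ
  simp [covariance, M.integral_score, info]

lemma infoSS_eq {θ : Coord k} (hθ : θ ∈ coordSpace k) (p q : VechIdx k) :
    infoSS (toParam θ) p q =
      info (law (toParam θ)) (score θ) (scatterDir p) (scatterDir q) := by
  simp only [infoSS, Matrix.of_apply, scoreScatter_eq hθ, covariance_score hθ]

lemma infoST_eq {θ : Coord k} (hθ : θ ∈ coordSpace k) (p : VechIdx k) :
    infoST (toParam θ) p = info (law (toParam θ)) (score θ) (scatterDir p) (tailDir k) := by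
  rw [← covariance_score hθ, infoST]
  simp only [scoreScatter_eq hθ]
  congr 1
  ext x
  exact scoreTail_eq hθ x

lemma infoTT_eq {θ : Coord k} (hθ : θ ∈ coordSpace k) :
    infoTT (toParam θ) = info (law (toParam θ)) (score θ) (tailDir k) (tailDir k) := by
  rw [← covariance_score hθ, infoTT, show scoreTail (toParam θ) = fun x => score θ x (tailDir k)
    from funext (scoreTail_eq hθ)]

end

end StudentT

/-! ### Orthogonality of location and nondegeneracy of the information. -/

namespace StudentT

section

variable {k : ℕ}

section Reflection

lemma sqMahalanobis_reflect (m l : Fin k → ℝ) (S : Matrix (Fin k) (Fin k) ℝ) (x : Fin k → ℝ) :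
    sqMahalanobis (m + l) S ((2 : ℝ) • m - x) = sqMahalanobis (m - l) S x := by
  have h : (2 : ℝ) • m - x - (m + l) = -(x - (m - l)) := by
    rw [two_smul]
    abel
  rw [sqMahalanobis, h, Matrix.mulVec_neg, neg_dotProduct_neg, sqMahalanobis]

lemma density_reflect (m l : Fin k → ℝ) (S : Matrix (Fin k) (Fin k) ℝ) (ν : ℝ) (x : Fin k → ℝ) :
    density (m + l, S, ν) ((2 : ℝ) • m - x) = density (m - l, S, ν) x := by
  simp only [density, sqMahalanobis_reflect]

/-- Reflecting the observation about μ amounts to reversing the location shift, so the location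
score is odd about μ and the scatter and tail scores are even. -/
lemma score_reflect {θ : Coord k} (hθ : θ ∈ coordSpace k) (x l : Fin k → ℝ)
    (z : (VechIdx k → ℝ) × ℝ) :
    score θ ((2 : ℝ) • θ.1 - x) (l, z) = score θ x (-l, z) := by
  refine (hasDerivAt_log_density hθ _ (l, z)).unique
    ((hasDerivAt_log_density hθ x (-l, z)).congr_of_eventuallyEq (Eventually.of_forall fun t => ?_))
  have := density_reflect θ.1 (t • l) (symMat (θ.2.1 + t • z.1)) (θ.2.2 + t * z.2) x
  simp only [toParam, Prod.fst_add, Prod.snd_add, Prod.smul_fst, Prod.smul_snd, smul_neg,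
    smul_eq_mul, ← sub_eq_add_neg]
  rw [this]

/-- Location is orthogonal to scatter and tail weight. -/
lemma info_location {θ : Coord k} (hθ : θ ∈ coordSpace k) (l : Fin k → ℝ)
    (z : (VechIdx k → ℝ) × ℝ) : info (law (toParam θ)) (score θ) (0, z) (l, 0) = 0 := by
  have h1 : ∀ x, density (toParam θ) ((2 : ℝ) • θ.1 - x) = density (toParam θ) x := fun x => by
    have := density_reflect θ.1 0 (symMat θ.2.1) θ.2.2 x
    rwa [add_zero, sub_zero] at this
  rw [info, integral_law_eq hθ]
  -- Lebesgue measure and the density are invariant under x ↦ 2μ - x, while the product of an even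
  -- and an odd score changes sign.
  have h2 := integral_sub_left_eq_self
    (fun x => density (toParam θ) x * (score θ x (0, z) * score θ x (l, 0))) volume
    ((2 : ℝ) • θ.1)
  have h3 : ∀ x, score θ x (-l, (0 : (VechIdx k → ℝ) × ℝ)) = -score θ x (l, 0) := fun x => by
    rw [← map_neg, Prod.neg_mk, neg_zero]
  simp only [h1, score_reflect hθ, neg_zero, h3, mul_neg, integral_neg] at h2
  linarith

end Reflection

section Nondegenerate

/-- The derivative of the inverse in a quadratic form. -/
lemma hasDerivAt_dotProduct_inv {S Z : Matrix (Fin k) (Fin k) ℝ} (hS : S.det ≠ 0)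
    (y : Fin k → ℝ) :
    HasDerivAt (fun t : ℝ => y ⬝ᵥ ((S + t • Z)⁻¹ *ᵥ y)) (-(y ⬝ᵥ ((S⁻¹ * Z * S⁻¹) *ᵥ y))) 0 := by
  have hent : ∀ i j, ContDiffAt ℝ 1 (fun t : ℝ => (S + t • Z) i j) 0 := fun i j => by
    simp only [Matrix.add_apply, Matrix.smul_apply, smul_eq_mul]
    fun_prop
  have hdet0 : (S + (0 : ℝ) • Z).det ≠ 0 := by simpa using hS
  -- By the resolvent identity (S + tZ)⁻¹ = S⁻¹ - t (S + tZ)⁻¹ Z S⁻¹ the quadratic form is its value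
  -- at 0 minus t g(t), with derivative -g(0) at 0.
  let g : ℝ → ℝ := fun t => y ⬝ᵥ ((S + t • Z)⁻¹ *ᵥ ((Z * S⁻¹) *ᵥ y))
  have hg : DifferentiableAt ℝ g 0 := by
    have : ContDiffAt ℝ 1 g 0 := by
      simp only [g, dotProduct, Matrix.mulVec]
      exact ContDiffAt.sum fun i _ => contDiffAt_const.mul (ContDiffAt.sum fun j _ =>
        (contDiffAt_inv_matrix hent hdet0 i j).mul contDiffAt_const)
    exact this.differentiableAt (by norm_num)
  have h1 := ((hasDerivAt_id (0 : ℝ)).mul hg.hasDerivAt).const_sub (y ⬝ᵥ (S⁻¹ *ᵥ y))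
  have h2 : g 0 = y ⬝ᵥ ((S⁻¹ * Z * S⁻¹) *ᵥ y) := by
    simp [g, Matrix.mul_assoc]
  simp only [id_eq, one_mul, zero_mul, add_zero, h2] at h1
  refine h1.congr_of_eventuallyEq ?_
  have hne : ∀ᶠ t in 𝓝 (0 : ℝ), (S + t • Z).det ≠ 0 :=
    (contDiffAt_det hent).continuousAt.eventually_ne hdet0
  filter_upwards [hne] with t ht
  have h3 : (S + t • Z)⁻¹ = S⁻¹ - t • ((S + t • Z)⁻¹ * (Z * S⁻¹)) := by
    have h4 : (S + t • Z)⁻¹ * (S + t • Z) = 1 := Matrix.nonsing_inv_mul _ (Ne.isUnit ht)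
    have h5 : S * S⁻¹ = 1 := Matrix.mul_nonsing_inv _ (Ne.isUnit hS)
    calc (S + t • Z)⁻¹ = (S + t • Z)⁻¹ * (S * S⁻¹) := by rw [h5, mul_one]
      _ = (S + t • Z)⁻¹ * (S + t • Z) * S⁻¹ - t • ((S + t • Z)⁻¹ * (Z * S⁻¹)) := by
        rw [Matrix.mul_assoc, Matrix.add_mul, Matrix.mul_add, Matrix.smul_mul, Matrix.mul_smul]
        abel
      _ = _ := by rw [h4, one_mul]
  simp only [Pi.mul_apply, id_eq, g]
  conv_lhs => rw [h3]
  rw [Matrix.sub_mulVec, Matrix.smul_mulVec, dotProduct_sub, dotProduct_smul, smul_eq_mul,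
    Matrix.mulVec_mulVec]

/-- The score in a direction of scatter and tail weight. -/
lemma exists_score_eq {θ : Coord k} (hθ : θ ∈ coordSpace k) (z : VechIdx k → ℝ) (b : ℝ) :
    ∃ c : ℝ, ∀ y : Fin k → ℝ, score θ (θ.1 + y) (0, z, b) =
      c - b / 2 * Real.log (1 + y ⬝ᵥ ((symMat θ.2.1)⁻¹ *ᵥ y) / θ.2.2) +
        (θ.2.2 + k) / 2 * ((θ.2.2 * (y ⬝ᵥ (((symMat θ.2.1)⁻¹ * symMat z * (symMat θ.2.1)⁻¹) *ᵥ y)) +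
          b * (y ⬝ᵥ ((symMat θ.2.1)⁻¹ *ᵥ y))) / θ.2.2 ^ 2 /
            (1 + y ⬝ᵥ ((symMat θ.2.1)⁻¹ *ᵥ y) / θ.2.2)) := by
  set S := symMat θ.2.1 with hS
  set ν := θ.2.2 with hν
  have hν0 : 0 < ν := hθ.2
  have hd : S.det ≠ 0 := hθ.1.det_pos.ne'
  have hdetC : ContDiffAt ℝ 1 (fun t : ℝ => (S + t • symMat z).det) 0 :=
    contDiffAt_det fun i j => by
      simp only [Matrix.add_apply, Matrix.smul_apply, smul_eq_mul]
      fun_prop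
  have hd0 : (S + (0 : ℝ) • symMat z).det ≠ 0 := by simpa using hd
  have hc1 : DifferentiableAt ℝ (fun t : ℝ => Real.log (normConst k (ν + t * b)) -
      1 / 2 * Real.log (S + t • symMat z).det) 0 := by
    have h1 : ContDiffAt ℝ 1 (fun t : ℝ => Real.log (normConst k (ν + t * b))) 0 := by
      have h2 : ContDiffAt ℝ 1 (fun t : ℝ => ν + t * b) 0 := by fun_prop
      refine ContDiffAt.comp (g := fun ν => Real.log (normConst k ν)) 0 ?_ h2
      exact contDiffAt_log_normConst (by simpa using hν0)
    exact (h1.sub (contDiffAt_const.mul (hdetC.log hd0))).differentiableAt (by norm_num)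
  -- The constant collects the normalizing factor and the determinant, the parts of the log-density
  -- that do not involve the observation.
  refine ⟨deriv (fun t : ℝ => Real.log (normConst k (ν + t * b)) -
    1 / 2 * Real.log (S + t • symMat z).det) 0, fun y => (hasDerivAt_log_density hθ (θ.1 + y) (0, z, b)).unique ?_⟩
  set q := y ⬝ᵥ (S⁻¹ *ᵥ y) with hq
  set w := y ⬝ᵥ ((S⁻¹ * symMat z * S⁻¹) *ᵥ y) with hw
  have hq0 : 0 ≤ q := by
    have := hθ.1.inv.posSemidef.dotProduct_mulVec_nonneg y
    rwa [star_trivial] at this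
  have h1 : HasDerivAt (fun t : ℝ => y ⬝ᵥ ((S + t • symMat z)⁻¹ *ᵥ y)) (-w) 0 :=
    hasDerivAt_dotProduct_inv hd y
  have h2 : HasDerivAt (fun t : ℝ => ν + t * b) b 0 := by
    simpa using ((hasDerivAt_id (0 : ℝ)).mul_const b).const_add ν
  have hpos : 0 < 1 + q / ν := by positivity
  have h3 := (h1.div h2 (by simpa using hν0.ne')).const_add 1
  have h4 := h3.log (by simpa using hpos.ne')
  have h5 := ((h2.add_const (k : ℝ)).div_const 2).mul h4
  have h6 := hc1.hasDerivAt.sub h5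
  refine (h6.congr_of_eventuallyEq ?_).congr_deriv ?_
  · have h7 : Tendsto (fun t : ℝ => θ + t • ((0, z, b) : Coord k)) (𝓝 0) (𝓝 θ) := by
      have : Continuous fun t : ℝ => θ + t • ((0, z, b) : Coord k) := by fun_prop
      simpa using this.tendsto 0
    filter_upwards [h7.eventually (isOpen_coordSpace.eventually_mem hθ)] with t ht
    have k1 := one_add_sqMahalanobis_pos ht (θ.1 + y)
    have k2 := normConst_pos (k := k) ht.2
    have k3 := ht.1.det_pos
    rw [density, Real.log_mul (mul_pos k2 (Real.rpow_pos_of_pos k3 _)).ne'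
      (Real.rpow_pos_of_pos k1 _).ne', Real.log_mul k2.ne' (Real.rpow_pos_of_pos k3 _).ne',
      Real.log_rpow k3, Real.log_rpow k1]
    simp only [toParam, sqMahalanobis, Prod.fst_add, Prod.snd_add, Prod.smul_fst, Prod.smul_snd,
      smul_zero, add_zero, add_sub_cancel_left, symMat_add, symMat_smul, smul_eq_mul, ← hS, ← hν,
      Pi.sub_apply, Pi.mul_apply, Pi.div_apply]
    ring
  · simp only [Pi.div_apply, zero_mul, zero_smul, add_zero, ← hq]
    ring

lemma eq_zero_of_isSymm_of_dotProduct {Z : Matrix (Fin k) (Fin k) ℝ} (hZ : Z.IsSymm)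
    (h : ∀ y : Fin k → ℝ, y ⬝ᵥ (Z *ᵥ y) = 0) : Z = 0 := by
  ext i j
  have h1 := h (Pi.single i 1 + Pi.single j 1)
  have h2 := h (Pi.single i 1)
  have h3 := h (Pi.single j 1)
  have h4 := hZ.apply i j
  simp only [Matrix.mulVec_add, add_dotProduct, dotProduct_add, Matrix.mulVec_single_one,
    single_one_dotProduct, Matrix.col_apply] at h1 h2 h3
  simp only [Matrix.zero_apply]
  linarith

/-- The points τ = 1 and τ = 3 suffice: log 4 = 2 log 2, whereas τ / (1 + τ) takes the values 1/2
and 3/4. -/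
lemma eq_zero_of_mul_log_eq {b C : ℝ}
    (h : ∀ τ : ℝ, 0 ≤ τ → b * Real.log (1 + τ) = C * (τ / (1 + τ))) : b = 0 ∧ C = 0 := by
  have h1 := h 1 zero_le_one
  have h3 := h 3 (by norm_num)
  have h4 : Real.log (1 + 3) = 2 * Real.log (1 + 1) := by
    rw [show (1 + 3 : ℝ) = (1 + 1) ^ 2 by norm_num, Real.log_pow]
    norm_num
  have h5 : 0 < Real.log (1 + 1) := Real.log_pos (by norm_num)
  rw [h4] at h3
  generalize Real.log (1 + 1) = l at h1 h3 h5
  have h6 : b * l = 0 := by linarith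
  have hb : b = 0 := (mul_eq_zero.1 h6).resolve_right h5.ne'
  refine ⟨hb, ?_⟩
  rw [hb] at h1
  linarith

/-- The score vanishes identically in no direction of scatter and tail weight. -/
lemma eq_zero_of_score_eq_zero [NeZero k] {θ : Coord k} (hθ : θ ∈ coordSpace k)
    {z : VechIdx k → ℝ} {b : ℝ} (h : ∀ x, score θ x (0, z, b) = 0) : z = 0 ∧ b = 0 := by
  obtain ⟨c, hc⟩ := exists_score_eq hθ z b
  set S := symMat θ.2.1 with hS
  set ν := θ.2.2 with hν
  have hν0 : 0 < ν := hθ.2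
  -- At the centre y = 0 every other term of the score vanishes.
  have hc0 : c = 0 := by
    have := hc 0
    rw [h] at this
    simpa using this.symm
  set w : (Fin k → ℝ) → ℝ := fun y => y ⬝ᵥ ((S⁻¹ * symMat z * S⁻¹) *ᵥ y) with hw
  have key : ∀ y : Fin k → ℝ, y ≠ 0 → b = 0 ∧ w y = 0 := by
    intro y hy
    set q := y ⬝ᵥ (S⁻¹ *ᵥ y) with hq
    have hq0 : 0 < q := by
      have := hθ.1.inv.dotProduct_mulVec_pos hy
      rwa [star_trivial] at this
    have h1 : ∀ τ : ℝ, 0 ≤ τ → b * Real.log (1 + τ) =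
        ((ν + k) * ((ν * w y + b * q) / (ν * q))) * (τ / (1 + τ)) := by
      intro τ hτ
      -- The point on the ray through y at which the quadratic form divided by ν equals τ.
      have h2 := hc (√(τ * ν / q) • y)
      have h3 : √(τ * ν / q) * √(τ * ν / q) = τ * ν / q := Real.mul_self_sqrt (by positivity)
      rw [h, hc0] at h2
      simp only [Matrix.mulVec_smul, smul_dotProduct, dotProduct_smul, smul_eq_mul,
        ← mul_assoc, h3, ← hq] at h2
      have h4 : τ * ν / q * q / ν = τ := by field_simp
      rw [h4] at h2
      change 0 = 0 - b / 2 * Real.log (1 + τ) + (ν + k) / 2 *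
        ((ν * (τ * ν / q) * w y + b * (τ * ν / q) * q) / ν ^ 2 / (1 + τ)) at h2
      have h5 : (ν * (τ * ν / q) * w y + b * (τ * ν / q) * q) / ν ^ 2 =
          (ν * w y + b * q) / (ν * q) * τ := by field_simp
      rw [h5] at h2
      have h6 : (ν * w y + b * q) / (ν * q) * τ / (1 + τ) =
          (ν * w y + b * q) / (ν * q) * (τ / (1 + τ)) := by ring
      rw [h6] at h2
      linarith
    obtain ⟨hb, h2⟩ := eq_zero_of_mul_log_eq h1
    refine ⟨hb, ?_⟩
    have h3 : (ν + k) ≠ 0 := by positivity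
    have h4 := (mul_eq_zero.1 h2).resolve_left h3
    rw [hb, zero_mul, add_zero, div_eq_zero_iff] at h4
    rcases h4 with h4 | h4
    · exact (mul_eq_zero.1 h4).resolve_left hν0.ne'
    · exact absurd h4 (by positivity)
  have hy1 : (Pi.single (0 : Fin k) (1 : ℝ) : Fin k → ℝ) ≠ 0 := by simp
  refine ⟨symMat_eq_zero (eq_zero_of_isSymm_of_dotProduct (symMat_isSymm z) fun r => ?_),
    (key _ hy1).1⟩
  -- The test vector y = S r turns the form of S⁻¹ Z S⁻¹ at y into that of Z at r; `key` needs it to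
  -- be nonzero.
  by_cases hr : S *ᵥ r = 0
  · have : r = 0 := by
      have h1 : S⁻¹ * S = 1 := Matrix.nonsing_inv_mul _ (Ne.isUnit hθ.1.det_pos.ne')
      rw [← Matrix.one_mulVec r, ← h1, ← Matrix.mulVec_mulVec, hr, Matrix.mulVec_zero]
    simp [this]
  · have h1 := (key _ hr).2
    have h2 : S⁻¹ * S = 1 := Matrix.nonsing_inv_mul _ (Ne.isUnit hθ.1.det_pos.ne')
    have h3 : S * S⁻¹ = 1 := Matrix.mul_nonsing_inv _ (Ne.isUnit hθ.1.det_pos.ne')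
    have h4 : Sᵀ = S := symMat_isSymm _
    simp only [hw] at h1
    rw [Matrix.mulVec_mulVec, Matrix.mul_assoc _ S⁻¹ S, h2, mul_one, dotProduct_comm,
      Matrix.dotProduct_mulVec, ← Matrix.mulVec_transpose, h4, Matrix.mulVec_mulVec,
      ← Matrix.mul_assoc, h3, one_mul, dotProduct_comm] at h1
    exact h1

lemma continuous_score {θ : Coord k} (hθ : θ ∈ coordSpace k) (v : Coord k) :
    Continuous fun x => score θ x v := by
  have := (continuous_partialD_comp (fun u hu => contDiffAt_logLik hθ hu) continuous_direction
    direction_mem).add continuous_linearPart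
  exact this.clm_apply continuous_const

/-- Zero information makes the score vanish almost surely, hence Lebesgue-almost everywhere as the
density is positive, hence everywhere by continuity. -/
lemma info_pos [NeZero k] {θ : Coord k} (hθ : θ ∈ coordSpace k) {z : VechIdx k → ℝ} {b : ℝ}
    (h : ¬ (z = 0 ∧ b = 0)) : 0 < info (law (toParam θ)) (score θ) (0, z, b) (0, z, b) := by
  have := isProbabilityMeasure_law hθ
  have h0 : 0 ≤ᵐ[law (toParam θ)] fun x => score θ x (0, z, b) * score θ x (0, z, b) :=
    Eventually.of_forall fun x => mul_self_nonneg _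
  refine lt_of_le_of_ne (integral_nonneg_of_ae h0) fun heq => h ?_
  refine eq_zero_of_score_eq_zero hθ fun x => ?_
  have h1 := (integral_eq_zero_iff_of_nonneg_ae h0
    ((localModel hθ).integrable_score_mul _ _)).1 heq.symm
  have h2 : (fun x => score θ x (0, z, b)) =ᵐ[volume] fun _ => 0 := by
    rw [law, Filter.EventuallyEq,
      ae_withDensity_iff (measurable_density _).ennreal_ofReal] at h1
    filter_upwards [h1] with x hx
    have := hx (by simpa using density_pos hθ x)
    simpa using this
  exact congrFun ((continuous_score hθ _).ae_eq_iff_eq volume continuous_const |>.1 h2) x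

end Nondegenerate

end

end StudentT

/-! ### The efficient direction, continuity in the parameter and the one-step estimator. -/

namespace StudentT

section

variable {k : ℕ}

section EfficientDirection

/-- The direction of the efficient score for tail weight. -/
def effDir (θ : Coord k) : Coord k :=
  (0, -((infoSS (toParam θ))⁻¹ *ᵥ infoST (toParam θ)), 1)

lemma mk_eq_sum (z : VechIdx k → ℝ) (b : ℝ) :
    ((0, z, b) : Coord k) = ∑ p, z p • scatterDir p + b • tailDir k := by
  have h : ∑ p, z p • scatterDir p = ((0, z, 0) : Coord k) := by
    ext j
    · simp [scatterDir, Prod.fst_sum]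
    · simp [scatterDir, Prod.fst_sum, Prod.snd_sum, Pi.single_apply]
    · simp [scatterDir, Prod.snd_sum]
  rw [h]
  simp [tailDir]

lemma info_add_left {θ : Coord k} (hθ : θ ∈ coordSpace k) (u v w : Coord k) :
    info (law (toParam θ)) (score θ) (u + v) w =
      info (law (toParam θ)) (score θ) u w + info (law (toParam θ)) (score θ) v w := by
  have := isProbabilityMeasure_law hθ
  have M := localModel hθ
  simp only [info, map_add, add_mul]
  exact integral_add (M.integrable_score_mul u w) (M.integrable_score_mul v w)

lemma info_mk_left {θ : Coord k} (hθ : θ ∈ coordSpace k) (z : VechIdx k → ℝ) (b : ℝ)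
    (w : Coord k) :
    info (law (toParam θ)) (score θ) (0, z, b) w =
      ∑ p, z p * info (law (toParam θ)) (score θ) (scatterDir p) w +
        b * info (law (toParam θ)) (score θ) (tailDir k) w := by
  rw [mk_eq_sum, info_add_left hθ, (localModel hθ).info_sum_smul]
  congr 1
  simpa using (localModel hθ).info_sum_smul (Finset.univ : Finset Unit) (fun _ => b)
    (fun _ => tailDir k) w

lemma infoSS_isSymm {θ : Coord k} (hθ : θ ∈ coordSpace k) : (infoSS (toParam θ))ᵀ =
    infoSS (toParam θ) := by
  ext p q
  rw [Matrix.transpose_apply, infoSS_eq hθ, infoSS_eq hθ, info_comm]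

lemma infoSS_posDef [NeZero k] {θ : Coord k} (hθ : θ ∈ coordSpace k) :
    (infoSS (toParam θ)).PosDef := by
  refine Matrix.PosDef.of_dotProduct_mulVec_pos ?_ fun z hz => ?_
  · rw [Matrix.IsHermitian, Matrix.conjTranspose_eq_transpose_of_trivial]
    exact infoSS_isSymm hθ
  · have h1 := info_pos hθ (z := z) (b := 0) fun h => hz h.1
    rw [info_mk_left hθ] at h1
    rw [star_trivial]
    refine h1.trans_eq ?_
    simp only [dotProduct, zero_mul, add_zero, Matrix.mulVec]
    refine Finset.sum_congr rfl fun p _ => ?_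
    rw [info_comm, info_mk_left hθ, zero_mul, add_zero]
    congr 1
    refine Finset.sum_congr rfl fun q _ => ?_
    rw [infoSS_eq hθ, mul_comm, info_comm]

/-- These are the normal equations: the score along `effDir` is the residual of the tail score after
projection on the scatter scores. -/
lemma info_scatterDir_effDir [NeZero k] {θ : Coord k} (hθ : θ ∈ coordSpace k) (p : VechIdx k) :
    info (law (toParam θ)) (score θ) (scatterDir p) (effDir θ) = 0 := by
  have h1 : infoSS (toParam θ) * (infoSS (toParam θ))⁻¹ = 1 :=
    Matrix.mul_nonsing_inv _ (Ne.isUnit (infoSS_posDef hθ).det_pos.ne')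
  have h2 : (infoSS (toParam θ) *ᵥ ((infoSS (toParam θ))⁻¹ *ᵥ infoST (toParam θ))) p =
      infoST (toParam θ) p := by
    rw [Matrix.mulVec_mulVec, h1, Matrix.one_mulVec]
  rw [info_comm, effDir, info_mk_left hθ, one_mul, info_comm _ _ (tailDir k), ← infoST_eq hθ, ← h2]
  simp only [Matrix.mulVec, dotProduct, Pi.neg_apply, neg_mul, Finset.sum_neg_distrib]
  rw [neg_add_eq_zero]
  refine Finset.sum_congr rfl fun q _ => ?_
  rw [infoSS_eq hθ, info_comm, mul_comm]

lemma info_tailDir_effDir {θ : Coord k} (hθ : θ ∈ coordSpace k) :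
    info (law (toParam θ)) (score θ) (tailDir k) (effDir θ) = effInfo (toParam θ) := by
  rw [info_comm, effDir, info_mk_left hθ, one_mul, ← infoTT_eq hθ, effInfo, add_comm,
    sub_eq_add_neg]
  congr 1
  simp only [dotProduct, Pi.neg_apply, neg_mul, Finset.sum_neg_distrib]
  congr 1
  refine Finset.sum_congr rfl fun q _ => ?_
  rw [← infoST_eq hθ, mul_comm]

/-- The efficient score is orthogonal to location and scatter. -/
lemma info_effDir [NeZero k] {θ : Coord k} (hθ : θ ∈ coordSpace k) (h : Coord k) :
    info (law (toParam θ)) (score θ) (effDir θ) h = effInfo (toParam θ) * tailCoord k h := by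
  obtain ⟨l, z, b⟩ := h
  have h1 : ((l, z, b) : Coord k) = (l, 0) + (0, z, b) := by simp
  rw [info_comm, h1, info_add_left hθ, info_comm _ _ (l, 0), effDir, info_location hθ, ← effDir,
    info_mk_left hθ, info_tailDir_effDir hθ]
  simp [info_scatterDir_effDir hθ, mul_comm]

lemma info_effDir_self [NeZero k] {θ : Coord k} (hθ : θ ∈ coordSpace k) :
    info (law (toParam θ)) (score θ) (effDir θ) (effDir θ) = effInfo (toParam θ) := by
  rw [info_effDir hθ]
  simp [effDir]

lemma effInfo_pos [NeZero k] {θ : Coord k} (hθ : θ ∈ coordSpace k) : 0 < effInfo (toParam θ) := by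
  rw [← info_effDir_self hθ]
  exact info_pos hθ fun h => one_ne_zero h.2

/-- Symmetry of `infoSS` moves its inverse to the other side of the dot product, so the projection
becomes a direction in the parameter space and the results on local models apply. -/
lemma effCentral_eq {θ : Coord k} (hθ : θ ∈ coordSpace k) {n : ℕ} (x : Sample k n) :
    effCentral (toParam θ) x = centralSeq (score θ) x (effDir θ) := by
  have h1 : ∀ p, centralScatter (toParam θ) x p = centralSeq (score θ) x (scatterDir p) :=
    fun p => by
      rw [centralSeq_apply]
      simp [centralScatter, scoreScatter_eq hθ]
  have h2 : centralTail (toParam θ) x = centralSeq (score θ) x (tailDir k) := by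
    rw [centralSeq_apply, centralTail]
    simp only [scoreTail_eq hθ]
  have h3 : infoST (toParam θ) ⬝ᵥ ((infoSS (toParam θ))⁻¹ *ᵥ centralScatter (toParam θ) x) =
      ((infoSS (toParam θ))⁻¹ *ᵥ infoST (toParam θ)) ⬝ᵥ centralScatter (toParam θ) x := by
    rw [Matrix.dotProduct_mulVec, ← Matrix.mulVec_transpose, Matrix.transpose_nonsing_inv,
      infoSS_isSymm hθ]
  rw [effCentral, h3, h2, effDir, mk_eq_sum, map_add, map_sum, one_smul]
  simp only [map_smul, dotProduct, h1, smul_eq_mul, Pi.neg_apply, neg_mul, Finset.sum_neg_distrib]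
  ring

end EfficientDirection

section Continuity

lemma tendsto_sub_nhds_zero (θ : Coord k) : Tendsto (fun η => η - θ) (𝓝 θ) (𝓝 0) := by
  simpa using (tendsto_id (x := 𝓝 θ)).sub_const θ

lemma continuousAt_info {θ : Coord k} (hθ : θ ∈ coordSpace k) (v w : Coord k) :
    ContinuousAt (fun η => info (law (toParam η)) (score η) v w) θ := by
  have := isProbabilityMeasure_law hθ
  have h1 := (localModel hθ).tendsto_info (S := fun h => score (θ + h))
    (eventually_norm_score_sub_le hθ) ((eventually_add_mem hθ).mono fun h hh v =>
      (continuous_score hh v).measurable) v w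
  refine (h1.comp (tendsto_sub_nhds_zero θ)).congr' ?_
  filter_upwards [isOpen_coordSpace.eventually_mem hθ] with η hη
  have h2 : θ + (η - θ) = η := by abel
  have h3 := law_add (h := η - θ) hθ (by rwa [h2])
  rw [h2] at h3
  simp only [Function.comp_apply, h2, h3]

lemma continuousAt_infoSS {θ : Coord k} (hθ : θ ∈ coordSpace k) :
    ContinuousAt (fun η : Coord k => infoSS (toParam η)) θ := by
  refine continuousAt_pi.2 fun p => continuousAt_pi.2 fun q => ?_
  refine (continuousAt_info hθ (scatterDir p) (scatterDir q)).congr ?_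
  filter_upwards [isOpen_coordSpace.eventually_mem hθ] with η hη
  exact (infoSS_eq hη p q).symm

lemma continuousAt_infoST {θ : Coord k} (hθ : θ ∈ coordSpace k) :
    ContinuousAt (fun η : Coord k => infoST (toParam η)) θ := by
  refine continuousAt_pi.2 fun p => ?_
  refine (continuousAt_info hθ (scatterDir p) (tailDir k)).congr ?_
  filter_upwards [isOpen_coordSpace.eventually_mem hθ] with η hη
  exact (infoST_eq hη p).symm

lemma continuousAt_infoTT {θ : Coord k} (hθ : θ ∈ coordSpace k) :
    ContinuousAt (fun η : Coord k => infoTT (toParam η)) θ := by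
  refine (continuousAt_info hθ (tailDir k) (tailDir k)).congr ?_
  filter_upwards [isOpen_coordSpace.eventually_mem hθ] with η hη
  exact (infoTT_eq hη).symm

lemma continuousAt_infoSS_inv_mulVec [NeZero k] {θ : Coord k} (hθ : θ ∈ coordSpace k) :
    ContinuousAt (fun η : Coord k => (infoSS (toParam η))⁻¹ *ᵥ infoST (toParam η)) θ := by
  have h0 : (infoSS (toParam θ)).det ≠ 0 := (infoSS_posDef hθ).det_pos.ne'
  have h1 : ContinuousAt (fun η : Coord k => (infoSS (toParam η))⁻¹) θ := by
    refine ContinuousAt.comp (g := Inv.inv) (continuousAt_matrix_inv _ ?_)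
      (continuousAt_infoSS hθ)
    rw [Ring.inverse_eq_inv']
    exact continuousAt_inv₀ h0
  have h2 : Continuous fun q : Matrix (VechIdx k) (VechIdx k) ℝ × (VechIdx k → ℝ) =>
      q.1 *ᵥ q.2 := by fun_prop
  exact h2.continuousAt.comp (h1.prodMk (continuousAt_infoST hθ))

lemma continuousAt_effDir [NeZero k] {θ : Coord k} (hθ : θ ∈ coordSpace k) :
    ContinuousAt effDir θ :=
  continuousAt_const.prodMk
    ((continuousAt_infoSS_inv_mulVec hθ).neg.prodMk continuousAt_const)

lemma continuousAt_effInfo [NeZero k] {θ : Coord k} (hθ : θ ∈ coordSpace k) :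
    ContinuousAt (fun η : Coord k => effInfo (toParam η)) θ := by
  have h2 : Continuous fun q : (VechIdx k → ℝ) × (VechIdx k → ℝ) => q.1 ⬝ᵥ q.2 := by fun_prop
  exact (continuousAt_infoTT hθ).sub (h2.continuousAt.comp
    ((continuousAt_infoST hθ).prodMk (continuousAt_infoSS_inv_mulVec hθ)))

lemma continuousAt_score {θ : Coord k} (hθ : θ ∈ coordSpace k) (x : Fin k → ℝ) :
    ContinuousAt (fun q : Coord k × (Fin k → ℝ) => score q.1 q.2) (θ, x) := by
  have h1 : ContinuousAt (fun q : Coord k × (Fin k → ℝ) => (q.1, direction q.2)) (θ, x) :=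
    (continuous_fst.prodMk (continuous_direction.comp continuous_snd)).continuousAt
  have h2 : ContinuousAt (fun q : Coord k × (Fin k → ℝ) => partialD logLik (q.1, direction q.2))
      (θ, x) :=
    ContinuousAt.comp_of_eq
      (contDiffAt_partialD (contDiffAt_logLik hθ (direction_mem x))).continuousAt h1 rfl
  exact h2.add (continuous_linearPart.comp continuous_snd).continuousAt

end Continuity

section OneStep

variable {locEst : ∀ n, Sample k n → Fin k → ℝ}
  {scatEst : ∀ n, Sample k n → Matrix (Fin k) (Fin k) ℝ} {tailEst : ∀ n, Sample k n → ℝ}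

/-- The coordinates of the preliminary estimator. -/
def prelim (locEst : ∀ n, Sample k n → Fin k → ℝ)
    (scatEst : ∀ n, Sample k n → Matrix (Fin k) (Fin k) ℝ) (tailEst : ∀ n, Sample k n → ℝ)
    (n : ℕ) (x : Sample k n) : Coord k := (locEst n x, vech (scatEst n x), tailEst n x)

lemma toParam_prelim (scat_symm : ∀ n x, (scatEst n x).IsSymm) (n : ℕ) (x : Sample k n) :
    toParam (prelim locEst scatEst tailEst n x) = (locEst n x, scatEst n x, tailEst n x) := by
  simp [toParam, prelim, symMat_vech (scat_symm n x)]

open Classical in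
lemma oneStep_eq (scat_symm : ∀ n x, (scatEst n x).IsSymm) (n : ℕ) (x : Sample k n) :
    oneStep locEst scatEst tailEst n x = tailEst n x + (√(n : ℝ))⁻¹ *
      {q : Coord k × Sample k n | q.1 ∈ coordSpace k}.piecewise
        (fun q => (effInfo (toParam q.1))⁻¹ * centralSeq (score q.1) q.2 (effDir q.1)) 0
        (prelim locEst scatEst tailEst n x, x) := by
  by_cases h : prelim locEst scatEst tailEst n x ∈ coordSpace k
  · rw [Set.piecewise_eq_of_mem _ _ _ (by exact h), ← effCentral_eq h,
      toParam_prelim scat_symm, oneStep, if_pos]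
    rwa [coordSpace, Set.mem_ofPred_eq, toParam_prelim scat_symm] at h
  · rw [Set.piecewise_eq_of_notMem _ _ _ (by exact h), oneStep, if_neg]
    · simp
    · rwa [coordSpace, Set.mem_ofPred_eq, toParam_prelim scat_symm] at h

/-- The correction is a function of (preliminary estimate, sample), jointly continuous on the open
set where the estimate is a parameter and zero elsewhere. -/
lemma measurable_oneStep [NeZero k] (loc_meas : ∀ n, Measurable (locEst n))
    (scat_meas : ∀ n i j, Measurable fun x => scatEst n x i j)
    (tail_meas : ∀ n, Measurable (tailEst n)) (scat_symm : ∀ n x, (scatEst n x).IsSymm) (n : ℕ) :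
    Measurable (oneStep locEst scatEst tailEst n) := by
  classical
  have h1 : Measurable (prelim locEst scatEst tailEst n) :=
    (loc_meas n).prodMk ((measurable_pi_lambda _ fun p : VechIdx k => scat_meas n p.1.1 p.1.2).prodMk
      (tail_meas n))
  have hopen : IsOpen {q : Coord k × Sample k n | q.1 ∈ coordSpace k} :=
    isOpen_coordSpace.preimage continuous_fst
  have h2 : ContinuousOn (fun q : Coord k × Sample k n =>
      (effInfo (toParam q.1))⁻¹ * centralSeq (score q.1) q.2 (effDir q.1))
      {q | q.1 ∈ coordSpace k} := by
    rintro ⟨θ, x⟩ hθ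
    refine ContinuousAt.continuousWithinAt ?_
    have k1 : ContinuousAt (fun q : Coord k × Sample k n => (effInfo (toParam q.1))⁻¹) (θ, x) :=
      (ContinuousAt.comp_of_eq (continuousAt_effInfo hθ) continuousAt_fst rfl).inv₀
        (effInfo_pos hθ).ne'
    have k2 : ContinuousAt (fun q : Coord k × Sample k n => effDir q.1) (θ, x) :=
      ContinuousAt.comp_of_eq (g := effDir) (continuousAt_effDir hθ) continuousAt_fst rfl
    simp only [centralSeq_apply]
    refine k1.mul (continuousAt_const.mul (tendsto_finsetSum _ fun i _ => ?_))
    have k3 : ContinuousAt (fun q : Coord k × Sample k n => (q.1, q.2 i)) (θ, x) := by fun_prop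
    exact (ContinuousAt.comp_of_eq (continuousAt_score hθ (x i)) k3 rfl).clm_apply k2
  have h3 := h2.measurable_piecewise (g := 0) continuousOn_const hopen.measurableSet
  rw [funext (oneStep_eq scat_symm n)]
  exact (tail_meas n).add ((h3.comp (h1.prodMk measurable_id)).const_mul _)

lemma RootNConsistent.boundedInProb {F : Type*} [PseudoMetricSpace F]
    {est : ∀ n, Sample k n → F} {g : Param k → F} (h : RootNConsistent est g) {V : Param k}
    (hV : V ∈ paramSpace k) :
    BoundedInProb (fun n => Measure.pi fun _ : Fin n => law V)
      fun z => √(z.1 : ℝ) * dist (est z.1 z.2) (g V) := fun ε hε => by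
  obtain ⟨C, hC⟩ := h V hV ε hε
  refine ⟨C, hC.mono fun n hn => le_trans (measure_mono fun x hx => ?_) hn⟩
  rw [Set.mem_ofPred_eq, abs_of_nonneg (by positivity)] at hx
  exact hx

lemma boundedInProb_prelim {θ : Coord k} (hθ : θ ∈ coordSpace k)
    (loc_root : RootNConsistent locEst fun V => V.1)
    (scat_root : RootNConsistent (F := Fin k → Fin k → ℝ)
      (fun n x i j => scatEst n x i j) fun V i j => V.2.1 i j)
    (tail_root : RootNConsistent tailEst fun V => V.2.2) :
    BoundedInProb (fun n => Measure.pi fun _ : Fin n => law (toParam θ))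
      fun z => √(z.1 : ℝ) * ‖prelim locEst scatEst tailEst z.1 z.2 - θ‖ := by
  refine (((loc_root.boundedInProb hθ).add (scat_root.boundedInProb hθ)).add
    (tail_root.boundedInProb hθ)).mono fun z => ?_
  rw [abs_of_nonneg (by positivity), abs_of_nonneg (by positivity), ← mul_add, ← mul_add]
  refine mul_le_mul_of_nonneg_left ?_ (Real.sqrt_nonneg _)
  have h1 := dist_nonneg (x := locEst z.1 z.2) (y := (toParam θ).1)
  have h2 := dist_nonneg (x := fun i j => scatEst z.1 z.2 i j)
    (y := fun i j => (toParam θ).2.1 i j)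
  have h3 := dist_nonneg (x := tailEst z.1 z.2) (y := (toParam θ).2.2)
  rw [Prod.norm_def, Prod.norm_def, max_le_iff, max_le_iff]
  refine ⟨?_, ?_, ?_⟩
  · rw [Prod.fst_sub, ← dist_eq_norm]
    simp only [prelim, toParam] at *
    linarith
  · refine le_trans ((pi_norm_le_iff_of_nonneg h2).2 fun p => ?_) (by linarith)
    have h4 := (dist_le_pi_dist (fun j => scatEst z.1 z.2 p.1.1 j)
      (fun j => (toParam θ).2.1 p.1.1 j) p.1.2).trans
      (dist_le_pi_dist (fun i j => scatEst z.1 z.2 i j) (fun i j => (toParam θ).2.1 i j) p.1.1)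
    refine le_trans (le_of_eq ?_) h4
    have h5 : (toParam θ).2.1 p.1.1 p.1.2 = θ.2.1 p := by
      simp [toParam, symMat, vechIdx, min_eq_left p.2, max_eq_right p.2]
    rw [h5, dist_eq_norm]
    rfl
  · rw [Prod.snd_sub, Prod.snd_sub, ← dist_eq_norm]
    simp only [prelim, toParam] at *
    linarith

/-- The one-step estimator is asymptotically linear, with the efficient influence function. -/
lemma tendsto_oneStep_sub_centralSeq [NeZero k] {θ : Coord k} (hθ : θ ∈ coordSpace k)
    (scat_symm : ∀ n x, (scatEst n x).IsSymm)
    (loc_root : RootNConsistent locEst fun V => V.1)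
    (scat_root : RootNConsistent (F := Fin k → Fin k → ℝ)
      (fun n x i j => scatEst n x i j) fun V i j => V.2.1 i j)
    (tail_root : RootNConsistent tailEst fun V => V.2.2) :
    Tendsto (fun z : Σ n, Sample k n =>
      √(z.1 : ℝ) * (oneStep locEst scatEst tailEst z.1 z.2 - θ.2.2) -
        (effInfo (toParam θ))⁻¹ * centralSeq (score θ) z.2 (effDir θ))
      (whp fun n => Measure.pi fun _ : Fin n => law (toParam θ)) (𝓝 0) := by
  classical
  have := isProbabilityMeasure_law hθ
  set d : (Σ n, Sample k n) → Coord k := fun z => prelim locEst scatEst tailEst z.1 z.2 - θ with hd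
  have hdb := boundedInProb_prelim hθ loc_root scat_root tail_root
  have hd0 : Tendsto d (whp fun n => Measure.pi fun _ : Fin n => law (toParam θ)) (𝓝 0) :=
    tendsto_zero_iff_norm_tendsto_zero.2 hdb.tendsto_div_sqrt
  have hadd : ∀ z, θ + d z = prelim locEst scatEst tailEst z.1 z.2 := fun z =>
    add_sub_cancel θ _
  have hθd : Tendsto (fun z => θ + d z)
      (whp fun n => Measure.pi fun _ : Fin n => law (toParam θ)) (𝓝 θ) := by
    simpa using hd0.const_add θ
  have h1 := (localModel hθ).tendsto_oneStep_sub (S := fun h => score (θ + h))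
    (eventually_norm_score_sub_le hθ) (effInfo_pos hθ) (info_effDir hθ) hdb
    ((continuousAt_effDir hθ).tendsto.comp hθd) ((continuousAt_effInfo hθ).tendsto.comp hθd)
  refine h1.congr' ?_
  -- The parameter space is open in the coordinates, so with probability tending to one the
  -- preliminary estimate lies in it and the default branch is not used.
  filter_upwards [hd0.eventually (eventually_add_mem hθ),
    tendsto_fst_whp.eventually (eventually_gt_atTop 0)] with z hz hn
  have hs : √(z.1 : ℝ) ≠ 0 := (Real.sqrt_pos.2 (by exact_mod_cast hn)).ne'
  rw [hadd] at hz
  rw [oneStep_eq scat_symm, Set.piecewise_eq_of_mem _ _ _ (by exact hz)]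
  have h2 : tailCoord k (prelim locEst scatEst tailEst z.1 z.2 - θ) =
      tailEst z.1 z.2 - θ.2.2 := rfl
  simp only [Function.comp_apply, hadd, h2]
  have h3 : ∀ a : ℝ, √(z.1 : ℝ) * (tailEst z.1 z.2 + (√(z.1 : ℝ))⁻¹ * a - θ.2.2) =
      √(z.1 : ℝ) * (tailEst z.1 z.2 - θ.2.2) + a := fun a => by
    field_simp
    ring
  rw [h3]
  simp only [add_sub_cancel]

end OneStep

section Local

lemma localParam_toParam (θ : Coord k) {h : Param k} (hh : h.2.1.IsSymm) (n : ℕ) :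
    localParam (toParam θ) h n = toParam (θ + (√(n : ℝ))⁻¹ • coord h) := by
  conv_lhs => rw [← toParam_coord hh]
  rfl

/-- Convergence in law under the local perturbations of a parameter. -/
lemma tendstoLaw_localParam_iff {θ : Coord k} (hθ : θ ∈ coordSpace k) {h : Param k}
    (hh : h.2.1.IsSymm) (T : ∀ n, Sample k n → ℝ) (L : Measure ℝ) :
    TendstoLaw (fun n => sampleLaw n (localParam (toParam θ) h n))
        (fun n x => √(n : ℝ) * (T n x - (localParam (toParam θ) h n).2.2)) L ↔
      TendstoLaw (fun n => localLaw (law (toParam θ)) (logLikRatio θ) (coord h) n)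
        (fun n x => √(n : ℝ) * (T n x - θ.2.2) - h.2.2) L := by
  refine forall_congr' fun f => tendsto_congr' ?_
  filter_upwards [(tendsto_inv_sqrt_nat_smul (coord h)).eventually (eventually_add_mem hθ),
    eventually_gt_atTop 0] with n hn hn0
  have hs : √(n : ℝ) ≠ 0 := (Real.sqrt_pos.2 (by exact_mod_cast hn0)).ne'
  have h1 : sampleLaw n (localParam (toParam θ) h n) =
      localLaw (law (toParam θ)) (logLikRatio θ) (coord h) n := by
    rw [sampleLaw, localParam_toParam θ hh, law_add hθ hn, localLaw]
  have h2 : (localParam (toParam θ) h n).2.2 = θ.2.2 + (√(n : ℝ))⁻¹ * h.2.2 := rfl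
  rw [h1, h2]
  congr 1
  ext x
  congr 1
  field_simp
  ring

lemma coord_toParam (θ : Coord k) : coord (toParam θ) = θ := by
  refine Prod.ext rfl (Prod.ext ?_ rfl)
  ext p
  simp [coord, toParam, vech, symMat, vechIdx, min_eq_left p.2, max_eq_right p.2]

/-- The limit laws of regular estimators of tail weight are convolutions. -/
lemma IsRegularAt.exists_eq_conv [NeZero k] {θ : Coord k} (hθ : θ ∈ coordSpace k)
    {T : ∀ n, Sample k n → ℝ} {L : Measure ℝ} [IsProbabilityMeasure L]
    (hT : IsRegularAt T (toParam θ) L) :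
    ∃ M : Measure ℝ, IsProbabilityMeasure M ∧
      L = Measure.conv (gaussianReal 0 (effInfo (toParam θ))⁻¹.toNNReal) M := by
  have := isProbabilityMeasure_law hθ
  refine (localModel hθ).exists_eq_conv (effInfo_pos hθ) (info_effDir_self hθ) (logLikRatio_zero θ)
    (Y := fun n x => √(n : ℝ) * (T n x - θ.2.2))
    (fun n => ((hT.1 n).sub_const _).const_mul _) fun t => ?_
  -- Only the perturbations t • `effDir` are needed; their tail coordinate is t, so the centring is
  -- the one of the one-dimensional theorem.
  have h1 := (tendstoLaw_localParam_iff hθ (symMat_isSymm _) T L).1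
    (hT.2 (toParam (t • effDir θ)) (symMat_isSymm _))
  rw [coord_toParam] at h1
  simpa [toParam, effDir] using h1

end Local

section Main

variable {locEst : ∀ n, Sample k n → Fin k → ℝ}
  {scatEst : ∀ n, Sample k n → Matrix (Fin k) (Fin k) ℝ} {tailEst : ∀ n, Sample k n → ℝ}

/-- The one-step estimator is regular, with the efficient limit law. -/
lemma isRegularAt_oneStep [NeZero k] {θ : Coord k} (hθ : θ ∈ coordSpace k)
    (loc_meas : ∀ n, Measurable (locEst n))
    (scat_meas : ∀ n i j, Measurable fun x => scatEst n x i j)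
    (tail_meas : ∀ n, Measurable (tailEst n)) (scat_symm : ∀ n x, (scatEst n x).IsSymm)
    (loc_root : RootNConsistent locEst fun V => V.1)
    (scat_root : RootNConsistent (F := Fin k → Fin k → ℝ)
      (fun n x i j => scatEst n x i j) fun V i j => V.2.1 i j)
    (tail_root : RootNConsistent tailEst fun V => V.2.2) :
    IsRegularAt (oneStep locEst scatEst tailEst) (toParam θ)
      (gaussianReal 0 (effInfo (toParam θ))⁻¹.toNNReal) := by
  have := isProbabilityMeasure_law hθ
  have hm := measurable_oneStep loc_meas scat_meas tail_meas scat_symm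
  refine ⟨hm, fun h hh => (tendstoLaw_localParam_iff hθ hh _ _).2 ?_⟩
  exact (localModel hθ).tendstoLaw_of_asymptotically_linear (effInfo_pos hθ) (info_effDir_self hθ)
    (κ := tailCoord k) (info_effDir hθ)
    (Y := fun n x => √(n : ℝ) * (oneStep locEst scatEst tailEst n x - θ.2.2))
    (fun n => ((hm n).sub_const _).const_mul _)
    (tendsto_oneStep_sub_centralSeq hθ scat_symm loc_root scat_root tail_root) (coord h)

end Main

end

end StudentT

end

theorem theorem3 (k : ℕ) (hk : 1 ≤ k)
    (locEst : ∀ n, StudentT.Sample k n → Fin k → ℝ)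
    (scatEst : ∀ n, StudentT.Sample k n → Matrix (Fin k) (Fin k) ℝ)
    (tailEst : ∀ n, StudentT.Sample k n → ℝ)
    (loc_meas : ∀ n, Measurable (locEst n))
    (scat_meas : ∀ n i j, Measurable fun x => scatEst n x i j)
    (tail_meas : ∀ n, Measurable (tailEst n))
    (scat_symm : ∀ n x, (scatEst n x).IsSymm)
    (loc_root : StudentT.RootNConsistent locEst fun V => V.1)
    (loc_discrete : StudentT.LocallyDiscrete locEst fun V => V.1)
    (scat_root : StudentT.RootNConsistent (F := Fin k → Fin k → ℝ)
      (fun n x i j => scatEst n x i j) fun V i j => V.2.1 i j)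
    (scat_discrete : StudentT.LocallyDiscrete (F := Fin k → Fin k → ℝ)
      (fun n x i j => scatEst n x i j) fun V i j => V.2.1 i j)
    (tail_root : StudentT.RootNConsistent tailEst fun V => V.2.2)
    (tail_discrete : StudentT.LocallyDiscrete tailEst fun V => V.2.2) :
    (∀ V ∈ StudentT.paramSpace k,
      (StudentT.infoSS V).PosDef ∧ 0 < StudentT.effInfo V ∧
      StudentT.TendstoLaw (fun n => StudentT.sampleLaw n V)
        (fun n x => √(n : ℝ) * (StudentT.oneStep locEst scatEst tailEst n x - V.2.2))
        (gaussianReal 0 (StudentT.effInfo V)⁻¹.toNNReal)) ∧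
    StudentT.IsAsymptoticallyEfficient (StudentT.oneStep locEst scatEst tailEst) := by
  have : NeZero k := ⟨by omega⟩
  have hreg : ∀ V ∈ StudentT.paramSpace k, StudentT.IsRegularAt
      (StudentT.oneStep locEst scatEst tailEst) V
      (gaussianReal 0 (StudentT.effInfo V)⁻¹.toNNReal) := fun V hV => by
    have h := StudentT.isRegularAt_oneStep (StudentT.coord_mem hV) loc_meas scat_meas tail_meas
      scat_symm loc_root scat_root tail_root
    rwa [StudentT.toParam_coord (StudentT.isSymm_of_mem_paramSpace hV)] at h
  refine ⟨fun V hV => ?_, fun V hV => ?_⟩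
  · have hV' := StudentT.coord_mem hV
    have h1 := StudentT.infoSS_posDef hV'
    have h2 := StudentT.effInfo_pos hV'
    rw [StudentT.toParam_coord (StudentT.isSymm_of_mem_paramSpace hV)] at h1 h2
    refine ⟨h1, h2, ?_⟩
    -- Asymptotic normality at `V` is regularity for the zero perturbation.
    have h3 := (hreg V hV).2 0 Matrix.isSymm_zero
    simpa [StudentT.localParam] using h3
  · refine ⟨_, inferInstance, hreg V hV, fun T' L' hL' hT' => ?_⟩
    rw [← StudentT.toParam_coord (StudentT.isSymm_of_mem_paramSpace hV)] at hT' ⊢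
    exact hT'.exists_eq_conv (StudentT.coord_mem hV)
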